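/- Let $a<c<b$ and let $q$ be a real-valued function that is continuous on $[a,c)$ and on $(c,b]$ and has finite limits $q(c\mp 0)$. Let $\alpha_{10},\alpha_{11},\alpha_{20},\alpha_{21},\alpha'_{20},\alpha'_{21},\beta^{\pm}_{ij}$ ($i=1,2$, $j=0,1$) be real. Consider on $[a,c)\cup(c,b]$ the problem $$-y''+q(x)y=\lambda y,\qquad \alpha_{10}y(a)+\alpha_{11}y'(a)=0,$$ $$\alpha_{20}y(b)-\alpha_{21}y'(b)+\lambda\big(\alpha'_{20}y(b)-\alpha'_{21}y'(b)\big)=0,$$ $$\beta^{-}_{i1}y'(c-)+\beta^{-}_{i0}y(c-)+\beta^{+}_{i1}y'(c+)+\beta^{+}_{i0}y(c+)=0\qquad(i=1,2).$$ Let $\Delta_{kj}$ be the determinant of the $k$-th and $j$-th columns of $$\begin{bmatrix}\beta^{+}_{10}&\beta^{+}_{11}&\beta^{-}_{10}&\beta^{-}_{11}\\ \beta^{+}_{20}&\beta^{+}_{21}&\beta^{-}_{20}&\beta^{-}_{21}\end{bmatrix},$$ and assume $\alpha_{21}\alpha'_{20}-\alpha_{20}\alpha'_{21}>0$, $\Delta_{12}>0$,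 $\Delta_{34}>0$, $\Delta_{24}\neq0$ and $(\alpha_{10},\alpha_{11})\neq(0,0)$. For $\lambda\in\mathbb C$ let $\varphi_\lambda$ be the solution of $-y''+qy=\lambda y$ on $[a,c)\cup(c,b]$ with $\varphi_\lambda(a)=\alpha_{11}$, $\varphi_\lambda'(a)=-\alpha_{10}$ and $$\varphi_\lambda(c+)=\tfrac1{\Delta_{12}}\big(\Delta_{23}\varphi_\lambda(c-)+\Delta_{24}\varphi_\lambda'(c-)\big),\qquad \varphi_\lambda'(c+)=-\tfrac1{\Delta_{12}}\big(\Delta_{13}\varphi_\lambda(c-)+\Delta_{14}\varphi_\lambda'(c-)\big);$$ it satisfies the boundary condition at $a$ and both transmission conditions. Define $\mu_{n,1},\mu_{n,2}$ for $n\in\mathbb Z$ by (i) if $\alpha'_{21}\ne0$, $\alpha_{11}\neq0$: $\mu_{n,1}=\frac{(n-2)\pi}{b-c}$, $\mu_{n,2}=\frac{n\pi}{a-c}$; (ii) if $\alpha'_{21}\ne0$, $\alpha_{11}=0$: $\mu_{n,1}=\frac{(n-1)\pi}{b-c}$, $\mu_{n,2}=\frac{(n+\frac12)\pi}{a-c}$;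 (iii) if $\alpha'_{21}=0$, $\alpha_{11}\neq0$: $\mu_{n,1}=\frac{(n+\frac12)\pi}{b-c}$, $\mu_{n,2}=\frac{(n-1)\pi}{a-c}$; (iv) if $\alpha'_{21}=0$, $\alpha_{11}=0$: $\mu_{n,1}=\frac{(n-\frac12)\pi}{b-c}$, $\mu_{n,2}=\frac{(n+\frac12)\pi}{a-c}$. Then all eigenvalues of the problem are real, and there are integers $N_1,N_2$ and numbers $s_{n,i}\in\mathbb C$ ($i=1,2$, $n\ge N_i$) such that the numbers $\lambda_{n,i}=s_{n,i}^2$ list every eigenvalue exactly once and $s_{n,i}=\mu_{n,i}+O(1/n)$ as $n\to\infty$. For every such listing and $i=1,2$, the function $\widetilde\varphi_{n,i}:=\varphi_{\lambda_{n,i}}$ is an eigenfunction for $\lambda_{n,i}$ for all $n\ge N_i$, and as $n\to\infty$ the following holds, each $O$ being uniform in $x$. If $\alpha_{11}\neq0$ (cases (i) and (iii)): $$\widetilde\varphi_{n,i}(x)=\begin{cases}\alpha_{11}\cos[\mu_{n,i}(x-a)]+O\left(\frac1n\right),&x\in[a,c),\\ -\alpha_{11}\frac{\Delta_{24}}{\Delta_{12}}\,\mu_{n,i}\sin[\mu_{n,i}(c-a)]\cos[\mu_{n,i}(x-c)]+O(1),&x\in(c,b].\end{cases}$$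 If $\alpha_{11}=0$ (cases (ii) and (iv)): $$\widetilde\varphi_{n,i}(x)=\begin{cases}-\frac{\alpha_{10}}{\mu_{n,i}}\sin[\mu_{n,i}(x-a)]+O\left(\frac1{n^2}\right),&x\in[a,c),\\ -\alpha_{10}\frac{\Delta_{24}}{\Delta_{12}}\cos[\mu_{n,i}(c-a)]\cos[\mu_{n,i}(x-c)]+O\left(\frac1n\right),&x\in(c,b].\end{cases}$$ -/

import Mathlib

open Set Filter Topology Asymptotics

noncomputable section

/-- The data of a Sturm–Liouville problem on `[a, c) ∪ (c, b]` with the spectral parameter in the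
boundary condition at `b` and with two transmission conditions at `c`.
`α20'`, `α21'` are the coefficients that are multiplied by the spectral parameter; `βm`, `βp` are
the coefficients of the limits at `c` from the left and from the right. -/
structure SLProblem where
  (a b c : ℝ)
  q : ℝ → ℝ
  (α10 α11 α20 α21 α20' α21' : ℝ)
  (βm10 βm11 βm20 βm21 βp10 βp11 βp20 βp21 : ℝ)

namespace SLProblem

variable (P : SLProblem)

/-- The domain `[a, c) ∪ (c, b]`. -/
def dom : Set ℝ := Ico P.a P.c ∪ Ioc P.c P.b

/-- The matrix of the transmission conditions; its first two columns belong to `c+`, its last two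
columns to `c-`, and in each pair the coefficient of the function comes before the coefficient of
the derivative. -/
def A : Matrix (Fin 2) (Fin 4) ℝ :=
  !![P.βp10, P.βp11, P.βm10, P.βm11;
     P.βp20, P.βp21, P.βm20, P.βm21]

/-- The determinant formed by two columns of `A`. Columns are counted from `0` here. -/
def minor (k j : Fin 4) : ℝ := P.A 0 k * P.A 1 j - P.A 0 j * P.A 1 k

def Δ12 : ℝ := P.minor 0 1
def Δ13 : ℝ := P.minor 0 2
def Δ14 : ℝ := P.minor 0 3
def Δ23 : ℝ := P.minor 1 2
def Δ24 : ℝ := P.minor 1 3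
def Δ34 : ℝ := P.minor 2 3

def Δ0 : ℝ := (!![P.α21, P.α20; P.α21', P.α20'] : Matrix (Fin 2) (Fin 2) ℝ).det

/-- The standing assumptions on the data. -/
structure Admissible : Prop where
  hac : P.a < P.c
  hcb : P.c < P.b
  q_left : ContinuousOn P.q (Ico P.a P.c)
  q_right : ContinuousOn P.q (Ioc P.c P.b)
  q_lim_left : ∃ l : ℝ, Tendsto P.q (𝓝[<] P.c) (𝓝 l)
  q_lim_right : ∃ l : ℝ, Tendsto P.q (𝓝[>] P.c) (𝓝 l)
  Δ0_pos : 0 < P.Δ0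
  Δ12_pos : 0 < P.Δ12
  Δ34_pos : 0 < P.Δ34

/-- The derivative on `[a, c) ∪ (c, b]` (one-sided at `a` and at `b`). -/
def D (y : ℝ → ℂ) : ℝ → ℂ := derivWithin y P.dom

/-- `y` is a (classical) solution of `-y'' + q y = lam y` on `[a, c) ∪ (c, b]`. -/
def SolvesEq (lam : ℂ) (y : ℝ → ℂ) : Prop :=
  DifferentiableOn ℝ y P.dom ∧ DifferentiableOn ℝ (P.D y) P.dom ∧
    ∀ x ∈ P.dom, -P.D (P.D y) x + (P.q x : ℂ) * y x = lam * y x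

/-- The boundary condition at `a`. -/
def BoundaryA (y : ℝ → ℂ) : Prop :=
  (P.α10 : ℂ) * y P.a + (P.α11 : ℂ) * P.D y P.a = 0

/-- The boundary condition at `b`. -/
def BoundaryB (lam : ℂ) (y : ℝ → ℂ) : Prop :=
  (P.α20 : ℂ) * y P.b - (P.α21 : ℂ) * P.D y P.b
    + lam * ((P.α20' : ℂ) * y P.b - (P.α21' : ℂ) * P.D y P.b) = 0

/-- Both transmission conditions at `c`, between the one-sided limits of `y` and of `y'`. -/
def Transmission (y : ℝ → ℂ) : Prop :=
  ∃ um vm up vp : ℂ,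
    Tendsto y (𝓝[<] P.c) (𝓝 um) ∧ Tendsto (P.D y) (𝓝[<] P.c) (𝓝 vm) ∧
    Tendsto y (𝓝[>] P.c) (𝓝 up) ∧ Tendsto (P.D y) (𝓝[>] P.c) (𝓝 vp) ∧
    (P.βm11 : ℂ) * vm + (P.βm10 : ℂ) * um + (P.βp11 : ℂ) * vp + (P.βp10 : ℂ) * up = 0 ∧
    (P.βm21 : ℂ) * vm + (P.βm20 : ℂ) * um + (P.βp21 : ℂ) * vp + (P.βp20 : ℂ) * up = 0

/-- `y` is an eigenfunction of the problem for the eigenvalue `lam`. -/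
def IsEigenfunction (lam : ℂ) (y : ℝ → ℂ) : Prop :=
  P.SolvesEq lam y ∧ P.BoundaryA y ∧ P.BoundaryB lam y ∧ P.Transmission y ∧
    ∃ x ∈ P.dom, y x ≠ 0

/-- The set of all (complex) eigenvalues of the problem. -/
def eigenvalues : Set ℂ := {lam | ∃ y, P.IsEigenfunction lam y}

/-- Successive approximations for `-y'' + q y = lam y`, `y(x₀) = u`, `y'(x₀) = v`. -/
def picard (q : ℝ → ℝ) (lam : ℂ) (x₀ : ℝ) (u v : ℂ) : ℕ → ℝ → ℂ
  | 0 => fun x => u + v * ((x - x₀ : ℝ) : ℂ)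
  | n + 1 => fun x => u + v * ((x - x₀ : ℝ) : ℂ)
      + ∫ z in x₀..x, ((x - z : ℝ) : ℂ) * (((q z : ℝ) : ℂ) - lam) * picard q lam x₀ u v n z

/-- The solution of the initial value problem `-y'' + q y = lam y`, `y(x₀) = u`, `y'(x₀) = v`,
as the sum of the series of successive approximations. -/
def ivp (q : ℝ → ℝ) (lam : ℂ) (x₀ : ℝ) (u v : ℂ) (x : ℝ) : ℂ :=
  picard q lam x₀ u v 0 x
    + ∑' n : ℕ, (picard q lam x₀ u v (n + 1) x - picard q lam x₀ u v n x)

/-- The solution on `[a, c)` with `y(a) = α11`, `y'(a) = -α10` (extended continuously to `c`). -/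
def phi₁ (lam : ℂ) : ℝ → ℂ := ivp P.q lam P.a (P.α11 : ℂ) (-(P.α10 : ℂ))

/-- The value of the left solution at `c-`. -/
def phi₁c (lam : ℂ) : ℂ := P.phi₁ lam P.c

/-- The value of the derivative of the left solution at `c-`. -/
def dphi₁c (lam : ℂ) : ℂ := derivWithin (P.phi₁ lam) (Icc P.a P.c) P.c

/-- The initial value `y(c+)` of the right solution. -/
def phi₂c (lam : ℂ) : ℂ :=
  1 / (P.Δ12 : ℂ) * ((P.Δ23 : ℂ) * P.phi₁c lam + (P.Δ24 : ℂ) * P.dphi₁c lam)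

/-- The initial value `y'(c+)` of the right solution. -/
def dphi₂c (lam : ℂ) : ℂ :=
  -1 / (P.Δ12 : ℂ) * ((P.Δ13 : ℂ) * P.phi₁c lam + (P.Δ14 : ℂ) * P.dphi₁c lam)

/-- The solution on `(c, b]` with the above initial values at `c+`. -/
def phi₂ (lam : ℂ) : ℝ → ℂ := ivp P.q lam P.c (P.phi₂c lam) (P.dphi₂c lam)

/-- The basic solution: `phi₁` on `[a, c)` and `phi₂` on `(c, b]`. -/
def phi (lam : ℂ) (x : ℝ) : ℂ := if x < P.c then P.phi₁ lam x else P.phi₂ lam x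

/-- The defining properties of the basic solution: it solves the differential equation, has the
initial values `α11`, `-α10` at `a`, and satisfies both transmission conditions. -/
def IsBasicSolution (lam : ℂ) (y : ℝ → ℂ) : Prop :=
  P.SolvesEq lam y ∧ y P.a = P.α11 ∧ P.D y P.a = -(P.α10 : ℂ) ∧ P.Transmission y

open Classical in
/-- The leading terms of the square roots of the eigenvalues; `0` and `1` stand for the first and
for the second sequence. -/
def mu (i : Fin 2) (n : ℤ) : ℝ :=
  if P.α21' ≠ 0 then
    if P.α11 ≠ 0 then
      ![((n : ℝ) - 2) * Real.pi / (P.b - P.c), (n : ℝ) * Real.pi / (P.a - P.c)] i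
    else
      ![((n : ℝ) - 1) * Real.pi / (P.b - P.c), ((n : ℝ) + 1 / 2) * Real.pi / (P.a - P.c)] i
  else
    if P.α11 ≠ 0 then
      ![((n : ℝ) + 1 / 2) * Real.pi / (P.b - P.c), ((n : ℝ) - 1) * Real.pi / (P.a - P.c)] i
    else
      ![((n : ℝ) - 1 / 2) * Real.pi / (P.b - P.c), ((n : ℝ) + 1 / 2) * Real.pi / (P.a - P.c)] i

/-- `s i n ^ 2`, for `i = 0, 1` and integers `n ≥ N i`, lists every eigenvalue exactly once, and
`s i n = mu i n + O(1/n)`. -/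
def IsEnumeration (N : Fin 2 → ℤ) (s : Fin 2 → ℤ → ℂ) : Prop :=
  BijOn (fun p : Fin 2 × ℤ => s p.1 p.2 ^ 2) {p | N p.1 ≤ p.2} P.eigenvalues ∧
    ∀ i, (fun n : ℤ => s i n - (P.mu i n : ℂ)) =O[atTop] (fun n : ℤ => 1 / (n : ℝ))

end SLProblem

/-- `F n x = G n x + O(g n)` as `n → ∞`, uniformly for `x ∈ S`. -/
def UniformBigO (S : Set ℝ) (F : ℤ → ℝ → ℂ) (G : ℤ → ℝ → ℝ) (g : ℤ → ℝ) : Prop :=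
  ∃ C : ℝ, ∃ n₀ : ℤ, ∀ n ≥ n₀, ∀ x ∈ S, ‖F n x - (G n x : ℂ)‖ ≤ C * |g n|

end

/-!
The eigenvalues are the zeros of an entire function, the characteristic function
`ω(λ) = α20 φ(b) - α21 φ'(b) + λ (α20' φ(b) - α21' φ'(b))` of the basic solution `φ = φ_λ`
(`SLProblem.Ext.mem_eigenvalues_iff`), because every solution of the conditions at `a` and at `c`
is a multiple of `φ_λ`. The potential is replaced on either side of `c` by a bounded continuous
function on the line (`SLProblem.Ext`), for which the successive approximations converge to a
solution of the initial value problem that is holomorphic in `λ`.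

*Reality and simplicity.* Lagrange's identity on both intervals, the transmission conditions and
the boundary condition give `ω(λ) U(μ) - ω(μ) U(λ) = (λ - μ) E(λ, μ)` with
`U = α20' φ(b) - α21' φ'(b)` and a bilinear form `E` that is positive at conjugate parameters
(`SLProblem.Ext.charFun_mul_bdry_sub`, `SLProblem.Ext.energy_conj_ne_zero`). Hence the zeros of
`ω` are real and simple.

*Location.* With `λ = s ^ 2`, variation of constants (`SLProblem.IsSol.asymptotics`) shows that
`Δ12 ω(s ^ 2)` is, up to a power of `s`, a product of constants and of two sines `V` and `W`,
which belong to `[a, c]` and to `[c, b]`, with the error `O((|V| + |W|) / s + 1 / s ^ 2)` relative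
to the exponential growth (`SLProblem.Ext.charFun_asymptotics`). The zeros of the sines are
`± mu i n`. In the `λ`-plane their squares have growing gaps within each of the two sequences, but
squares from different sequences may come arbitrarily close or coincide. The error estimate is
sharp enough for Rouché's theorem on circles that stay at a fixed distance `K` from all these
squares, so that a single square has one eigenvalue nearby and a close pair has two
(`SLProblem.Ext.eigenvalue_count`). A combinatorial argument (`exists_listing_of_count`) turns the
counts into a listing of all eigenvalues, the finitely many remaining ones being added at the
beginning of the first sequence, and `|λ - mu ^ 2| = O(1)` gives `s = mu + O(1/n)`.

*Eigenfunctions.* For any such listing, the asymptotic formulas for solutions are applied with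
`s = s i n` on both intervals, and `s i n` is replaced by `mu i n` in them; the imaginary part of
`s i n` is bounded, and `sin` and `cos` are Lipschitz in horizontal strips. All estimates are
`O`-terms along `atTop ×ˢ 𝓟 S`, which makes them uniform in `x ∈ S`.
-/

/-! ### The initial value problem -/

namespace SLProblem

section Picard

variable {q : ℝ → ℝ} {x₀ : ℝ}

theorem continuous_picard (hq : Continuous q) (u v : ℂ) (n : ℕ) :
    Continuous fun p : ℂ × ℝ => picard q p.1 x₀ u v n p.2 := by
  induction n with
  | zero => simp only [picard]; fun_prop
  | succ n ih =>
    simp only [picard]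
    refine Continuous.add (by fun_prop) ?_
    refine intervalIntegral.continuous_parametric_intervalIntegral_of_continuous
      (f := fun (p : ℂ × ℝ) z => ((p.2 - z : ℝ) : ℂ) * (((q z : ℝ) : ℂ) - p.1)
        * picard q p.1 x₀ u v n z) ?_ continuous_snd
    have h2 : Continuous fun r : (ℂ × ℝ) × ℝ => picard q r.1.1 x₀ u v n r.2 :=
      ih.comp (continuous_fst.fst.prodMk continuous_snd)
    change Continuous fun r : (ℂ × ℝ) × ℝ => ((r.1.2 - r.2 : ℝ) : ℂ) * (((q r.2 : ℝ) : ℂ) - r.1.1)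
        * picard q r.1.1 x₀ u v n r.2
    fun_prop

theorem continuous_picard_right (hq : Continuous q) (lam u v : ℂ) (n : ℕ) :
    Continuous (picard q lam x₀ u v n) :=
  (continuous_picard hq u v n).comp (continuous_const.prodMk continuous_id)

/-- One step of the factorial estimate for iterated Volterra integrals. -/
theorem norm_volterra_le {Q Λ B M x : ℝ} {lam : ℂ} {g : ℝ → ℂ} {n : ℕ} (hq : Continuous q)
    (hQ : ∀ z, |q z| ≤ Q) (hl : ‖lam‖ ≤ Λ) (hx : |x - x₀| ≤ B) (hg : Continuous g)
    (hgb : ∀ z, |z - x₀| ≤ B → ‖g z‖ ≤ M * ((B * (Q + Λ)) * |z - x₀|) ^ n / n.factorial) :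
    ‖∫ z in x₀..x, ((x - z : ℝ) : ℂ) * (((q z : ℝ) : ℂ) - lam) * g z‖
      ≤ M * ((B * (Q + Λ)) * |x - x₀|) ^ (n + 1) / (n + 1).factorial := by
  have hB : 0 ≤ B := (abs_nonneg _).trans hx
  have hQ0 : 0 ≤ Q := (abs_nonneg _).trans (hQ 0)
  have hΛ : 0 ≤ Λ := (norm_nonneg _).trans hl
  refine (intervalIntegral.norm_integral_le_integral_norm_uIoc).trans ?_
  set K := B * (Q + Λ) with hK
  have hK0 : 0 ≤ K := by positivity
  have key : ∀ z ∈ uIoc x₀ x, ‖((x - z : ℝ) : ℂ) * (((q z : ℝ) : ℂ) - lam) * g z‖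
      ≤ K * (M * K ^ n / n.factorial) * |z - x₀| ^ n := by
    intro z hz
    have hz' := uIoc_subset_uIcc hz
    have h1 : |x - z| ≤ B := (abs_sub_right_of_mem_uIcc hz').trans hx
    have h2 : |z - x₀| ≤ B := (abs_sub_left_of_mem_uIcc hz').trans hx
    have h3 : ‖((q z : ℝ) : ℂ) - lam‖ ≤ Q + Λ := (norm_sub_le _ _).trans
      (add_le_add (by simpa using hQ z) hl)
    rw [norm_mul, norm_mul, Complex.norm_real, Real.norm_eq_abs]
    calc |x - z| * ‖((q z : ℝ) : ℂ) - lam‖ * ‖g z‖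
        ≤ B * (Q + Λ) * (M * (K * |z - x₀|) ^ n / n.factorial) := by
          gcongr
          exact hgb z h2
      _ = _ := by rw [mul_pow, hK]; ring
  calc ∫ z in uIoc x₀ x, ‖((x - z : ℝ) : ℂ) * (((q z : ℝ) : ℂ) - lam) * g z‖
      ≤ ∫ z in uIoc x₀ x, K * (M * K ^ n / n.factorial) * |z - x₀| ^ n := by
        refine MeasureTheory.setIntegral_mono_on ?_ ?_ measurableSet_uIoc key
        · exact (Continuous.integrableOn_uIoc (by fun_prop))
        · exact (Continuous.integrableOn_uIoc (by fun_prop))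
    _ = _ := by
        rw [MeasureTheory.integral_const_mul, integral_pow_abs_sub_uIoc, Nat.factorial_succ]
        push_cast
        clear_value K
        field_simp
        ring

theorem norm_picard_succ_sub_le {Q Λ B x : ℝ} {lam : ℂ} (hq : Continuous q)
    (hQ : ∀ z, |q z| ≤ Q) (hl : ‖lam‖ ≤ Λ) (hx : |x - x₀| ≤ B) (u v : ℂ) (n : ℕ) :
    ‖picard q lam x₀ u v (n + 1) x - picard q lam x₀ u v n x‖
      ≤ (‖u‖ + ‖v‖ * B) * ((B * (Q + Λ)) * |x - x₀|) ^ (n + 1) / (n + 1).factorial := by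
  have hB : 0 ≤ B := (abs_nonneg _).trans hx
  induction n generalizing x with
  | zero =>
    have : picard q lam x₀ u v (0 + 1) x - picard q lam x₀ u v 0 x
        = ∫ z in x₀..x, ((x - z : ℝ) : ℂ) * (((q z : ℝ) : ℂ) - lam)
          * picard q lam x₀ u v 0 z := by
      simp [picard]
    rw [this]
    refine norm_volterra_le hq hQ hl hx (continuous_picard_right hq _ _ _ _) ?_
    intro z hz
    simp only [picard, pow_zero, Nat.factorial_zero, Nat.cast_one, mul_one, div_one]
    refine (norm_add_le _ _).trans ?_
    rw [norm_mul, Complex.norm_real, Real.norm_eq_abs]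
    gcongr
  | succ n ih =>
    have hc := fun n => continuous_picard_right (x₀ := x₀) hq lam u v n
    have : picard q lam x₀ u v (n + 1 + 1) x - picard q lam x₀ u v (n + 1) x
        = ∫ z in x₀..x, ((x - z : ℝ) : ℂ) * (((q z : ℝ) : ℂ) - lam)
          * (picard q lam x₀ u v (n + 1) z - picard q lam x₀ u v n z) := by
      rw [picard, picard, add_sub_add_left_eq_sub, ← intervalIntegral.integral_sub]
      · simp only [mul_sub]
      · have h1 := hc (n + 1)
        exact Continuous.intervalIntegrable (by fun_prop) _ _
      · have := hc n
        exact Continuous.intervalIntegrable (by fun_prop) _ _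
    rw [this]
    exact norm_volterra_le hq hQ hl hx
      ((continuous_picard_right hq _ _ _ _).sub (continuous_picard_right hq _ _ _ _))
      (fun z hz => ih hz)

theorem summable_picardBound (M K : ℝ) :
    Summable fun n : ℕ => M * K ^ (n + 1) / (n + 1).factorial := by
  have := (Real.summable_pow_div_factorial K).comp_injective (add_left_injective 1)
  simpa [Function.comp_def, mul_div_assoc] using this.mul_left M

theorem norm_picard_succ_sub_le' {Q Λ B x : ℝ} {lam : ℂ} (hq : Continuous q)
    (hQ : ∀ z, |q z| ≤ Q) (hl : ‖lam‖ ≤ Λ) (hx : |x - x₀| ≤ B) (u v : ℂ) (n : ℕ) :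
    ‖picard q lam x₀ u v (n + 1) x - picard q lam x₀ u v n x‖
      ≤ (‖u‖ + ‖v‖ * B) * ((B * (Q + Λ)) * B) ^ (n + 1) / (n + 1).factorial := by
  have hB : 0 ≤ B := (abs_nonneg _).trans hx
  have hQ0 : 0 ≤ Q := (abs_nonneg _).trans (hQ 0)
  have hΛ : 0 ≤ Λ := (norm_nonneg _).trans hl
  refine (norm_picard_succ_sub_le hq hQ hl hx u v n).trans ?_
  gcongr

/-- Joint continuity in the spectral parameter and in `x`, from the locally uniform convergence of
the successive approximations. -/
theorem continuous_ivp {Q : ℝ} (hq : Continuous q) (hQ : ∀ z, |q z| ≤ Q) (u v : ℂ) :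
    Continuous fun p : ℂ × ℝ => ivp q p.1 x₀ u v p.2 := by
  refine continuous_iff_continuousAt.2 fun p => ?_
  set Λ := ‖p.1‖ + 1
  set B := |p.2 - x₀| + 1
  have hU : {r : ℂ × ℝ | ‖r.1‖ < Λ ∧ |r.2 - x₀| < B} ∈ 𝓝 p := by
    refine IsOpen.mem_nhds ?_ ⟨by simp [Λ], by simp [B]⟩
    exact (isOpen_lt continuous_fst.norm continuous_const).inter
      (isOpen_lt (continuous_snd.sub continuous_const).abs continuous_const)
  refine ContinuousOn.continuousAt ?_ hU
  unfold ivp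
  refine (continuous_picard hq u v 0).continuousOn.add ?_
  refine continuousOn_tsum (fun n => ((continuous_picard hq u v (n + 1)).sub
    (continuous_picard hq u v n)).continuousOn)
    (summable_picardBound (‖u‖ + ‖v‖ * B) ((B * (Q + Λ)) * B)) ?_
  intro n r hr
  exact norm_picard_succ_sub_le' hq hQ hr.1.le hr.2.le u v n

theorem continuous_ivp_right {Q : ℝ} (hq : Continuous q) (hQ : ∀ z, |q z| ≤ Q) (lam u v : ℂ) :
    Continuous (ivp q lam x₀ u v) :=
  (continuous_ivp hq hQ u v).comp (continuous_const.prodMk continuous_id)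

theorem tendsto_picard {Q : ℝ} (hq : Continuous q) (hQ : ∀ z, |q z| ≤ Q) (lam u v : ℂ) (x : ℝ) :
    Tendsto (fun n => picard q lam x₀ u v n x) atTop (𝓝 (ivp q lam x₀ u v x)) := by
  have hs : Summable fun n => picard q lam x₀ u v (n + 1) x - picard q lam x₀ u v n x :=
    Summable.of_norm_bounded (summable_picardBound _ _)
      (fun n => norm_picard_succ_sub_le' hq hQ le_rfl (le_refl |x - x₀|) u v n)
  have h := hs.hasSum.tendsto_sum_nat.const_add (picard q lam x₀ u v 0 x)
  refine h.congr fun n => ?_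
  rw [Finset.sum_range_sub fun n => picard q lam x₀ u v n x]
  ring

/-- The sum of the successive approximations solves the Volterra integral equation that is
equivalent to the initial value problem. -/
theorem ivp_eq {Q : ℝ} (hq : Continuous q) (hQ : ∀ z, |q z| ≤ Q) (lam u v : ℂ) (x : ℝ) :
    ivp q lam x₀ u v x = u + v * ((x - x₀ : ℝ) : ℂ)
      + ∫ z in x₀..x, ((x - z : ℝ) : ℂ) * (((q z : ℝ) : ℂ) - lam) * ivp q lam x₀ u v z := by
  refine tendsto_nhds_unique ((tendsto_picard hq hQ lam u v x).comp (tendsto_add_atTop_nat 1)) ?_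
  simp only [Function.comp_def, picard]
  refine Tendsto.const_add _ ?_
  set B := |x - x₀| with hB
  set b : ℕ → ℝ := fun n => (‖u‖ + ‖v‖ * B) * ((B * (Q + ‖lam‖)) * B) ^ (n + 1) /
    (n + 1).factorial with hb
  have hQ0 : 0 ≤ Q := (abs_nonneg _).trans (hQ 0)
  have hB0 : 0 ≤ B := abs_nonneg _
  have hb0 : ∀ n, 0 ≤ b n := fun n => by positivity
  have hbs : Summable b := summable_picardBound _ _
  set A := ‖u‖ + ‖v‖ * B + ∑' n, b n
  have hbound : ∀ n z, |z - x₀| ≤ B → ‖picard q lam x₀ u v n z‖ ≤ A := by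
    intro n z hz
    have h1 : picard q lam x₀ u v n z = picard q lam x₀ u v 0 z
        + ∑ i ∈ Finset.range n, (picard q lam x₀ u v (i + 1) z - picard q lam x₀ u v i z) := by
      rw [Finset.sum_range_sub fun n => picard q lam x₀ u v n z]; ring
    rw [h1]
    refine (norm_add_le _ _).trans (add_le_add ?_ ?_)
    · simp only [picard]
      refine (norm_add_le _ _).trans ?_
      rw [norm_mul, Complex.norm_real, Real.norm_eq_abs]
      gcongr
    · refine (norm_sum_le _ _).trans ?_
      refine (Finset.sum_le_sum fun i _ => norm_picard_succ_sub_le' hq hQ le_rfl hz u v i).trans ?_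
      exact hbs.sum_le_tsum _ (fun i _ => hb0 i)
  have hc := fun n => (continuous_picard_right (x₀ := x₀) hq lam u v n)
  refine intervalIntegral.tendsto_integral_filter_of_dominated_convergence
    (fun _ => B * (Q + ‖lam‖) * A) ?_ ?_ intervalIntegrable_const ?_
  · refine Eventually.of_forall fun n => ?_
    have := hc n
    exact Continuous.aestronglyMeasurable (by fun_prop)
  · refine Eventually.of_forall fun n => Eventually.of_forall fun z hz => ?_
    have hz' := uIoc_subset_uIcc hz
    have h1 : |x - z| ≤ B := abs_sub_right_of_mem_uIcc hz'
    have h2 : |z - x₀| ≤ B := abs_sub_left_of_mem_uIcc hz'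
    have h3 : ‖((q z : ℝ) : ℂ) - lam‖ ≤ Q + ‖lam‖ := (norm_sub_le _ _).trans
      (add_le_add (by simpa using hQ z) le_rfl)
    rw [norm_mul, norm_mul, Complex.norm_real, Real.norm_eq_abs]
    have := hbound n z h2
    gcongr
  · refine Eventually.of_forall fun z _ => ?_
    exact (tendsto_picard hq hQ lam u v z).const_mul _

end Picard

/-- `y` solves `-y'' + q y = lam y` on the whole line, and `y'` is its derivative. -/
structure IsSol (q : ℝ → ℝ) (lam : ℂ) (y y' : ℝ → ℂ) : Prop where
  hasDerivAt : ∀ x, HasDerivAt y (y' x) x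
  hasDerivAt' : ∀ x, HasDerivAt y' ((((q x : ℝ) : ℂ) - lam) * y x) x

/-- The derivative of `ivp`, in integrated form. -/
noncomputable def divp (q : ℝ → ℝ) (lam : ℂ) (x₀ : ℝ) (u v : ℂ) (x : ℝ) : ℂ :=
  v + ∫ z in x₀..x, (((q z : ℝ) : ℂ) - lam) * ivp q lam x₀ u v z

section Solution

variable {q : ℝ → ℝ} {x₀ : ℝ}

theorem ivp_self {Q : ℝ} (hq : Continuous q) (hQ : ∀ z, |q z| ≤ Q) (lam u v : ℂ) :
    ivp q lam x₀ u v x₀ = u := by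
  rw [ivp_eq hq hQ]; simp

@[simp] theorem divp_self (lam u v : ℂ) : divp q lam x₀ u v x₀ = v := by
  simp [divp]

/-- Differentiating the integral equation twice: its kernel is `x - z`, so the first derivative is
`divp`. -/
theorem isSol_ivp {Q : ℝ} (hq : Continuous q) (hQ : ∀ z, |q z| ≤ Q) (lam u v : ℂ) :
    IsSol q lam (ivp q lam x₀ u v) (divp q lam x₀ u v) := by
  have hy := continuous_ivp_right (x₀ := x₀) hq hQ lam u v
  set y := ivp q lam x₀ u v with hydef
  set g : ℝ → ℂ := fun z => (((q z : ℝ) : ℂ) - lam) * y z with hg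
  have hgc : Continuous g := by fun_prop
  have hd : ∀ {h : ℝ → ℂ} (_ : Continuous h) (x : ℝ),
      HasDerivAt (fun x => ∫ z in x₀..x, h z) (h x) x := fun hh x =>
    intervalIntegral.integral_hasDerivAt_right (hh.intervalIntegrable _ _)
      (hh.stronglyMeasurableAtFilter _ _) hh.continuousAt
  constructor
  · intro x
    have e : y = fun x : ℝ => u + v * ((x - x₀ : ℝ) : ℂ) + ((x : ℂ) * ∫ z in x₀..x, g z)
        - ∫ z in x₀..x, (z : ℂ) * g z := by
      funext x
      rw [hydef, ivp_eq hq hQ, ← intervalIntegral.integral_const_mul, add_sub_assoc,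
        ← intervalIntegral.integral_sub]
      · congr 1
        refine intervalIntegral.integral_congr fun z _ => ?_
        simp only [hg, hydef]
        push_cast
        ring
      · exact Continuous.intervalIntegrable (by fun_prop) _ _
      · exact Continuous.intervalIntegrable (by fun_prop) _ _
    have hx : HasDerivAt (fun x : ℝ => (x : ℂ)) 1 x := Complex.ofRealCLM.hasDerivAt
    have hx' : HasDerivAt (fun x : ℝ => ((x - x₀ : ℝ) : ℂ)) 1 x := by
      simpa using hx.sub_const (x₀ : ℂ)
    rw [e]
    refine ((((hx'.const_mul v).const_add u).add (hx.mul (hd hgc x))).sub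
      (hd (h := fun z => (z : ℂ) * g z) (by fun_prop) x)).congr_deriv ?_
    change _ = v + ∫ z in x₀..x, g z
    ring
  · intro x
    exact (hd hgc x).const_add v

end Solution

end SLProblem

/-! ### Wronskians, dependence on the parameter, and asymptotics of solutions -/

namespace SLProblem

/-- `y` solves `-y'' + q y = lam y` on the set `s`, with derivatives taken within `s`. -/
structure IsSolOn (q : ℝ → ℝ) (lam : ℂ) (s : Set ℝ) (y y' : ℝ → ℂ) : Prop where
  hasDerivWithinAt : ∀ x ∈ s, HasDerivWithinAt y (y' x) s x
  hasDerivWithinAt' : ∀ x ∈ s, HasDerivWithinAt y' ((((q x : ℝ) : ℂ) - lam) * y x) s x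

section Wronskian

variable {q : ℝ → ℝ} {x₀ : ℝ} {lam mu : ℂ} {y y' z z' : ℝ → ℂ}

theorem IsSol.isSolOn (h : IsSol q lam y y') (s : Set ℝ) : IsSolOn q lam s y y' :=
  ⟨fun x _ => (h.hasDerivAt x).hasDerivWithinAt, fun x _ => (h.hasDerivAt' x).hasDerivWithinAt⟩

theorem IsSol.continuous (h : IsSol q lam y y') : Continuous y :=
  continuous_iff_continuousAt.2 fun x => (h.hasDerivAt x).continuousAt

theorem IsSol.continuous' (h : IsSol q lam y y') : Continuous y' :=
  continuous_iff_continuousAt.2 fun x => (h.hasDerivAt' x).continuousAt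

/-- Lagrange's identity: the Wronskian of two solutions for `lam` and `mu` has the derivative
`(lam - mu) y z`. -/
theorem IsSol.lagrange (hy : IsSol q lam y y') (hz : IsSol q mu z z') (a b : ℝ) :
    (y b * z' b - y' b * z b) - (y a * z' a - y' a * z a)
      = (lam - mu) * ∫ x in a..b, y x * z x := by
  have hyc := hy.continuous
  have hzc := hz.continuous
  rw [← intervalIntegral.integral_const_mul]
  symm
  refine intervalIntegral.integral_eq_sub_of_hasDerivAt
    (f := fun x => y x * z' x - y' x * z x) (fun x _ => ?_)
    (Continuous.intervalIntegrable (by fun_prop) _ _)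
  refine (((hy.hasDerivAt x).mul (hz.hasDerivAt' x)).sub
    ((hy.hasDerivAt' x).mul (hz.hasDerivAt x))).congr_deriv ?_
  ring

/-- The Wronskian of two solutions for the same spectral parameter is constant. -/
theorem IsSolOn.wronskian_eq {s : Set ℝ} (hs : Convex ℝ s) (hy : IsSolOn q lam s y y')
    (hz : IsSol q lam z z') {x x' : ℝ} (hx : x ∈ s) (hx' : x' ∈ s) :
    y x * z' x - y' x * z x = y x' * z' x' - y' x' * z x' := by
  have hz' := hz.isSolOn s
  have key : ∀ t ∈ s, HasDerivWithinAt (fun x => y x * z' x - y' x * z x) 0 s t := by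
    intro t ht
    refine (((hy.hasDerivWithinAt t ht).mul (hz'.hasDerivWithinAt' t ht)).sub
      ((hy.hasDerivWithinAt' t ht).mul (hz'.hasDerivWithinAt t ht))).congr_deriv ?_
    ring
  have := hs.norm_image_sub_le_of_norm_hasDerivWithin_le (C := 0) key (by simp) hx' hx
  simpa [sub_eq_zero] using this

/-- A solution is determined by its Wronskians with a pair of solutions of Wronskian `1`. -/
theorem eq_of_wronskian {c c' s s' y y' u v : ℂ} (h : c * s' - c' * s = 1)
    (h1 : y * c' - y' * c = -v) (h2 : y * s' - y' * s = u) :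
    y = u * c + v * s ∧ y' = u * c' + v * s' := by
  constructor
  · linear_combination (-y) * h - s * h1 + c * h2
  · linear_combination (-y') * h - s' * h1 + c' * h2

variable {Q : ℝ}

theorem wronskian_basis (hq : Continuous q) (hQ : ∀ z, |q z| ≤ Q) (x : ℝ) :
    ivp q lam x₀ 1 0 x * divp q lam x₀ 0 1 x - divp q lam x₀ 1 0 x * ivp q lam x₀ 0 1 x = 1 := by
  rw [((isSol_ivp hq hQ lam 1 0).isSolOn univ).wronskian_eq convex_univ (isSol_ivp hq hQ lam 0 1)
    (mem_univ x) (mem_univ x₀)]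
  simp [ivp_self hq hQ]

/-- A solution on an interval that has the limits `u`, `v` (of itself and of its derivative)
at the point `x₀` of the closure is the corresponding combination of the basis at `x₀`. -/
theorem IsSolOn.eq_basis (hq : Continuous q) (hQ : ∀ z, |q z| ≤ Q) {s : Set ℝ} (hs : Convex ℝ s)
    (hy : IsSolOn q lam s y y') {l : Filter ℝ} [l.NeBot] (hl : l ≤ 𝓝 x₀) (hls : ∀ᶠ x in l, x ∈ s)
    {u v : ℂ} (hu : Tendsto y l (𝓝 u)) (hv : Tendsto y' l (𝓝 v)) {x : ℝ} (hx : x ∈ s) :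
    y x = u * ivp q lam x₀ 1 0 x + v * ivp q lam x₀ 0 1 x ∧
      y' x = u * divp q lam x₀ 1 0 x + v * divp q lam x₀ 0 1 x := by
  have key : ∀ z z', IsSol q lam z z' → y x * z' x - y' x * z x = u * z' x₀ - v * z x₀ := by
    intro z z' hz
    have h1 : Tendsto (fun x => y x * z' x - y' x * z x) l (𝓝 (u * z' x₀ - v * z x₀)) :=
      (hu.mul ((hz.continuous'.tendsto x₀).mono_left hl)).sub
        (hv.mul ((hz.continuous.tendsto x₀).mono_left hl))
    refine tendsto_nhds_unique (tendsto_const_nhds.congr' ?_) h1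
    filter_upwards [hls] with t ht
    exact hy.wronskian_eq hs hz hx ht
  refine eq_of_wronskian (wronskian_basis hq hQ x) ?_ ?_
  · rw [key _ _ (isSol_ivp hq hQ lam 1 0)]; simp [ivp_self hq hQ]
  · rw [key _ _ (isSol_ivp hq hQ lam 0 1)]; simp [ivp_self hq hQ]

theorem IsSol.eq_basis (hq : Continuous q) (hQ : ∀ z, |q z| ≤ Q) (hy : IsSol q lam y y')
    (x₀ x : ℝ) :
    y x = y x₀ * ivp q lam x₀ 1 0 x + y' x₀ * ivp q lam x₀ 0 1 x ∧
      y' x = y x₀ * divp q lam x₀ 1 0 x + y' x₀ * divp q lam x₀ 0 1 x :=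
  (hy.isSolOn univ).eq_basis hq hQ convex_univ le_rfl (by simp) (hy.continuous.tendsto x₀)
    (hy.continuous'.tendsto x₀) (mem_univ x)

theorem ivp_eq_basis (hq : Continuous q) (hQ : ∀ z, |q z| ≤ Q) (lam u v : ℂ) (x₀ x : ℝ) :
    ivp q lam x₀ u v x = u * ivp q lam x₀ 1 0 x + v * ivp q lam x₀ 0 1 x ∧
      divp q lam x₀ u v x = u * divp q lam x₀ 1 0 x + v * divp q lam x₀ 0 1 x := by
  simpa [ivp_self hq hQ] using (isSol_ivp (x₀ := x₀) hq hQ lam u v).eq_basis hq hQ x₀ x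

/-- For a real potential, conjugation of the spectral parameter and of the initial values
conjugates the solution. -/
theorem ivp_conj (hq : Continuous q) (hQ : ∀ z, |q z| ≤ Q) (lam u v : ℂ) (x₀ x : ℝ) :
    ivp q (star lam) x₀ (star u) (star v) x = star (ivp q lam x₀ u v x) ∧
      divp q (star lam) x₀ (star u) (star v) x = star (divp q lam x₀ u v x) := by
  have h := isSol_ivp (x₀ := x₀) hq hQ lam u v
  have h' : IsSol q (star lam) (fun x => star (ivp q lam x₀ u v x))
      (fun x => star (divp q lam x₀ u v x)) := by
    refine ⟨fun x => (h.hasDerivAt x).star, fun x => ((h.hasDerivAt' x).star).congr_deriv ?_⟩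
    simp [mul_comm]
  obtain ⟨h1, h2⟩ := h'.eq_basis hq hQ x₀ x
  obtain ⟨h3, h4⟩ := ivp_eq_basis hq hQ (star lam) (star u) (star v) x₀ x
  rw [ivp_self hq hQ, divp_self] at h1 h2
  exact ⟨h3.trans h1.symm, h4.trans h2.symm⟩

/-- Solutions with fixed initial values depend holomorphically on the spectral parameter: by
Lagrange's identity, `y_mu - y_lam` is `mu - lam` times an expression that is continuous
in `mu`. -/
theorem differentiable_ivp (hq : Continuous q) (hQ : ∀ z, |q z| ≤ Q) (u v : ℂ) (x₀ x : ℝ) :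
    Differentiable ℂ (fun lam => ivp q lam x₀ u v x) ∧
      Differentiable ℂ (fun lam => divp q lam x₀ u v x) := by
  have aux : ∀ (lam A : ℂ) (f B : ℂ → ℂ), Continuous B → (∀ mu, f mu = A + (mu - lam) * B mu) →
      DifferentiableAt ℂ f lam := by
    intro lam A f B hB hf
    have : HasDerivAt f (B lam) lam := by
      rw [hasDerivAt_iff_tendsto_slope]
      refine ((hB.tendsto lam).mono_left nhdsWithin_le_nhds).congr' ?_
      filter_upwards [self_mem_nhdsWithin] with mu hmu
      have : mu - lam ≠ 0 := sub_ne_zero.2 hmu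
      rw [slope_def_field, hf, hf]
      field_simp
      ring
    exact this.differentiableAt
  have hI : ∀ (lam u' v' : ℂ), Continuous fun mu =>
      ∫ t in x₀..x, ivp q mu x₀ u v t * ivp q lam x₀ u' v' t := by
    intro lam u' v'
    have h1 := continuous_ivp (x₀ := x₀) hq hQ u v
    have h2 := continuous_ivp_right (x₀ := x₀) hq hQ lam u' v'
    refine intervalIntegral.continuous_parametric_intervalIntegral_of_continuous'
      (f := fun mu t => ivp q mu x₀ u v t * ivp q lam x₀ u' v' t) ?_ _ _
    exact h1.mul (h2.comp continuous_snd)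
  have key := fun lam mu => eq_of_wronskian (wronskian_basis (x₀ := x₀) (lam := lam) hq hQ x)
    (y := ivp q mu x₀ u v x) (y' := divp q mu x₀ u v x)
    (v := v - (mu - lam) * ∫ t in x₀..x, ivp q mu x₀ u v t * ivp q lam x₀ 1 0 t)
    (u := u + (mu - lam) * ∫ t in x₀..x, ivp q mu x₀ u v t * ivp q lam x₀ 0 1 t)
    (by
      rw [← (isSol_ivp hq hQ mu u v).lagrange (isSol_ivp hq hQ lam 1 0)]
      simp [ivp_self hq hQ])
    (by
      rw [← (isSol_ivp hq hQ mu u v).lagrange (isSol_ivp hq hQ lam 0 1)]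
      simp [ivp_self hq hQ])
  have h10 := fun lam => hI lam 1 0
  have h01 := fun lam => hI lam 0 1
  constructor
  · intro lam
    refine aux lam (u * ivp q lam x₀ 1 0 x + v * ivp q lam x₀ 0 1 x) _
      (fun mu => (∫ t in x₀..x, ivp q mu x₀ u v t * ivp q lam x₀ 0 1 t) * ivp q lam x₀ 1 0 x
        - (∫ t in x₀..x, ivp q mu x₀ u v t * ivp q lam x₀ 1 0 t) * ivp q lam x₀ 0 1 x)
      (((h01 lam).mul continuous_const).sub ((h10 lam).mul continuous_const)) fun mu => ?_
    rw [(key lam mu).1]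
    ring
  · intro lam
    refine aux lam (u * divp q lam x₀ 1 0 x + v * divp q lam x₀ 0 1 x) _
      (fun mu => (∫ t in x₀..x, ivp q mu x₀ u v t * ivp q lam x₀ 0 1 t) * divp q lam x₀ 1 0 x
        - (∫ t in x₀..x, ivp q mu x₀ u v t * ivp q lam x₀ 1 0 t) * divp q lam x₀ 0 1 x)
      (((h01 lam).mul continuous_const).sub ((h10 lam).mul continuous_const)) fun mu => ?_
    rw [(key lam mu).2]
    ring

end Wronskian

section Asymptotics

theorem norm_sin_le_exp (z : ℂ) : ‖Complex.sin z‖ ≤ Real.exp |z.im| := by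
  have h1 : ‖Complex.exp (-z * Complex.I)‖ ≤ Real.exp |z.im| := by
    rw [Complex.norm_exp]; simpa using le_abs_self z.im
  have h2 : ‖Complex.exp (z * Complex.I)‖ ≤ Real.exp |z.im| := by
    rw [Complex.norm_exp]; simpa using neg_le_abs z.im
  rw [Complex.sin, norm_div, norm_mul]
  have := norm_sub_le (Complex.exp (-z * Complex.I)) (Complex.exp (z * Complex.I))
  simp only [Complex.norm_I, mul_one, Complex.norm_ofNat]
  linarith

theorem norm_cos_le_exp (z : ℂ) : ‖Complex.cos z‖ ≤ Real.exp |z.im| := by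
  have h1 : ‖Complex.exp (-z * Complex.I)‖ ≤ Real.exp |z.im| := by
    rw [Complex.norm_exp]; simpa using le_abs_self z.im
  have h2 : ‖Complex.exp (z * Complex.I)‖ ≤ Real.exp |z.im| := by
    rw [Complex.norm_exp]; simpa using neg_le_abs z.im
  rw [Complex.cos, norm_div]
  have := norm_add_le (Complex.exp (z * Complex.I)) (Complex.exp (-z * Complex.I))
  simp only [Complex.norm_ofNat]
  linarith

variable {q : ℝ → ℝ} {s : ℂ} {y y' : ℝ → ℂ}

/-- Variation of constants, with `q y` as the inhomogeneity of `y'' + s ^ 2 y = q y`. -/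
theorem IsSol.variation (hq : Continuous q) (hy : IsSol q (s ^ 2) y y') (x₀ x : ℝ) :
    s * y x - (s * y x₀ * Complex.cos (s * (x - x₀)) + y' x₀ * Complex.sin (s * (x - x₀)))
        = ∫ z in x₀..x, Complex.sin (s * (x - z)) * (q z * y z) ∧
      y' x - (-(s * y x₀ * Complex.sin (s * (x - x₀))) + y' x₀ * Complex.cos (s * (x - x₀)))
        = ∫ z in x₀..x, Complex.cos (s * (x - z)) * (q z * y z) := by
  have hyc := hy.continuous
  have harg : ∀ z : ℝ, HasDerivAt (fun z : ℝ => s * ((x : ℂ) - z)) (-s) z := by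
    intro z
    have := ((Complex.ofRealCLM.hasDerivAt (x := z)).const_sub (x : ℂ)).const_mul s
    simpa using this
  have hsin : ∀ z : ℝ, HasDerivAt (fun z : ℝ => Complex.sin (s * ((x : ℂ) - z)))
      (Complex.cos (s * ((x : ℂ) - z)) * -s) z := fun z =>
    (Complex.hasDerivAt_sin _).comp z (harg z)
  have hcos : ∀ z : ℝ, HasDerivAt (fun z : ℝ => Complex.cos (s * ((x : ℂ) - z)))
      (-Complex.sin (s * ((x : ℂ) - z)) * -s) z := fun z =>
    (Complex.hasDerivAt_cos _).comp z (harg z)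
  constructor
  · rw [intervalIntegral.integral_eq_sub_of_hasDerivAt
      (f := fun z : ℝ => Complex.sin (s * (x - z)) * y' z + s * Complex.cos (s * (x - z)) * y z)
      (fun z _ => ?_) (Continuous.intervalIntegrable (by fun_prop) _ _)]
    · simp only [sub_self, mul_zero, Complex.sin_zero, Complex.cos_zero]
      ring
    · refine (((hsin z).mul (hy.hasDerivAt' z)).add
        (((hcos z).const_mul s).mul (hy.hasDerivAt z))).congr_deriv ?_
      ring
  · rw [intervalIntegral.integral_eq_sub_of_hasDerivAt
      (f := fun z : ℝ => Complex.cos (s * (x - z)) * y' z - s * Complex.sin (s * (x - z)) * y z)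
      (fun z _ => ?_) (Continuous.intervalIntegrable (by fun_prop) _ _)]
    · simp only [sub_self, mul_zero, Complex.sin_zero, Complex.cos_zero]
      ring
    · refine (((hcos z).mul (hy.hasDerivAt' z)).sub
        (((hsin z).const_mul s).mul (hy.hasDerivAt z))).congr_deriv ?_
      ring

/-- The bound for the integrals in `IsSol.variation`; the kernel `k` is `sin` or `cos`. -/
theorem norm_kernel_integral_le {Q N x₀ x₁ x : ℝ} {k : ℂ → ℂ}
    (hkb : ∀ z, ‖k z‖ ≤ Real.exp |z.im|) (hQ : ∀ z, |q z| ≤ Q) (hx : x ∈ Icc x₀ x₁)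
    (hN : ∀ z ∈ Icc x₀ x₁, ‖y z‖ ≤ N * Real.exp (|s.im| * (z - x₀))) :
    ‖∫ z in x₀..x, k (s * (x - z)) * (q z * y z)‖
      ≤ Q * (x₁ - x₀) * N * Real.exp (|s.im| * (x - x₀)) := by
  have hQ0 : 0 ≤ Q := (abs_nonneg _).trans (hQ 0)
  have hN0 : 0 ≤ N := by
    have := (norm_nonneg _).trans (hN x hx)
    exact nonneg_of_mul_nonneg_left this (Real.exp_pos _)
  have h := intervalIntegral.norm_integral_le_of_norm_le_const
    (f := fun z : ℝ => k (s * (x - z)) * (q z * y z)) (a := x₀) (b := x)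
    (C := Q * N * Real.exp (|s.im| * (x - x₀))) ?_
  · refine h.trans ?_
    rw [abs_of_nonneg (sub_nonneg.2 hx.1)]
    have : x - x₀ ≤ x₁ - x₀ := by linarith [hx.2]
    calc Q * N * Real.exp (|s.im| * (x - x₀)) * (x - x₀)
        ≤ Q * N * Real.exp (|s.im| * (x - x₀)) * (x₁ - x₀) := by gcongr
      _ = _ := by ring
  · intro z hz
    rw [uIoc_of_le hx.1] at hz
    have h1 : ‖k (s * (x - z))‖ ≤ Real.exp (|s.im| * (x - z)) := by
      refine (hkb _).trans (le_of_eq ?_)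
      have : (s * ((x : ℂ) - z)).im = s.im * (x - z) := by
        rw [← Complex.ofReal_sub, Complex.im_mul_ofReal]
      rw [this, abs_mul, abs_of_nonneg (sub_nonneg.2 hz.2)]
    have h2 := hN z ⟨hz.1.le, hz.2.trans hx.2⟩
    have h3 : ‖((q z : ℝ) : ℂ)‖ ≤ Q := by simpa using hQ z
    rw [norm_mul, norm_mul]
    calc ‖k (s * (x - z))‖ * (‖((q z : ℝ) : ℂ)‖ * ‖y z‖)
        ≤ Real.exp (|s.im| * (x - z)) * (Q * (N * Real.exp (|s.im| * (z - x₀)))) := by gcongr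
      _ = Q * N * (Real.exp (|s.im| * (x - z)) * Real.exp (|s.im| * (z - x₀))) := by ring
      _ = _ := by rw [← Real.exp_add]; ring_nf

/-- The a priori bound for solutions with a large spectral parameter: at a maximum of
`|y| exp (-|Im s| (x - x₀))`, the integral in `IsSol.variation` is at most half of `|s y|`. -/
theorem IsSol.norm_le {Q x₀ x₁ : ℝ} (hq : Continuous q) (hQ : ∀ z, |q z| ≤ Q) (h01 : x₀ ≤ x₁)
    (hy : IsSol q (s ^ 2) y y') (hs : 2 * (Q * (x₁ - x₀)) ≤ ‖s‖) (hs0 : s ≠ 0) :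
    ∀ x ∈ Icc x₀ x₁,
      ‖y x‖ ≤ 2 * (‖y x₀‖ + ‖y' x₀‖ / ‖s‖) * Real.exp (|s.im| * (x - x₀)) := by
  have hyc := hy.continuous
  obtain ⟨m, hm, hmax⟩ := isCompact_Icc.exists_isMaxOn (nonempty_Icc.2 h01)
    (f := fun x => ‖y x‖ * Real.exp (-(|s.im| * (x - x₀)))) (by fun_prop)
  set N := ‖y m‖ * Real.exp (-(|s.im| * (m - x₀))) with hN
  have hs' : 0 < ‖s‖ := norm_pos_iff.2 hs0
  have hNb : ∀ z ∈ Icc x₀ x₁, ‖y z‖ ≤ N * Real.exp (|s.im| * (z - x₀)) := by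
    intro z hz
    have : ‖y z‖ * Real.exp (-(|s.im| * (z - x₀))) ≤ N := hmax hz
    rw [Real.exp_neg, ← div_eq_mul_inv, div_le_iff₀ (Real.exp_pos _)] at this
    exact this
  -- `N` is the maximum; the estimate is evaluated at the point `m` where it is attained.
  have hym : ‖y m‖ = N * Real.exp (|s.im| * (m - x₀)) := by
    rw [hN, mul_assoc, ← Real.exp_add]; simp
  have h1 := norm_kernel_integral_le norm_sin_le_exp hQ hm hNb
  rw [← (hy.variation hq x₀ m).1] at h1
  set E := Real.exp (|s.im| * (m - x₀)) with hE
  have hE0 : 0 < E := Real.exp_pos _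
  have him : |(s * ((m : ℂ) - x₀)).im| = |s.im| * (m - x₀) := by
    rw [← Complex.ofReal_sub, Complex.im_mul_ofReal, abs_mul, abs_of_nonneg (sub_nonneg.2 hm.1)]
  have hc := norm_cos_le_exp (s * (m - x₀))
  have hsn := norm_sin_le_exp (s * (m - x₀))
  rw [him, ← hE] at hc hsn
  have h2 : ‖s * y x₀ * Complex.cos (s * (m - x₀)) + y' x₀ * Complex.sin (s * (m - x₀))‖
      ≤ (‖s‖ * ‖y x₀‖ + ‖y' x₀‖) * E := by
    refine (norm_add_le _ _).trans ?_
    rw [norm_mul, norm_mul, norm_mul, add_mul]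
    gcongr
  have h3 : ‖s * y m‖ ≤ Q * (x₁ - x₀) * N * E + (‖s‖ * ‖y x₀‖ + ‖y' x₀‖) * E := by
    have := norm_add_le_of_le h1 h2
    simpa using this
  rw [norm_mul, hym, ← mul_assoc, ← add_mul] at h3
  have h4 := le_of_mul_le_mul_right h3 hE0
  have hN0 : 0 ≤ N := by positivity
  have h5 : N ≤ 2 * (‖y x₀‖ + ‖y' x₀‖ / ‖s‖) := by
    have e : 2 * (‖y x₀‖ + ‖y' x₀‖ / ‖s‖) = 2 * (‖s‖ * ‖y x₀‖ + ‖y' x₀‖) / ‖s‖ := by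
      field_simp
    rw [e, le_div_iff₀ hs']
    nlinarith
  intro x hx
  refine (hNb x hx).trans ?_
  gcongr

/-- The asymptotics of a solution and of its derivative for a large spectral parameter. -/
theorem IsSol.asymptotics {Q x₀ x₁ : ℝ} (hq : Continuous q) (hQ : ∀ z, |q z| ≤ Q) (h01 : x₀ ≤ x₁)
    (hy : IsSol q (s ^ 2) y y') (hs : 2 * (Q * (x₁ - x₀)) ≤ ‖s‖) (hs0 : s ≠ 0) :
    ∀ x ∈ Icc x₀ x₁,
      ‖y x - (y x₀ * Complex.cos (s * (x - x₀)) + y' x₀ / s * Complex.sin (s * (x - x₀)))‖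
        ≤ 2 * (Q * (x₁ - x₀)) * ((‖y x₀‖ + ‖y' x₀‖ / ‖s‖) / ‖s‖)
          * Real.exp (|s.im| * (x - x₀)) ∧
      ‖y' x - (-(s * y x₀ * Complex.sin (s * (x - x₀))) + y' x₀ * Complex.cos (s * (x - x₀)))‖
        ≤ 2 * (Q * (x₁ - x₀)) * (‖y x₀‖ + ‖y' x₀‖ / ‖s‖) * Real.exp (|s.im| * (x - x₀)) := by
  intro x hx
  have hb := hy.norm_le hq hQ h01 hs hs0
  have hs' : 0 < ‖s‖ := norm_pos_iff.2 hs0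
  constructor
  · have h1 := norm_kernel_integral_le norm_sin_le_exp hQ hx hb
    rw [← (hy.variation hq x₀ x).1] at h1
    have e : y x - (y x₀ * Complex.cos (s * (x - x₀)) + y' x₀ / s * Complex.sin (s * (x - x₀)))
        = (s * y x - (s * y x₀ * Complex.cos (s * (x - x₀))
          + y' x₀ * Complex.sin (s * (x - x₀)))) / s := by
      field_simp
    rw [e, norm_div, div_le_iff₀ hs']
    refine h1.trans (le_of_eq ?_)
    field_simp
  · have h1 := norm_kernel_integral_le norm_cos_le_exp hQ hx hb
    rw [← (hy.variation hq x₀ x).2] at h1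
    refine h1.trans (le_of_eq ?_)
    ring

end Asymptotics

end SLProblem

/-! ### The basic solution and the characteristic function -/

namespace SLProblem

section Extension

/-- A function that is continuous on a dense part of `[a, b]` and has limits at the remaining points
agrees there with a bounded continuous function on the line. -/
theorem exists_continuous_bounded_extension {q : ℝ → ℝ} {a b : ℝ} {s : Set ℝ} (hab : a ≤ b)
    (hs : s ⊆ Icc a b) (hs' : Icc a b ⊆ closure s) (hq : ContinuousOn q s)
    (hl : ∀ x ∈ Icc a b, ∃ l, Tendsto q (𝓝[s] x) (𝓝 l)) :
    ∃ (q' : ℝ → ℝ) (Q : ℝ), Continuous q' ∧ (∀ x, |q' x| ≤ Q) ∧ ∀ x ∈ s, q' x = q x := by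
  have hc := continuousOn_extendFrom hs' hl
  obtain ⟨Q, hQ⟩ := isCompact_Icc.exists_bound_of_continuousOn hc
  refine ⟨IccExtend hab ((Icc a b).domRestrict (extendFrom s q)), Q, ?_, fun x => ?_,
    fun x hx => ?_⟩
  · exact (continuousOn_iff_continuous_domRestrict.1 hc).Icc_extend'
  · rw [IccExtend_apply]
    exact hQ _ (by simp [hab])
  · rw [IccExtend_of_mem _ _ (hs hx)]
    exact extendFrom_extends hq x hx

/-- On `[x₀, x₁]` the successive approximations only depend on the potential in `(x₀, x₁)`. Hence
`q`, whose values at `c` and outside `[a, b]` are arbitrary, may be replaced by an extension. -/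
theorem ivp_congr {q q' : ℝ → ℝ} {x₀ x₁ : ℝ} (h : ∀ x ∈ Ioo x₀ x₁, q x = q' x) (lam u v : ℂ)
    {x : ℝ} (hx : x ∈ Icc x₀ x₁) : ivp q lam x₀ u v x = ivp q' lam x₀ u v x := by
  have key : ∀ n, ∀ x ∈ Icc x₀ x₁, picard q lam x₀ u v n x = picard q' lam x₀ u v n x := by
    intro n
    induction n with
    | zero => intro x _; rfl
    | succ n ih =>
      intro x hx
      simp only [picard]
      congr 1
      refine intervalIntegral.integral_congr_Ioo_of_le hx.1 fun z hz => ?_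
      simp only [h z ⟨hz.1, hz.2.trans_le hx.2⟩, ih z ⟨hz.1.le, hz.2.le.trans hx.2⟩]
  simp only [ivp, fun n => key n x hx]

end Extension

variable {P : SLProblem}

/-- Continuous bounded potentials on the whole line that extend `q` from `[a, c)` and
from `(c, b]`. -/
structure Ext (P : SLProblem) where
  (qL qR : ℝ → ℝ)
  (QL QR : ℝ)
  contL : Continuous qL
  contR : Continuous qR
  boundL : ∀ x, |qL x| ≤ QL
  boundR : ∀ x, |qR x| ≤ QR
  eqL : ∀ x ∈ Ico P.a P.c, qL x = P.q x
  eqR : ∀ x ∈ Ioc P.c P.b, qR x = P.q x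

theorem Admissible.nonempty_ext (hP : P.Admissible) : Nonempty P.Ext := by
  have hac := hP.hac
  have hcb := hP.hcb
  obtain ⟨qL, QL, h1, h2, h3⟩ := exists_continuous_bounded_extension (q := P.q) hac.le
    (Ico_subset_Icc_self) (closure_Ico hac.ne).ge hP.q_left (by
      intro x hx
      rcases hx.2.lt_or_eq with h | h
      · exact ⟨_, hP.q_left x ⟨hx.1, h⟩⟩
      · obtain ⟨l, hl⟩ := hP.q_lim_left
        subst h
        exact ⟨l, hl.mono_left (nhdsWithin_mono _ Ico_subset_Iio_self)⟩)
  obtain ⟨qR, QR, h4, h5, h6⟩ := exists_continuous_bounded_extension (q := P.q) hcb.le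
    (Ioc_subset_Icc_self) (closure_Ioc hcb.ne).ge hP.q_right (by
      intro x hx
      rcases hx.1.lt_or_eq with h | h
      · exact ⟨_, hP.q_right x ⟨h, hx.2⟩⟩
      · obtain ⟨l, hl⟩ := hP.q_lim_right
        subst h
        exact ⟨l, hl.mono_left (nhdsWithin_mono _ Ioc_subset_Ioi_self)⟩)
  exact ⟨⟨qL, qR, QL, QR, h1, h4, h2, h5, h3, h6⟩⟩

section Domain

theorem dom_mem_left {x : ℝ} (hx : x ∈ Ico P.a P.c) : x ∈ P.dom := Or.inl hx

theorem dom_mem_right {x : ℝ} (hx : x ∈ Ioc P.c P.b) : x ∈ P.dom := Or.inr hx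

theorem nhdsWithin_dom_left {x : ℝ} (hx : x ∈ Ico P.a P.c) : 𝓝[P.dom] x = 𝓝[Ico P.a P.c] x := by
  have e : P.dom ∩ Iio P.c = Ico P.a P.c := by
    ext t
    simp only [dom, mem_inter_iff, mem_union, mem_Ico, mem_Ioc, mem_Iio]
    grind
  rw [← e, nhdsWithin_inter_of_mem' (nhdsWithin_le_nhds (Iio_mem_nhds hx.2))]

theorem nhdsWithin_dom_right {x : ℝ} (hx : x ∈ Ioc P.c P.b) :
    𝓝[P.dom] x = 𝓝[Ioc P.c P.b] x := by
  have e : P.dom ∩ Ioi P.c = Ioc P.c P.b := by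
    ext t
    simp only [dom, mem_inter_iff, mem_union, mem_Ico, mem_Ioc, mem_Ioi]
    grind
  rw [← e, nhdsWithin_inter_of_mem' (nhdsWithin_le_nhds (Ioi_mem_nhds hx.1))]

theorem uniqueDiffOn_dom : UniqueDiffOn ℝ P.dom := by
  rintro x (hx | hx)
  · exact (uniqueDiffOn_Ico _ _ x hx).mono subset_union_left
  · exact (uniqueDiffOn_Ioc _ _ x hx).mono subset_union_right

theorem hasDerivWithinAt_dom_left {f g : ℝ → ℂ} {g' : ℂ} {x : ℝ} (hx : x ∈ Ico P.a P.c)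
    (hfg : ∀ t ∈ Ico P.a P.c, f t = g t) (hg : HasDerivAt g g' x) :
    HasDerivWithinAt f g' P.dom x := by
  refine hg.hasDerivWithinAt.congr_of_eventuallyEq ?_ (hfg x hx)
  rw [nhdsWithin_dom_left hx]
  exact eventually_of_mem self_mem_nhdsWithin hfg

theorem hasDerivWithinAt_dom_right {f g : ℝ → ℂ} {g' : ℂ} {x : ℝ} (hx : x ∈ Ioc P.c P.b)
    (hfg : ∀ t ∈ Ioc P.c P.b, f t = g t) (hg : HasDerivAt g g' x) :
    HasDerivWithinAt f g' P.dom x := by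
  refine hg.hasDerivWithinAt.congr_of_eventuallyEq ?_ (hfg x hx)
  rw [nhdsWithin_dom_right hx]
  exact eventually_of_mem self_mem_nhdsWithin hfg

end Domain

namespace Ext

variable (X : P.Ext) (lam : ℂ)

/-- The left part of the basic solution, on the whole line. -/
noncomputable def yL : ℝ → ℂ := ivp X.qL lam P.a (P.α11 : ℂ) (-(P.α10 : ℂ))

/-- The derivative of `yL`. -/
noncomputable def dyL : ℝ → ℂ := divp X.qL lam P.a (P.α11 : ℂ) (-(P.α10 : ℂ))

/-- The right part of the basic solution, on the whole line. -/
noncomputable def yR : ℝ → ℂ := ivp X.qR lam P.c (P.phi₂c lam) (P.dphi₂c lam)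

/-- The derivative of `yR`. -/
noncomputable def dyR : ℝ → ℂ := divp X.qR lam P.c (P.phi₂c lam) (P.dphi₂c lam)

/-- The part `α20' y(b) - α21' y'(b)` of the boundary condition that is multiplied by the spectral
parameter, for the basic solution. -/
noncomputable def bdry : ℂ := (P.α20' : ℂ) * X.yR lam P.b - (P.α21' : ℂ) * X.dyR lam P.b

/-- The characteristic function: the left-hand side of the boundary condition at `b` for the basic
solution. -/
noncomputable def charFun : ℂ :=
  (P.α20 : ℂ) * X.yR lam P.b - (P.α21 : ℂ) * X.dyR lam P.b + lam * X.bdry lam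

theorem isSol_left : IsSol X.qL lam (X.yL lam) (X.dyL lam) := isSol_ivp X.contL X.boundL _ _ _

theorem isSol_right : IsSol X.qR lam (X.yR lam) (X.dyR lam) := isSol_ivp X.contR X.boundR _ _ _

@[simp] theorem yL_a : X.yL lam P.a = P.α11 := ivp_self X.contL X.boundL _ _ _

@[simp] theorem dyL_a : X.dyL lam P.a = -P.α10 := divp_self _ _ _

@[simp] theorem yR_c : X.yR lam P.c = P.phi₂c lam := ivp_self X.contR X.boundR _ _ _

@[simp] theorem dyR_c : X.dyR lam P.c = P.dphi₂c lam := divp_self _ _ _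

theorem phi₁_eq {x : ℝ} (hx : x ∈ Icc P.a P.c) : P.phi₁ lam x = X.yL lam x :=
  ivp_congr (fun x hx => (X.eqL x ⟨hx.1.le, hx.2⟩).symm) _ _ _ hx

theorem phi_left {x : ℝ} (hx : x ∈ Ico P.a P.c) : P.phi lam x = X.yL lam x := by
  rw [phi, if_pos hx.2, X.phi₁_eq lam ⟨hx.1, hx.2.le⟩]

theorem phi_right {x : ℝ} (hx : x ∈ Ioc P.c P.b) : P.phi lam x = X.yR lam x := by
  rw [phi, if_neg hx.1.not_gt]
  exact ivp_congr (fun x hx => (X.eqR x ⟨hx.1, hx.2.le⟩).symm) _ _ _ ⟨hx.1.le, hx.2⟩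

theorem phi₁c_eq (hP : P.Admissible) : P.phi₁c lam = X.yL lam P.c :=
  X.phi₁_eq lam (right_mem_Icc.2 hP.hac.le)

theorem dphi₁c_eq (hP : P.Admissible) : P.dphi₁c lam = X.dyL lam P.c := by
  have h := right_mem_Icc.2 hP.hac.le
  exact ((((X.isSol_left lam).hasDerivAt P.c).hasDerivWithinAt.congr
    (fun x hx => X.phi₁_eq lam hx) (X.phi₁_eq lam h))).derivWithin
    (uniqueDiffOn_Icc hP.hac P.c h)

theorem hasDerivWithinAt_phi_left {x : ℝ} (hx : x ∈ Ico P.a P.c) :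
    HasDerivWithinAt (P.phi lam) (X.dyL lam x) P.dom x :=
  hasDerivWithinAt_dom_left hx (fun _ ht => X.phi_left lam ht) ((X.isSol_left lam).hasDerivAt x)

theorem hasDerivWithinAt_phi_right {x : ℝ} (hx : x ∈ Ioc P.c P.b) :
    HasDerivWithinAt (P.phi lam) (X.dyR lam x) P.dom x :=
  hasDerivWithinAt_dom_right hx (fun _ ht => X.phi_right lam ht) ((X.isSol_right lam).hasDerivAt x)

theorem D_phi_left {x : ℝ} (hx : x ∈ Ico P.a P.c) : P.D (P.phi lam) x = X.dyL lam x :=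
  (X.hasDerivWithinAt_phi_left lam hx).derivWithin (uniqueDiffOn_dom x (dom_mem_left hx))

theorem D_phi_right {x : ℝ} (hx : x ∈ Ioc P.c P.b) : P.D (P.phi lam) x = X.dyR lam x :=
  (X.hasDerivWithinAt_phi_right lam hx).derivWithin (uniqueDiffOn_dom x (dom_mem_right hx))

theorem hasDerivWithinAt_D_phi (X : P.Ext) {x : ℝ} (hx : x ∈ P.dom) :
    HasDerivWithinAt (P.D (P.phi lam)) ((((P.q x : ℝ) : ℂ) - lam) * P.phi lam x) P.dom x := by
  rcases hx with hx | hx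
  · rw [X.phi_left lam hx, ← X.eqL x hx]
    exact hasDerivWithinAt_dom_left hx (fun _ ht => X.D_phi_left lam ht)
      ((X.isSol_left lam).hasDerivAt' x)
  · rw [X.phi_right lam hx, ← X.eqR x hx]
    exact hasDerivWithinAt_dom_right hx (fun _ ht => X.D_phi_right lam ht)
      ((X.isSol_right lam).hasDerivAt' x)

theorem solvesEq_phi (X : P.Ext) : P.SolvesEq lam (P.phi lam) := by
  refine ⟨?_, fun x hx => (X.hasDerivWithinAt_D_phi lam hx).differentiableWithinAt,
    fun x hx => ?_⟩
  · rintro x (hx | hx)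
    · exact (X.hasDerivWithinAt_phi_left lam hx).differentiableWithinAt
    · exact (X.hasDerivWithinAt_phi_right lam hx).differentiableWithinAt
  · rw [D, (X.hasDerivWithinAt_D_phi lam hx).derivWithin (uniqueDiffOn_dom x hx)]
    ring

theorem transmission_phi (X : P.Ext) (hP : P.Admissible) : P.Transmission (P.phi lam) := by
  have hl := Ico_mem_nhdsLT hP.hac
  have hr := Ioc_mem_nhdsGT hP.hcb
  have hΔ : (P.Δ12 : ℂ) ≠ 0 := by exact_mod_cast hP.Δ12_pos.ne'
  refine ⟨P.phi₁c lam, P.dphi₁c lam, P.phi₂c lam, P.dphi₂c lam, ?_, ?_, ?_, ?_, ?_, ?_⟩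
  · rw [X.phi₁c_eq lam hP]
    refine Tendsto.congr' ?_ ((X.isSol_left lam).continuous.continuousWithinAt)
    exact eventually_of_mem hl fun x hx => (X.phi_left lam hx).symm
  · rw [X.dphi₁c_eq lam hP]
    refine Tendsto.congr' ?_ ((X.isSol_left lam).continuous'.continuousWithinAt)
    exact eventually_of_mem hl fun x hx => (X.D_phi_left lam hx).symm
  · rw [← X.yR_c lam]
    refine Tendsto.congr' ?_ ((X.isSol_right lam).continuous.continuousWithinAt)
    exact eventually_of_mem hr fun x hx => (X.phi_right lam hx).symm
  · rw [← X.dyR_c lam]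
    refine Tendsto.congr' ?_ ((X.isSol_right lam).continuous'.continuousWithinAt)
    exact eventually_of_mem hr fun x hx => (X.D_phi_right lam hx).symm
  all_goals
    simp only [phi₂c, dphi₂c]
    field_simp
    simp only [Δ12, Δ23, Δ24, Δ13, Δ14, minor, A, Matrix.of_apply, Matrix.cons_val,
      Matrix.cons_val_zero, Matrix.cons_val_one]
    push_cast
    ring

theorem isBasicSolution_phi (X : P.Ext) (hP : P.Admissible) :
    P.IsBasicSolution lam (P.phi lam) := by
  have ha : P.a ∈ Ico P.a P.c := left_mem_Ico.2 hP.hac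
  refine ⟨X.solvesEq_phi lam, ?_, ?_, X.transmission_phi lam hP⟩
  · rw [X.phi_left lam ha, yL_a]
  · rw [X.D_phi_left lam ha, dyL_a]

theorem isEigenfunction_phi (hP : P.Admissible) (hα : P.α10 ≠ 0 ∨ P.α11 ≠ 0)
    (h : X.charFun lam = 0) : P.IsEigenfunction lam (P.phi lam) := by
  have ha : P.a ∈ Ico P.a P.c := left_mem_Ico.2 hP.hac
  have hb : P.b ∈ Ioc P.c P.b := right_mem_Ioc.2 hP.hcb
  refine ⟨X.solvesEq_phi lam, ?_, ?_, X.transmission_phi lam hP, ?_⟩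
  · rw [BoundaryA, X.phi_left lam ha, X.D_phi_left lam ha, yL_a, dyL_a]
    ring
  · rw [BoundaryB, X.phi_right lam hb, X.D_phi_right lam hb]
    exact h
  · by_contra! h0
    have h1 : P.phi lam P.a = 0 := h0 _ (dom_mem_left ha)
    have h2 : P.D (P.phi lam) P.a = 0 := by
      rw [D, derivWithin_congr (f := fun _ => (0 : ℂ)) (fun x hx => h0 x hx) h1]
      simp
    rw [X.phi_left lam ha, yL_a] at h1
    rw [X.D_phi_left lam ha, dyL_a] at h2
    norm_cast at h1 h2
    rcases hα with h | h
    · exact h (neg_eq_zero.1 h2)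
    · exact h h1

theorem isSolOn_left {y : ℝ → ℂ} (h : P.SolvesEq lam y) :
    IsSolOn X.qL lam (Ico P.a P.c) y (P.D y) := by
  refine ⟨fun x hx => (h.1 x (dom_mem_left hx)).hasDerivWithinAt.mono subset_union_left,
    fun x hx => ?_⟩
  refine ((h.2.1 x (dom_mem_left hx)).hasDerivWithinAt.mono subset_union_left).congr_deriv ?_
  have := h.2.2 x (dom_mem_left hx)
  rw [X.eqL x hx]
  change P.D (P.D y) x = _
  linear_combination -this

theorem isSolOn_right {y : ℝ → ℂ} (h : P.SolvesEq lam y) :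
    IsSolOn X.qR lam (Ioc P.c P.b) y (P.D y) := by
  refine ⟨fun x hx => (h.1 x (dom_mem_right hx)).hasDerivWithinAt.mono subset_union_right,
    fun x hx => ?_⟩
  refine ((h.2.1 x (dom_mem_right hx)).hasDerivWithinAt.mono subset_union_right).congr_deriv ?_
  have := h.2.2 x (dom_mem_right hx)
  rw [X.eqR x hx]
  change P.D (P.D y) x = _
  linear_combination -this

variable {lam}

/-- An eigenfunction is a multiple of the basic solution: by the boundary condition at `a` on the
left of `c`, and then on the right of `c` because `Δ12 ≠ 0` makes the transmission conditions
solvable for the limits at `c+`. -/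
theorem charFun_eq_zero_of_isEigenfunction (hP : P.Admissible) (hα : P.α10 ≠ 0 ∨ P.α11 ≠ 0)
    {y : ℝ → ℂ} (hy : P.IsEigenfunction lam y) : X.charFun lam = 0 := by
  obtain ⟨hS, hA, hB, ⟨um, vm, up, vp, h1, h2, h3, h4, h5, h6⟩, x, hx, hyx⟩ := hy
  have hΔ : (P.Δ12 : ℂ) ≠ 0 := by exact_mod_cast hP.Δ12_pos.ne'
  have ha : P.a ∈ Ico P.a P.c := left_mem_Ico.2 hP.hac
  have hb : P.b ∈ Ioc P.c P.b := right_mem_Ioc.2 hP.hcb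
  obtain ⟨k, hk1, hk2⟩ : ∃ k : ℂ, y P.a = k * P.α11 ∧ P.D y P.a = k * -P.α10 := by
    rw [BoundaryA] at hA
    rcases hα with h | h
    · have h' : (P.α10 : ℂ) ≠ 0 := by exact_mod_cast h
      refine ⟨-P.D y P.a / P.α10, ?_, ?_⟩
      · field_simp
        linear_combination hA
      · field_simp
    · have h' : (P.α11 : ℂ) ≠ 0 := by exact_mod_cast h
      refine ⟨y P.a / P.α11, ?_, ?_⟩
      · field_simp
      · field_simp
        linear_combination hA
  have hL : ∀ x ∈ Ico P.a P.c, y x = k * X.yL lam x ∧ P.D y x = k * X.dyL lam x := by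
    intro x hx
    have e1 := (X.isSolOn_left lam hS).eq_basis X.contL X.boundL (convex_Ico _ _)
      (pure_le_nhds P.a) (by simpa using hP.hac) (tendsto_pure_nhds y _)
      (tendsto_pure_nhds (P.D y) _) hx
    have e2 := (X.isSol_left lam).eq_basis X.contL X.boundL P.a x
    rw [yL_a, dyL_a] at e2
    rw [hk1, hk2] at e1
    constructor
    · rw [e1.1, e2.1]; ring
    · rw [e1.2, e2.2]; ring
  have hl := Ico_mem_nhdsLT hP.hac
  have hum : um = k * P.phi₁c lam := by
    rw [X.phi₁c_eq lam hP]
    refine tendsto_nhds_unique h1 (Tendsto.congr' ?_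
      (((X.isSol_left lam).continuous.const_mul k).continuousWithinAt))
    exact eventually_of_mem hl fun x hx => (hL x hx).1.symm
  have hvm : vm = k * P.dphi₁c lam := by
    rw [X.dphi₁c_eq lam hP]
    refine tendsto_nhds_unique h2 (Tendsto.congr' ?_
      (((X.isSol_left lam).continuous'.const_mul k).continuousWithinAt))
    exact eventually_of_mem hl fun x hx => (hL x hx).2.symm
  have hup : up = k * P.phi₂c lam := by
    have : (P.Δ12 : ℂ) * up = P.Δ12 * (k * P.phi₂c lam) := by
      simp only [phi₂c]
      field_simp
      rw [hum, hvm] at h5 h6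
      simp only [Δ12, Δ23, Δ24, minor, A, Matrix.of_apply, Matrix.cons_val,
        Matrix.cons_val_zero, Matrix.cons_val_one]
      push_cast
      linear_combination (P.βp21 : ℂ) * h5 - (P.βp11 : ℂ) * h6
    exact mul_left_cancel₀ hΔ this
  have hvp : vp = k * P.dphi₂c lam := by
    have : (P.Δ12 : ℂ) * vp = P.Δ12 * (k * P.dphi₂c lam) := by
      simp only [dphi₂c]
      field_simp
      rw [hum, hvm] at h5 h6
      simp only [Δ12, Δ13, Δ14, minor, A, Matrix.of_apply, Matrix.cons_val,
        Matrix.cons_val_zero, Matrix.cons_val_one]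
      push_cast
      linear_combination (P.βp10 : ℂ) * h6 - (P.βp20 : ℂ) * h5
    exact mul_left_cancel₀ hΔ this
  have hR : ∀ x ∈ Ioc P.c P.b, y x = k * X.yR lam x ∧ P.D y x = k * X.dyR lam x := by
    intro x hx
    have e1 := (X.isSolOn_right lam hS).eq_basis X.contR X.boundR (convex_Ioc _ _)
      (x₀ := P.c) nhdsWithin_le_nhds (Ioc_mem_nhdsGT hP.hcb) h3 h4 hx
    have e2 := (X.isSol_right lam).eq_basis X.contR X.boundR P.c x
    rw [yR_c, dyR_c] at e2
    rw [hup, hvp] at e1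
    constructor
    · rw [e1.1, e2.1]; ring
    · rw [e1.2, e2.2]; ring
  have hk : k ≠ 0 := by
    rintro rfl
    rcases hx with hx | hx
    · exact hyx (by simpa using (hL x hx).1)
    · exact hyx (by simpa using (hR x hx).1)
  rw [BoundaryB, (hR _ hb).1, (hR _ hb).2] at hB
  refine (mul_eq_zero.1 (?_ : k * _ = 0)).resolve_left hk
  rw [charFun, bdry]
  linear_combination hB

theorem mem_eigenvalues_iff (hP : P.Admissible) (hα : P.α10 ≠ 0 ∨ P.α11 ≠ 0) :
    lam ∈ P.eigenvalues ↔ X.charFun lam = 0 :=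
  ⟨fun ⟨_, hy⟩ => X.charFun_eq_zero_of_isEigenfunction hP hα hy,
    fun h => ⟨_, X.isEigenfunction_phi lam hP hα h⟩⟩

end Ext

end SLProblem

/-! ### Reality and simplicity of the eigenvalues -/

namespace SLProblem

variable {P : SLProblem}

namespace Ext

section Differentiability

variable (X : P.Ext) (hP : P.Admissible)

theorem yR_eq (lam : ℂ) (x : ℝ) :
    X.yR lam x = P.phi₂c lam * ivp X.qR lam P.c 1 0 x + P.dphi₂c lam * ivp X.qR lam P.c 0 1 x :=
  (ivp_eq_basis X.contR X.boundR _ _ _ _ _).1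

theorem dyR_eq (lam : ℂ) (x : ℝ) :
    X.dyR lam x
      = P.phi₂c lam * divp X.qR lam P.c 1 0 x + P.dphi₂c lam * divp X.qR lam P.c 0 1 x :=
  (ivp_eq_basis X.contR X.boundR _ _ _ _ _).2

theorem differentiable_phi₂c (hP : P.Admissible) (X : P.Ext) : Differentiable ℂ P.phi₂c := by
  have h := differentiable_ivp X.contL X.boundL (P.α11 : ℂ) (-(P.α10 : ℂ)) P.a P.c
  have e : P.phi₂c = fun lam => 1 / (P.Δ12 : ℂ) *
      ((P.Δ23 : ℂ) * X.yL lam P.c + (P.Δ24 : ℂ) * X.dyL lam P.c) := by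
    funext lam
    rw [phi₂c, X.phi₁c_eq lam hP, X.dphi₁c_eq lam hP]
  rw [e]
  exact ((h.1.const_mul _).add (h.2.const_mul _)).const_mul _

theorem differentiable_dphi₂c (hP : P.Admissible) (X : P.Ext) : Differentiable ℂ P.dphi₂c := by
  have h := differentiable_ivp X.contL X.boundL (P.α11 : ℂ) (-(P.α10 : ℂ)) P.a P.c
  have e : P.dphi₂c = fun lam => -1 / (P.Δ12 : ℂ) *
      ((P.Δ13 : ℂ) * X.yL lam P.c + (P.Δ14 : ℂ) * X.dyL lam P.c) := by
    funext lam
    rw [dphi₂c, X.phi₁c_eq lam hP, X.dphi₁c_eq lam hP]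
  rw [e]
  exact ((h.1.const_mul _).add (h.2.const_mul _)).const_mul _

include hP in
theorem differentiable_yR (x : ℝ) : Differentiable ℂ fun lam => X.yR lam x := by
  simp only [yR_eq]
  exact ((X.differentiable_phi₂c hP).mul (differentiable_ivp X.contR X.boundR 1 0 _ _).1).add
    ((X.differentiable_dphi₂c hP).mul (differentiable_ivp X.contR X.boundR 0 1 _ _).1)

include hP in
theorem differentiable_dyR (x : ℝ) : Differentiable ℂ fun lam => X.dyR lam x := by
  simp only [dyR_eq]
  exact ((X.differentiable_phi₂c hP).mul (differentiable_ivp X.contR X.boundR 1 0 _ _).2).add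
    ((X.differentiable_dphi₂c hP).mul (differentiable_ivp X.contR X.boundR 0 1 _ _).2)

include hP in
theorem differentiable_bdry : Differentiable ℂ X.bdry :=
  ((X.differentiable_yR hP _).const_mul _).sub ((X.differentiable_dyR hP _).const_mul _)

include hP in
theorem differentiable_charFun : Differentiable ℂ X.charFun :=
  (((X.differentiable_yR hP _).const_mul _).sub ((X.differentiable_dyR hP _).const_mul _)).add
    (differentiable_id.mul (X.differentiable_bdry hP))

theorem continuous_yL : Continuous fun p : ℂ × ℝ => X.yL p.1 p.2 :=
  continuous_ivp X.contL X.boundL _ _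

include hP in
theorem continuous_yR : Continuous fun p : ℂ × ℝ => X.yR p.1 p.2 := by
  simp only [yR_eq]
  exact (((X.differentiable_phi₂c hP).continuous.comp continuous_fst).mul
    (continuous_ivp X.contR X.boundR 1 0)).add
    (((X.differentiable_dphi₂c hP).continuous.comp continuous_fst).mul
    (continuous_ivp X.contR X.boundR 0 1))

end Differentiability

section Conj

variable (X : P.Ext) (hP : P.Admissible) (lam : ℂ)

theorem yL_conj (x : ℝ) : X.yL (star lam) x = star (X.yL lam x) := by
  rw [yL, yL, ← (ivp_conj X.contL X.boundL _ _ _ _ _).1]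
  simp

theorem dyL_conj (x : ℝ) : X.dyL (star lam) x = star (X.dyL lam x) := by
  rw [dyL, dyL, ← (ivp_conj X.contL X.boundL _ _ _ _ _).2]
  simp

theorem phi₂c_conj (hP : P.Admissible) (X : P.Ext) : P.phi₂c (star lam) = star (P.phi₂c lam) := by
  simp only [phi₂c, X.phi₁c_eq _ hP, X.dphi₁c_eq _ hP, yL_conj, dyL_conj]
  simp

theorem dphi₂c_conj (hP : P.Admissible) (X : P.Ext) :
    P.dphi₂c (star lam) = star (P.dphi₂c lam) := by
  simp only [dphi₂c, X.phi₁c_eq _ hP, X.dphi₁c_eq _ hP, yL_conj, dyL_conj]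
  simp

include hP in
theorem yR_conj (x : ℝ) : X.yR (star lam) x = star (X.yR lam x) := by
  rw [yR, yR, ← (ivp_conj X.contR X.boundR _ _ _ _ _).1, phi₂c_conj lam hP X, dphi₂c_conj lam hP X]

include hP in
theorem dyR_conj (x : ℝ) : X.dyR (star lam) x = star (X.dyR lam x) := by
  rw [dyR, dyR, ← (ivp_conj X.contR X.boundR _ _ _ _ _).2, phi₂c_conj lam hP X,
    dphi₂c_conj lam hP X]

include hP in
theorem bdry_conj : X.bdry (star lam) = star (X.bdry lam) := by
  simp only [bdry, X.yR_conj hP, X.dyR_conj hP]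
  simp

include hP in
theorem charFun_conj : X.charFun (star lam) = star (X.charFun lam) := by
  simp only [charFun, X.yR_conj hP, X.dyR_conj hP, X.bdry_conj hP]
  simp

end Conj

section Energy

variable (X : P.Ext) (hP : P.Admissible) (hα : P.α10 ≠ 0 ∨ P.α11 ≠ 0)

/-- The bilinear form of the Hilbert space `L² ⊕ ℂ` in which the problem is self-adjoint, evaluated
at the basic solutions for two spectral parameters. -/
noncomputable def energy (lam mu : ℂ) : ℂ :=
  P.Δ0 * (P.Δ34 / P.Δ12 * (∫ x in P.a..P.c, X.yL lam x * X.yL mu x)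
    + ∫ x in P.c..P.b, X.yR lam x * X.yR mu x) + X.bdry lam * X.bdry mu

/-- The identity behind self-adjointness. The transmission conditions multiply the Wronskian by
`Δ34 / Δ12`, by the Plücker relation between the minors. -/
theorem charFun_mul_bdry_sub (hP : P.Admissible) (lam mu : ℂ) :
    X.charFun lam * X.bdry mu - X.charFun mu * X.bdry lam = (lam - mu) * X.energy lam mu := by
  have hΔ : (P.Δ12 : ℂ) ≠ 0 := by exact_mod_cast hP.Δ12_pos.ne'
  have h1 := (X.isSol_left lam).lagrange (X.isSol_left mu) P.a P.c
  have h2 := (X.isSol_right lam).lagrange (X.isSol_right mu) P.c P.b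
  have plucker : P.Δ12 * P.Δ34 = P.Δ13 * P.Δ24 - P.Δ14 * P.Δ23 := by
    simp only [Δ12, Δ13, Δ14, Δ23, Δ24, Δ34, minor]
    ring
  have plucker' : (P.Δ12 : ℂ) * P.Δ34 = P.Δ13 * P.Δ24 - P.Δ14 * P.Δ23 := by
    exact_mod_cast congrArg (fun t : ℝ => (t : ℂ)) plucker
  have h3 : P.phi₂c lam * P.dphi₂c mu - P.dphi₂c lam * P.phi₂c mu
      = P.Δ34 / P.Δ12 * (X.yL lam P.c * X.dyL mu P.c - X.dyL lam P.c * X.yL mu P.c) := by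
    simp only [phi₂c, dphi₂c, X.phi₁c_eq _ hP, X.dphi₁c_eq _ hP]
    field_simp
    linear_combination (-(X.yL lam P.c * X.dyL mu P.c - X.dyL lam P.c * X.yL mu P.c)) * plucker'
  rw [yL_a, yL_a, dyL_a, dyL_a] at h1
  rw [yR_c, yR_c, dyR_c, dyR_c, h3] at h2
  have hΔ0 : (P.Δ0 : ℂ) = P.α21 * P.α20' - P.α20 * P.α21' := by
    simp [Δ0, Matrix.det_fin_two]
  rw [energy]
  set I := ∫ x in P.a..P.c, X.yL lam x * X.yL mu x
  set J := ∫ x in P.c..P.b, X.yR lam x * X.yR mu x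
  have h4 : X.charFun lam * X.bdry mu - X.charFun mu * X.bdry lam
      = P.Δ0 * (X.yR lam P.b * X.dyR mu P.b - X.dyR lam P.b * X.yR mu P.b)
        + (lam - mu) * (X.bdry lam * X.bdry mu) := by
    rw [hΔ0, charFun, charFun, bdry, bdry]
    ring
  rw [h4]
  linear_combination (P.Δ0 : ℂ) * h2 + (P.Δ0 : ℂ) * (P.Δ34 / P.Δ12) * h1

include hP hα in
/-- At conjugate parameters the form is positive, by the signs of `Δ0`, `Δ12` and `Δ34`. -/
theorem energy_conj_ne_zero (lam : ℂ) : X.energy lam (star lam) ≠ 0 := by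
  have hΔ12 := hP.Δ12_pos
  have hΔ34 := hP.Δ34_pos
  have hΔ0 := hP.Δ0_pos
  have hns : ∀ z : ℂ, z * star z = ((‖z‖ ^ 2 : ℝ) : ℂ) := fun z => by
    rw [RCLike.star_def, Complex.mul_conj, Complex.normSq_eq_norm_sq]
  have e : X.energy lam (star lam) = ((P.Δ0 * (P.Δ34 / P.Δ12 * (∫ x in P.a..P.c, ‖X.yL lam x‖ ^ 2)
      + ∫ x in P.c..P.b, ‖X.yR lam x‖ ^ 2) + ‖X.bdry lam‖ ^ 2 : ℝ) : ℂ) := by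
    simp only [energy, yL_conj, X.yR_conj hP, X.bdry_conj hP, hns, intervalIntegral.integral_ofReal]
    push_cast
    ring
  have hcL := (X.isSol_left lam).continuous
  have hpos : 0 < ∫ x in P.a..P.c, ‖X.yL lam x‖ ^ 2 := by
    refine intervalIntegral.integral_pos hP.hac (by fun_prop) (fun _ _ => by positivity) ?_
    by_contra! h0
    have h0' : ∀ x ∈ Icc P.a P.c, X.yL lam x = 0 := fun x hx => by
      have := le_antisymm (h0 x hx) (by positivity)
      simpa using this
    have ha := left_mem_Icc.2 hP.hac.le
    have h1 := h0' _ ha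
    have h2 : X.dyL lam P.a = 0 :=
      ((uniqueDiffOn_Icc hP.hac) P.a ha).eq_deriv _
        ((X.isSol_left lam).hasDerivAt P.a).hasDerivWithinAt
        ((hasDerivWithinAt_const P.a _ (0 : ℂ)).congr h0' h1)
    rw [yL_a] at h1
    rw [dyL_a] at h2
    norm_cast at h1 h2
    rcases hα with h | h
    · exact h (neg_eq_zero.1 h2)
    · exact h h1
  have hnn : 0 ≤ ∫ x in P.c..P.b, ‖X.yR lam x‖ ^ 2 :=
    intervalIntegral.integral_nonneg hP.hcb.le fun _ _ => by positivity
  rw [e]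
  have : 0 < P.Δ0 * (P.Δ34 / P.Δ12 * (∫ x in P.a..P.c, ‖X.yL lam x‖ ^ 2)
      + ∫ x in P.c..P.b, ‖X.yR lam x‖ ^ 2) + ‖X.bdry lam‖ ^ 2 := by positivity
  exact_mod_cast this.ne'

include hP hα in
/-- The eigenvalues are real: at conjugate parameters, `charFun_mul_bdry_sub` has a vanishing left
side and a nonzero factor on the right. -/
theorem im_eq_zero_of_charFun_eq_zero {lam : ℂ} (h : X.charFun lam = 0) : lam.im = 0 := by
  have h1 := X.charFun_mul_bdry_sub hP lam (star lam)
  rw [X.charFun_conj hP, h, star_zero, zero_mul, zero_mul, sub_zero, eq_comm, mul_eq_zero,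
    or_iff_left (X.energy_conj_ne_zero hP hα lam), sub_eq_zero] at h1
  exact Complex.conj_eq_iff_im.1 h1.symm

include hP in
theorem continuous_energy (lam : ℂ) : Continuous (X.energy lam) := by
  have h1 := X.continuous_yL
  have h2 := X.continuous_yR hP
  have h3 := (X.isSol_left lam).continuous
  have h4 := (X.isSol_right lam).continuous
  have hI : Continuous fun mu => ∫ x in P.a..P.c, X.yL lam x * X.yL mu x :=
    intervalIntegral.continuous_parametric_intervalIntegral_of_continuous'
      (f := fun mu x => X.yL lam x * X.yL mu x) ((h3.comp continuous_snd).mul h1) _ _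
  have hJ : Continuous fun mu => ∫ x in P.c..P.b, X.yR lam x * X.yR mu x :=
    intervalIntegral.continuous_parametric_intervalIntegral_of_continuous'
      (f := fun mu x => X.yR lam x * X.yR mu x) ((h4.comp continuous_snd).mul h2) _ _
  exact (((hI.const_mul _).add hJ).const_mul _).add
    ((X.differentiable_bdry hP).continuous.const_mul _)

include hP hα in
/-- The eigenvalues are simple zeros of the characteristic function: after division by `lam - mu`,
the identity `charFun_mul_bdry_sub` becomes `charFun' * bdry = energy ≠ 0` in the limit. -/
theorem deriv_charFun_ne_zero {lam : ℂ} (h : X.charFun lam = 0) : deriv X.charFun lam ≠ 0 := by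
  have hre : star lam = lam :=
    Complex.conj_eq_iff_im.2 (X.im_eq_zero_of_charFun_eq_zero hP hα h)
  have hne := X.energy_conj_ne_zero hP hα lam
  rw [hre] at hne
  have h1 : HasDerivAt (fun mu => X.charFun mu * X.bdry lam) (deriv X.charFun lam * X.bdry lam)
      lam := ((X.differentiable_charFun hP lam).hasDerivAt).mul_const _
  have h2 : HasDerivAt (fun mu => X.charFun mu * X.bdry lam) (X.energy lam lam) lam := by
    rw [hasDerivAt_iff_tendsto_slope]
    refine (((X.continuous_energy hP lam).tendsto lam).mono_left nhdsWithin_le_nhds).congr' ?_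
    filter_upwards [self_mem_nhdsWithin] with mu hmu
    have hmu' : mu - lam ≠ 0 := sub_ne_zero.2 hmu
    have := X.charFun_mul_bdry_sub hP lam mu
    rw [h, zero_mul, zero_sub] at this
    rw [slope_def_field, h, zero_mul, sub_zero, eq_div_iff hmu']
    linear_combination this
  intro h0
  rw [h0, zero_mul] at h1
  exact hne (h2.unique h1)

end Energy

end Ext

end SLProblem

/-! ### Counting simple zeros -/

section ZeroCounting

open Metric

/-- Simple zeros are isolated, so a compact set contains finitely many of them. -/
theorem finite_zeros_of_deriv_ne_zero {f : ℂ → ℂ} {K : Set ℂ} (hK : IsCompact K)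
    (hd : ∀ z ∈ K, DifferentiableAt ℂ f z) (hs : ∀ z ∈ K, f z = 0 → deriv f z ≠ 0) :
    (K ∩ {z | f z = 0}).Finite := by
  by_contra hinf
  obtain ⟨z, hz, hacc⟩ := Set.Infinite.exists_accPt_of_subset_isCompact hinf hK inter_subset_left
  rw [accPt_iff_frequently_nhdsNE] at hacc
  have h0 : f z = 0 := by
    by_contra hne
    have : ∀ᶠ w in 𝓝[≠] z, f w ≠ 0 :=
      nhdsWithin_le_nhds ((hd z hz).continuousAt.eventually_ne hne)
    exact hacc (this.mono fun w hw hw' => hw hw'.2)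
  have := (hd z hz).hasDerivAt.eventually_ne (c := 0) (hs z hz h0)
  exact hacc (this.mono fun w hw hw' => hw hw'.2)

variable {c : ℂ} {R : ℝ} {U : Set ℂ} {f g v w : ℂ → ℂ}

theorem circleIntegrable_logDeriv (hR : 0 ≤ R) (hU : IsOpen U) (hb : closedBall c R ⊆ U)
    (hf : DifferentiableOn ℂ f U) (h0 : ∀ z ∈ sphere c R, f z ≠ 0) :
    CircleIntegrable (fun z => deriv f z / f z) c R := by
  have hs : sphere c R ⊆ U := sphere_subset_closedBall.trans hb
  exact (((hf.deriv hU).continuousOn.mono hs).div (hf.continuousOn.mono hs) h0).circleIntegrable hR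

/-- The argument principle for a function with simple zeros, by splitting off one zero at a time. -/
theorem circleIntegral_logDeriv_eq_card (hR : 0 < R) (hU : IsOpen U) (hb : closedBall c R ⊆ U)
    (Z : Finset ℂ) (f : ℂ → ℂ) (hf : DifferentiableOn ℂ f U)
    (hZ : ∀ z ∈ closedBall c R, f z = 0 ↔ z ∈ Z) (hZb : ∀ z ∈ Z, z ∈ ball c R)
    (hd : ∀ z ∈ Z, deriv f z ≠ 0) :
    (∮ z in C(c, R), deriv f z / f z) = 2 * Real.pi * Complex.I * Z.card := by
  induction Z using Finset.induction_on generalizing f with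
  | empty =>
    have h0 : ∀ z ∈ closedBall c R, f z ≠ 0 := fun z hz h => by simpa using (hZ z hz).1 h
    have : DifferentiableOn ℂ (fun z => deriv f z / f z) (closedBall c R) :=
      ((hf.deriv hU).mono hb).div (hf.mono hb) h0
    rw [← closure_ball c hR.ne'] at this
    simpa using this.diffContOnCl.circleIntegral_eq_zero hR.le
  | insert a Z ha ih =>
    have hab : a ∈ ball c R := hZb a (Finset.mem_insert_self _ _)
    have hac := ball_subset_closedBall hab
    have hfa : f a = 0 := (hZ a hac).2 (Finset.mem_insert_self _ _)
    set g := dslope f a with hgdef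
    have hg : DifferentiableOn ℂ g U :=
      (Complex.differentiableOn_dslope (hU.mem_nhds (hb hac))).2 hf
    have hfg : ∀ z, f z = (z - a) * g z := fun z => by
      have := sub_smul_dslope f a z
      rw [hfa, sub_zero, smul_eq_mul] at this
      exact this.symm
    have hga : g a ≠ 0 := by
      rw [hgdef, dslope_same]
      exact hd a (Finset.mem_insert_self _ _)
    have hderiv : ∀ z ∈ U, deriv f z = g z + (z - a) * deriv g z := by
      intro z hz
      have h1 : HasDerivAt (fun z => (z - a) * g z) (1 * g z + (z - a) * deriv g z) z :=
        ((hasDerivAt_id z).sub_const a).mul (hg.differentiableAt (hU.mem_nhds hz)).hasDerivAt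
      rw [funext hfg, h1.deriv, one_mul]
    have hZg : ∀ z ∈ closedBall c R, g z = 0 ↔ z ∈ Z := by
      intro z hz
      rcases eq_or_ne z a with rfl | hza
      · simp [hga, ha]
      · have := hZ z hz
        rw [hfg, mul_eq_zero, or_iff_right (sub_ne_zero.2 hza), Finset.mem_insert,
          or_iff_right hza] at this
        exact this
    have hdg : ∀ z ∈ Z, deriv g z ≠ 0 := by
      intro z hz h0
      have hzb := ball_subset_closedBall (hZb z (Finset.mem_insert_of_mem hz))
      refine hd z (Finset.mem_insert_of_mem hz) ?_
      rw [hderiv z (hb hzb), h0, (hZg z hzb).2 hz]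
      simp
    have ih' := ih g hg hZg (fun z hz => hZb z (Finset.mem_insert_of_mem hz)) hdg
    have hsne : ∀ z ∈ sphere c R, z - a ≠ 0 := fun z hz h => by
      rw [sub_eq_zero] at h
      subst h
      exact absurd (mem_sphere.1 hz) (mem_ball.1 hab).ne
    have hsg : ∀ z ∈ sphere c R, g z ≠ 0 := fun z hz h => by
      have := (hZg z (sphere_subset_closedBall hz)).1 h
      exact absurd (mem_sphere.1 hz) (mem_ball.1 (hZb z (Finset.mem_insert_of_mem this))).ne
    have e : EqOn (fun z => deriv f z / f z) (fun z => (z - a)⁻¹ + deriv g z / g z)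
        (sphere c R) := by
      intro z hz
      have h1 := hsne z hz
      have h2 := hsg z hz
      simp only [hderiv z (hb (sphere_subset_closedBall hz)), hfg z]
      field_simp
    rw [circleIntegral.integral_congr hR.le e, circleIntegral.integral_add, ih',
      circleIntegral.integral_sub_inv_of_mem_ball hab, Finset.card_insert_of_notMem ha]
    · push_cast
      ring
    · exact ContinuousOn.circleIntegrable hR.le
        (ContinuousOn.inv₀ (by fun_prop) hsne)
    · exact circleIntegrable_logDeriv hR.le hU hb hg hsg

theorem circleIntegral_logDeriv_eq_ncard (hR : 0 < R) (hU : IsOpen U) (hb : closedBall c R ⊆ U)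
    (hf : DifferentiableOn ℂ f U) (h0 : ∀ z ∈ sphere c R, f z ≠ 0)
    (hd : ∀ z ∈ ball c R, f z = 0 → deriv f z ≠ 0) :
    (ball c R ∩ {z | f z = 0}).Finite ∧ (∮ z in C(c, R), deriv f z / f z)
      = 2 * Real.pi * Complex.I * (ball c R ∩ {z | f z = 0}).ncard := by
  have hmem : ∀ z ∈ closedBall c R, f z = 0 → z ∈ ball c R := by
    intro z hz hfz
    rw [← ball_union_sphere] at hz
    exact hz.resolve_right fun h => h0 z h hfz
  have hfin : (ball c R ∩ {z | f z = 0}).Finite := by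
    refine (finite_zeros_of_deriv_ne_zero (isCompact_closedBall c R)
      (fun z hz => hf.differentiableAt (hU.mem_nhds (hb hz)))
      (fun z hz hz0 => hd z (hmem z hz hz0) hz0)).subset ?_
    exact inter_subset_inter_left _ ball_subset_closedBall
  refine ⟨hfin, ?_⟩
  rw [ncard_eq_toFinset_card _ hfin]
  refine circleIntegral_logDeriv_eq_card hR hU hb _ f hf (fun z hz => ?_) (fun z hz => ?_)
    (fun z hz => ?_)
  · simp only [Finite.mem_toFinset, mem_inter_iff, mem_ofPred_eq]
    exact ⟨fun h => ⟨hmem z hz h, h⟩, fun h => h.2⟩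
  · simp only [Finite.mem_toFinset, mem_inter_iff] at hz
    exact hz.1
  · simp only [Finite.mem_toFinset, mem_inter_iff] at hz
    exact hd z hz.1 hz.2

/-- Rouché's theorem in terms of the integral of the logarithmic derivative: the quotient `f / g`
maps the circle into the right half-plane, where it has a logarithm. -/
theorem circleIntegral_logDeriv_eq_of_norm_sub_lt (hR : 0 < R) (hU : IsOpen U)
    (hb : closedBall c R ⊆ U) (hf : DifferentiableOn ℂ f U) (hg : DifferentiableOn ℂ g U)
    (h : ∀ z ∈ sphere c R, ‖f z - g z‖ < ‖g z‖) :
    (∮ z in C(c, R), deriv f z / f z) = ∮ z in C(c, R), deriv g z / g z := by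
  have hg0 : ∀ z ∈ sphere c R, g z ≠ 0 := fun z hz h0 => by
    have := h z hz
    rw [h0, norm_zero] at this
    exact absurd this (norm_nonneg _).not_gt
  have hf0 : ∀ z ∈ sphere c R, f z ≠ 0 := fun z hz h0 => by
    have := h z hz
    rw [h0, zero_sub, norm_neg] at this
    exact lt_irrefl _ this
  rw [← sub_eq_zero, ← circleIntegral.integral_sub
    (circleIntegrable_logDeriv hR.le hU hb hf hf0) (circleIntegrable_logDeriv hR.le hU hb hg hg0)]
  refine circleIntegral.integral_eq_zero_of_hasDerivWithinAt hR.le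
    (f := fun z => Complex.log (f z / g z)) fun z hz => ?_
  have hzU := hU.mem_nhds (hb (sphere_subset_closedBall hz))
  have h1 := (hf.differentiableAt hzU).hasDerivAt
  have h2 := (hg.differentiableAt hzU).hasDerivAt
  have hgz := hg0 z hz
  have hfz := hf0 z hz
  have hslit : f z / g z ∈ Complex.slitPlane := by
    left
    have h3 : ‖f z / g z - 1‖ < 1 := by
      rw [div_sub_one hgz, norm_div, div_lt_one (norm_pos_iff.2 hgz)]
      exact h z hz
    have h4 := (Complex.abs_re_le_norm (f z / g z - 1)).trans_lt h3
    rw [Complex.sub_re, Complex.one_re, abs_lt] at h4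
    linarith [h4.1]
  refine (((h1.div h2 hgz).clog hslit).congr_deriv ?_).hasDerivWithinAt
  simp only [Pi.div_apply]
  field_simp

/-- Rouché's theorem for a perturbation of a product, all zeros being simple. -/
theorem ncard_zeros_eq_add_of_norm_sub_lt (hR : 0 < R) (hU : IsOpen U)
    (hb : closedBall c R ⊆ U) (hf : DifferentiableOn ℂ f U) (hv : DifferentiableOn ℂ v U)
    (hw : DifferentiableOn ℂ w U)
    (h : ∀ z ∈ sphere c R, ‖f z - v z * w z‖ < ‖v z * w z‖)
    (hdf : ∀ z ∈ ball c R, f z = 0 → deriv f z ≠ 0)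
    (hdv : ∀ z ∈ ball c R, v z = 0 → deriv v z ≠ 0)
    (hdw : ∀ z ∈ ball c R, w z = 0 → deriv w z ≠ 0) :
    (ball c R ∩ {z | f z = 0}).Finite ∧ (ball c R ∩ {z | f z = 0}).ncard
      = (ball c R ∩ {z | v z = 0}).ncard + (ball c R ∩ {z | w z = 0}).ncard := by
  have hvw0 : ∀ z ∈ sphere c R, v z * w z ≠ 0 := fun z hz h0 => by
    have := h z hz
    rw [h0, norm_zero] at this
    exact absurd this (norm_nonneg _).not_gt
  have hv0 := fun z hz => left_ne_zero_of_mul (hvw0 z hz)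
  have hw0 := fun z hz => right_ne_zero_of_mul (hvw0 z hz)
  have hf0 : ∀ z ∈ sphere c R, f z ≠ 0 := fun z hz h0 => by
    have := h z hz
    rw [h0, zero_sub, norm_neg] at this
    exact lt_irrefl _ this
  obtain ⟨h1, h2⟩ := circleIntegral_logDeriv_eq_ncard hR hU hb hf hf0 hdf
  obtain ⟨-, h3⟩ := circleIntegral_logDeriv_eq_ncard hR hU hb hv hv0 hdv
  obtain ⟨-, h4⟩ := circleIntegral_logDeriv_eq_ncard hR hU hb hw hw0 hdw
  refine ⟨h1, ?_⟩
  have e : EqOn (fun z => deriv (fun z => v z * w z) z / (v z * w z))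
      (fun z => deriv v z / v z + deriv w z / w z) (sphere c R) := by
    intro z hz
    have hzU := hU.mem_nhds (hb (sphere_subset_closedBall hz))
    have h5 := (hv.differentiableAt hzU).hasDerivAt
    have h6 := (hw.differentiableAt hzU).hasDerivAt
    have h7 := hv0 z hz
    have h8 := hw0 z hz
    simp only
    rw [show deriv (fun z => v z * w z) z = _ from (h5.mul h6).deriv]
    field_simp
  rw [circleIntegral_logDeriv_eq_of_norm_sub_lt hR hU hb hf (hv.mul hw) h] at h2
  have h9 := circleIntegral.integral_congr hR.le e
  rw [circleIntegral.integral_add (circleIntegrable_logDeriv hR.le hU hb hv hv0)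
    (circleIntegrable_logDeriv hR.le hU hb hw hw0), h3, h4] at h9
  have h10 := h2.symm.trans h9
  rw [← mul_add] at h10
  exact_mod_cast mul_left_cancel₀ Complex.two_pi_I_ne_zero h10

end ZeroCounting

/-! ### Asymptotics of the characteristic function -/

namespace SLProblem

section LeadingTerms

variable (P : SLProblem)

/-- The phase of the leading term of the derivative of the left solution at `c`: this term is
`σ_L k_L sin (s (c - a) + θ_L)`. -/
noncomputable def thL : ℝ := if P.α11 = 0 then Real.pi / 2 else 0

/-- The constant factor of that leading term. -/
noncomputable def kL : ℝ := if P.α11 = 0 then -P.α10 else -P.α11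

/-- The power of `s` in that leading term. -/
noncomputable def sigL (s : ℂ) : ℂ := if P.α11 = 0 then 1 else s

/-- The phase of the leading term of the boundary form at `b` of the solution with `y(c) = 1`,
`y'(c) = 0`: this term is `σ_R k_R sin (s (b - c) + θ_R)`. -/
noncomputable def thR : ℝ := if P.α21' = 0 then Real.pi / 2 else 0

/-- The constant factor of that leading term. -/
noncomputable def kR : ℝ := if P.α21' = 0 then P.α20' else P.α21'

/-- The power of `s` in that leading term. -/
noncomputable def sigR (s : ℂ) : ℂ := if P.α21' = 0 then s ^ 2 else s ^ 3

variable {P}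

theorem kL_ne_zero (hα : P.α10 ≠ 0 ∨ P.α11 ≠ 0) : P.kL ≠ 0 := by
  rw [kL]
  split_ifs with h
  · exact neg_ne_zero.2 (hα.resolve_right (by simpa using h))
  · exact neg_ne_zero.2 h

theorem kR_ne_zero (hP : P.Admissible) : P.kR ≠ 0 := by
  rw [kR]
  split_ifs with h
  · intro h0
    have := hP.Δ0_pos
    simp [Δ0, Matrix.det_fin_two, h, h0] at this
  · exact h

theorem sigL_ne_zero {s : ℂ} (hs : s ≠ 0) : P.sigL s ≠ 0 := by
  rw [sigL]; split_ifs <;> simp [hs]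

theorem sigR_ne_zero {s : ℂ} (hs : s ≠ 0) : P.sigR s ≠ 0 := by
  rw [sigR]; split_ifs <;> simp [hs]

theorem sin_add_half_pi (z : ℂ) : Complex.sin (z + ((Real.pi / 2 : ℝ) : ℂ)) = Complex.cos z := by
  push_cast
  exact Complex.sin_add_pi_div_two z

end LeadingTerms

namespace Ext

variable {P : SLProblem} (X : P.Ext) (hP : P.Admissible)

/-- The growth of `yL` and `dyL` at `c`. -/
theorem left_asymptotics (hP : P.Admissible) : ∃ C ≥ 0, ∃ S > 0, ∀ s : ℂ, S ≤ ‖s‖ →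
    ‖X.dyL (s ^ 2) P.c - P.sigL s * (P.kL * Complex.sin (s * (P.c - P.a) + P.thL))‖
      ≤ C * ‖P.sigL s‖ / ‖s‖ * Real.exp (|s.im| * (P.c - P.a)) ∧
    ‖X.yL (s ^ 2) P.c‖ ≤ C * ‖P.sigL s‖ / ‖s‖ * Real.exp (|s.im| * (P.c - P.a)) := by
  have hac := hP.hac
  have hQ0 : 0 ≤ X.QL := (abs_nonneg _).trans (X.boundL 0)
  set K := 2 * (X.QL * (P.c - P.a)) with hK
  have hK0 : 0 ≤ K := by have := sub_pos.2 hac; positivity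
  have hc := right_mem_Icc.2 hac.le
  refine ⟨(K + 2) * (|P.α11| + |P.α10|) + |P.α10|, by positivity, max K 1, by positivity,
    fun s hs => ?_⟩
  have hs1 : 1 ≤ ‖s‖ := (le_max_right _ _).trans hs
  have hs0 : s ≠ 0 := norm_pos_iff.1 (zero_lt_one.trans_le hs1)
  have hsK : K ≤ ‖s‖ := (le_max_left _ _).trans hs
  have h1 := ((X.isSol_left (s ^ 2)).asymptotics X.contL X.boundL hac.le hsK hs0 P.c hc).2
  have h2 := (X.isSol_left (s ^ 2)).norm_le X.contL X.boundL hac.le hsK hs0 P.c hc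
  rw [yL_a, dyL_a] at h1 h2
  rw [norm_neg, Complex.norm_real, Complex.norm_real, Real.norm_eq_abs, Real.norm_eq_abs,
    ← hK] at h1
  rw [norm_neg, Complex.norm_real, Complex.norm_real, Real.norm_eq_abs, Real.norm_eq_abs] at h2
  have hcos := norm_cos_le_exp (s * (P.c - P.a))
  have him : |(s * ((P.c : ℂ) - P.a)).im| = |s.im| * (P.c - P.a) := by
    rw [← Complex.ofReal_sub, Complex.im_mul_ofReal, abs_mul, abs_of_nonneg (sub_nonneg.2 hac.le)]
  rw [him] at hcos
  set E := Real.exp (|s.im| * (P.c - P.a))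
  have hE : 0 < E := Real.exp_pos _
  have hs' : 0 < ‖s‖ := by linarith
  by_cases hα : P.α11 = 0
  · simp only [sigL, kL, thL, if_pos hα, sin_add_half_pi]
    simp only [hα, abs_zero, zero_add, Complex.ofReal_zero, mul_zero, zero_mul, neg_zero] at h1 h2 ⊢
    constructor
    · have e : (1 : ℂ) * (((-P.α10 : ℝ) : ℂ) * Complex.cos (s * (P.c - P.a)))
          = -(P.α10 : ℂ) * Complex.cos (s * (P.c - P.a)) := by push_cast; ring
      rw [e]
      refine h1.trans ?_
      rw [norm_one, mul_one, ← mul_div_assoc]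
      gcongr
      nlinarith [abs_nonneg P.α10]
    · refine h2.trans ?_
      rw [norm_one, mul_one, ← mul_div_assoc]
      gcongr
      nlinarith [abs_nonneg P.α10]
  · simp only [sigL, kL, thL, if_neg hα, Complex.ofReal_zero, add_zero]
    have hle : |P.α11| + |P.α10| / ‖s‖ ≤ |P.α11| + |P.α10| := by
      gcongr
      exact div_le_self (abs_nonneg _) hs1
    constructor
    · have e : X.dyL (s ^ 2) P.c - s * (((-P.α11 : ℝ) : ℂ) * Complex.sin (s * (P.c - P.a)))
          = (X.dyL (s ^ 2) P.c - (-(s * P.α11 * Complex.sin (s * (P.c - P.a)))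
            + -(P.α10 : ℂ) * Complex.cos (s * (P.c - P.a))))
            - (P.α10 : ℂ) * Complex.cos (s * (P.c - P.a)) := by push_cast; ring
      rw [e]
      refine (norm_sub_le_of_le h1 (norm_mul_le _ _)).trans ?_
      rw [mul_div_assoc, div_self hs'.ne', mul_one, Complex.norm_real, Real.norm_eq_abs]
      calc K * (|P.α11| + |P.α10| / ‖s‖) * E + |P.α10| * ‖Complex.cos (s * (P.c - P.a))‖
          ≤ K * (|P.α11| + |P.α10|) * E + |P.α10| * E := by gcongr
        _ = (K * (|P.α11| + |P.α10|) + |P.α10|) * E := by ring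
        _ ≤ _ := by
          gcongr
          linarith
    · refine h2.trans ?_
      rw [mul_div_assoc, div_self hs'.ne', mul_one]
      gcongr
      nlinarith [abs_nonneg P.α10, abs_nonneg P.α11]

/-- The boundary form at `b`, applied to values `y`, `y'`. -/
noncomputable def bForm (P : SLProblem) (lam y y' : ℂ) : ℂ :=
  (P.α20 + lam * P.α20') * y - (P.α21 + lam * P.α21') * y'

/-- The asymptotics and the growth at `b` of the two solutions that are normalized at `c`. -/
theorem right_basis_bounds (hP : P.Admissible) : ∃ K ≥ 0, ∀ s : ℂ, max K 1 ≤ ‖s‖ →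
    ∀ E, E = Real.exp (|s.im| * (P.b - P.c)) →
    ‖ivp X.qR (s ^ 2) P.c 1 0 P.b - Complex.cos (s * (P.b - P.c))‖ ≤ K * (1 / ‖s‖) * E ∧
    ‖divp X.qR (s ^ 2) P.c 1 0 P.b - -(s * Complex.sin (s * (P.b - P.c)))‖ ≤ K * E ∧
    ‖ivp X.qR (s ^ 2) P.c 1 0 P.b‖ ≤ 2 * E ∧
    ‖divp X.qR (s ^ 2) P.c 1 0 P.b‖ ≤ (K + 1) * ‖s‖ * E ∧
    ‖ivp X.qR (s ^ 2) P.c 0 1 P.b‖ ≤ 2 * (1 / ‖s‖) * E ∧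
    ‖divp X.qR (s ^ 2) P.c 0 1 P.b‖ ≤ (K + 1) * E := by
  have hcb := hP.hcb
  have hQ0 : 0 ≤ X.QR := (abs_nonneg _).trans (X.boundR 0)
  set K := 2 * (X.QR * (P.b - P.c)) with hK
  have hK0 : 0 ≤ K := by have := sub_pos.2 hcb; positivity
  have hb := right_mem_Icc.2 hcb.le
  refine ⟨K, hK0, fun s hs E hE => ?_⟩
  have hs1 : 1 ≤ ‖s‖ := (le_max_right _ _).trans hs
  have hs0 : s ≠ 0 := norm_pos_iff.1 (zero_lt_one.trans_le hs1)
  have hsK : K ≤ ‖s‖ := (le_max_left _ _).trans hs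
  have hsolC := isSol_ivp (x₀ := P.c) X.contR X.boundR (s ^ 2) 1 0
  have hsolS := isSol_ivp (x₀ := P.c) X.contR X.boundR (s ^ 2) 0 1
  obtain ⟨h1, h2⟩ := hsolC.asymptotics X.contR X.boundR hcb.le hsK hs0 P.b hb
  have h3 := hsolC.norm_le X.contR X.boundR hcb.le hsK hs0 P.b hb
  obtain ⟨-, h4⟩ := hsolS.asymptotics X.contR X.boundR hcb.le hsK hs0 P.b hb
  have h5 := hsolS.norm_le X.contR X.boundR hcb.le hsK hs0 P.b hb
  simp only [ivp_self X.contR X.boundR, divp_self, norm_one, norm_zero, ← hK, zero_div, zero_mul,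
    mul_zero, neg_zero, add_zero, zero_add, one_mul, mul_one] at h1 h2 h3 h4 h5
  have hcos := norm_cos_le_exp (s * (P.b - P.c))
  have hsin := norm_sin_le_exp (s * (P.b - P.c))
  have him : |(s * ((P.b : ℂ) - P.c)).im| = |s.im| * (P.b - P.c) := by
    rw [← Complex.ofReal_sub, Complex.im_mul_ofReal, abs_mul, abs_of_nonneg (sub_nonneg.2 hcb.le)]
  rw [him] at hcos hsin
  rw [← hE] at h1 h2 h3 h4 h5 hcos hsin
  have hE0 : 0 < E := hE ▸ Real.exp_pos _
  refine ⟨h1, h2, h3, ?_, h5, ?_⟩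
  · refine (norm_le_norm_sub_add _ (-(s * Complex.sin (s * (P.b - P.c))))).trans ?_
    rw [norm_neg, norm_mul]
    calc _ ≤ K * E + ‖s‖ * E := by gcongr
      _ ≤ K * ‖s‖ * E + ‖s‖ * E := by
          gcongr
          exact le_mul_of_one_le_right hK0 hs1
      _ = _ := by ring
  · refine (norm_le_norm_sub_add _ (Complex.cos (s * (P.b - P.c)))).trans ?_
    have : K * (1 / ‖s‖) ≤ K := by
      rw [mul_one_div]; exact div_le_self hK0 hs1
    nlinarith

/-- The triangle inequality in the form used for boundary forms. -/
theorem norm_linear_comb_le {A : ℝ} {lam y y' z z' : ℂ} {p p' r r' : ℝ} {α β γ δ : ℝ}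
    (h1 : |α| ≤ A) (h2 : |β| ≤ A) (h3 : |γ| ≤ A) (h4 : |δ| ≤ A) (hy : ‖y‖ ≤ p) (hy' : ‖y'‖ ≤ p')
    (hz : ‖z‖ ≤ r) (hz' : ‖z'‖ ≤ r') :
    ‖α * y - β * y' + lam * (γ * z - δ * z')‖ ≤ A * (p + p' + ‖lam‖ * (r + r')) := by
  have hA : 0 ≤ A := (abs_nonneg _).trans h1
  have na : ∀ t : ℝ, ‖(t : ℂ)‖ = |t| := fun t => by rw [Complex.norm_real, Real.norm_eq_abs]
  refine (norm_add_le_of_le (norm_sub_le _ _) ((norm_mul_le _ _).trans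
    (mul_le_mul_of_nonneg_left (norm_sub_le _ _) (norm_nonneg _)))).trans ?_
  simp only [norm_mul, na]
  calc |α| * ‖y‖ + |β| * ‖y'‖ + ‖lam‖ * (|γ| * ‖z‖ + |δ| * ‖z'‖)
      ≤ A * p + A * p' + ‖lam‖ * (A * r + A * r') := by gcongr
    _ = _ := by ring

/-- The growth of the boundary form at `b` of the two solutions that are normalized at `c`. -/
theorem right_asymptotics (hP : P.Admissible) : ∃ C ≥ 0, ∃ S > 0, ∀ s : ℂ, S ≤ ‖s‖ →
    ‖bForm P (s ^ 2) (ivp X.qR (s ^ 2) P.c 1 0 P.b) (divp X.qR (s ^ 2) P.c 1 0 P.b)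
        - P.sigR s * (P.kR * Complex.sin (s * (P.b - P.c) + P.thR))‖
      ≤ C * ‖P.sigR s‖ / ‖s‖ * Real.exp (|s.im| * (P.b - P.c)) ∧
    ‖bForm P (s ^ 2) (ivp X.qR (s ^ 2) P.c 0 1 P.b) (divp X.qR (s ^ 2) P.c 0 1 P.b)‖
      ≤ C * ‖P.sigR s‖ / ‖s‖ * Real.exp (|s.im| * (P.b - P.c)) := by
  obtain ⟨K, hK0, hbd⟩ := X.right_basis_bounds hP
  set A := |P.α20| + |P.α21| + |P.α20'| + |P.α21'| with hA
  have hA0 : 0 ≤ A := by positivity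
  have b1 := abs_nonneg P.α20
  have b2 := abs_nonneg P.α21
  have b3 := abs_nonneg P.α20'
  have b4 := abs_nonneg P.α21'
  have a1 : |P.α20| ≤ A := by linarith
  have a2 : |P.α21| ≤ A := by linarith
  have a3 : |P.α20'| ≤ A := by linarith
  have a4 : |P.α21'| ≤ A := by linarith
  have a0 : |(0 : ℝ)| ≤ A := by simpa using hA0
  refine ⟨A * (3 * K + 10), by positivity, max K 1, by positivity, fun s hs => ?_⟩
  obtain ⟨h1, h2, h3, h4, h5, h6⟩ := hbd s hs _ rfl
  have hs1 : 1 ≤ ‖s‖ := (le_max_right _ _).trans hs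
  generalize Real.exp (|s.im| * (P.b - P.c)) = E at *
  have hE : 0 ≤ E := by linarith [norm_nonneg (ivp X.qR (s ^ 2) P.c 1 0 P.b)]
  generalize ivp X.qR (s ^ 2) P.c 1 0 P.b = c₁ at *
  generalize divp X.qR (s ^ 2) P.c 1 0 P.b = c₂ at *
  generalize ivp X.qR (s ^ 2) P.c 0 1 P.b = s₁ at *
  generalize divp X.qR (s ^ 2) P.c 0 1 P.b = s₂ at *
  set r := ‖s‖ with hr
  have hr0 : 0 < r := by linarith
  have hri : 1 / r ≤ 1 := div_le_one_of_le₀ hs1 hr0.le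
  have hr1 : r ≤ r ^ 2 := by nlinarith
  have hl : ‖s ^ 2‖ = r ^ 2 := by rw [norm_pow]
  by_cases hα : P.α21' = 0
  · simp only [sigR, kR, thR, if_pos hα, sin_add_half_pi, bForm]
    rw [show (P.α21' : ℂ) = 0 by simp [hα]]
    have hsig : ∀ C : ℝ, C * ‖s ^ 2‖ / r * E = C * (r * E) := fun C => by
      rw [hl]; field_simp
    rw [hsig, mul_assoc]
    constructor
    · have := norm_linear_comb_le (lam := s ^ 2) a1 a2 a3 a0 h3 h4 h1 (norm_zero (E := ℂ)).le
      rw [hl] at this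
      refine (le_of_eq ?_).trans (this.trans (mul_le_mul_of_nonneg_left ?_ hA0))
      · congr 1; push_cast; ring
      · calc 2 * E + (K + 1) * r * E + r ^ 2 * (K * (1 / r) * E + 0)
            = (2 + (K + 1) * r + K * r) * E := by field_simp; ring
          _ ≤ (2 * r + (K + 1) * r + K * r) * E := by gcongr; linarith
          _ = (2 * K + 3) * (r * E) := by ring
          _ ≤ _ := by gcongr <;> linarith
    · have := norm_linear_comb_le (lam := s ^ 2) a1 a2 a3 a0 h5 h6 h5 (norm_zero (E := ℂ)).le
      rw [hl] at this
      refine (le_of_eq ?_).trans (this.trans (mul_le_mul_of_nonneg_left ?_ hA0))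
      · congr 1; push_cast; ring
      · calc 2 * (1 / r) * E + (K + 1) * E + r ^ 2 * (2 * (1 / r) * E + 0)
            = (2 * (1 / r) + (K + 1) * 1 + 2 * r) * E := by field_simp; ring
          _ ≤ (2 * r + (K + 1) * r + 2 * r) * E := by gcongr; linarith
          _ = (K + 5) * (r * E) := by ring
          _ ≤ _ := by gcongr <;> linarith
  · simp only [sigR, kR, thR, if_neg hα, Complex.ofReal_zero, add_zero, bForm]
    have hsig : ∀ C : ℝ, C * ‖s ^ 3‖ / r * E = C * (r ^ 2 * E) := fun C => by
      rw [norm_pow, ← hr]; field_simp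
    rw [hsig, mul_assoc]
    constructor
    · have := norm_linear_comb_le (lam := s ^ 2) a1 a2 a3 a4 h3 h4 h3 h2
      rw [hl] at this
      refine (le_of_eq ?_).trans (this.trans (mul_le_mul_of_nonneg_left ?_ hA0))
      · congr 1; ring
      · calc 2 * E + (K + 1) * r * E + r ^ 2 * (2 * E + K * E)
            = (2 * 1 + (K + 1) * r + (2 + K) * r ^ 2) * E := by ring
          _ ≤ (2 * r ^ 2 + (K + 1) * r ^ 2 + (2 + K) * r ^ 2) * E := by gcongr; linarith
          _ = (2 * K + 5) * (r ^ 2 * E) := by ring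
          _ ≤ _ := by gcongr <;> linarith
    · have := norm_linear_comb_le (lam := s ^ 2) a1 a2 a3 a4 h5 h6 h5 h6
      rw [hl] at this
      refine (le_of_eq ?_).trans (this.trans (mul_le_mul_of_nonneg_left ?_ hA0))
      · congr 1; ring
      · calc 2 * (1 / r) * E + (K + 1) * E + r ^ 2 * (2 * (1 / r) * E + (K + 1) * E)
            = (2 * (1 / r) + (K + 1) * 1 + r ^ 2 * (2 * (1 / r) + (K + 1))) * E := by ring
          _ ≤ (2 * r ^ 2 + (K + 1) * r ^ 2 + r ^ 2 * (2 * 1 + (K + 1))) * E := by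
            gcongr <;> linarith
          _ = (2 * K + 6) * (r ^ 2 * E) := by ring
          _ ≤ _ := by gcongr <;> linarith

/-- Expansion of the characteristic function in the solutions that are normalized at `c`. The main
contribution is the product of `Δ24 dyL(c)` and the first boundary form. -/
theorem charFun_eq_bForm (hP : P.Admissible) (lam : ℂ) :
    P.Δ12 * X.charFun lam
      = (P.Δ23 * X.yL lam P.c + P.Δ24 * X.dyL lam P.c)
          * bForm P lam (ivp X.qR lam P.c 1 0 P.b) (divp X.qR lam P.c 1 0 P.b)
        - (P.Δ13 * X.yL lam P.c + P.Δ14 * X.dyL lam P.c)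
          * bForm P lam (ivp X.qR lam P.c 0 1 P.b) (divp X.qR lam P.c 0 1 P.b) := by
  have hΔ : (P.Δ12 : ℂ) ≠ 0 := by exact_mod_cast hP.Δ12_pos.ne'
  rw [charFun, bdry, yR_eq, dyR_eq, phi₂c, dphi₂c, X.phi₁c_eq _ hP, X.dphi₁c_eq _ hP, bForm, bForm]
  field_simp
  ring

/-- Up to the power `σ_L σ_R` of `s` and constants, the leading term of the characteristic function
is a product `V W`. The error is `O((|V| + |W|) / s + 1 / s ^ 2)` and not merely `O(1 / s)`.
Therefore `V W` dominates as soon as both factors are large compared with `1 / s`, even where zeros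
of `V` and of `W` come close to each other. -/
theorem charFun_asymptotics (hP : P.Admissible) : ∃ C ≥ 0, ∃ S > 0, ∀ s : ℂ, S ≤ ‖s‖ →
    ∀ V W : ℂ, V = P.kL * Complex.sin (s * (P.c - P.a) + P.thL) →
    W = P.kR * Complex.sin (s * (P.b - P.c) + P.thR) →
    ‖P.Δ12 * X.charFun (s ^ 2) - P.Δ24 * ((P.sigL s * V) * (P.sigR s * W))‖
      ≤ C * (‖P.sigL s‖ * ‖P.sigR s‖) *
        ((‖V‖ * Real.exp (|s.im| * (P.b - P.c)) + ‖W‖ * Real.exp (|s.im| * (P.c - P.a))) / ‖s‖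
          + Real.exp (|s.im| * (P.c - P.a)) * Real.exp (|s.im| * (P.b - P.c)) / ‖s‖ ^ 2) := by
  obtain ⟨C₁, hC₁, S₁, hS₁, hL⟩ := X.left_asymptotics hP
  obtain ⟨C₂, hC₂, S₂, hS₂, hR⟩ := X.right_asymptotics hP
  set D := |P.Δ24| + |P.Δ23| + |P.Δ13| + |P.Δ14| with hD
  have hD0 : 0 ≤ D := by positivity
  refine ⟨D * (C₁ + C₂ + C₁ * C₂), by positivity, max S₁ S₂, by positivity,
    fun s hs V W hV hW => ?_⟩
  have hs' : 0 < ‖s‖ := hS₁.trans_le ((le_max_left _ _).trans hs)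
  have hs0 : s ≠ 0 := norm_pos_iff.1 hs'
  obtain ⟨hv, hu⟩ := hL s ((le_max_left _ _).trans hs)
  obtain ⟨hw, hb⟩ := hR s ((le_max_right _ _).trans hs)
  rw [← hV] at hv
  rw [← hW] at hw
  rw [X.charFun_eq_bForm hP]
  set EL := Real.exp (|s.im| * (P.c - P.a))
  set ER := Real.exp (|s.im| * (P.b - P.c))
  have hEL : 0 < EL := Real.exp_pos _
  have hER : 0 < ER := Real.exp_pos _
  set u := X.yL (s ^ 2) P.c
  set v := X.dyL (s ^ 2) P.c
  set w := bForm P (s ^ 2) (ivp X.qR (s ^ 2) P.c 1 0 P.b) (divp X.qR (s ^ 2) P.c 1 0 P.b)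
  set b := bForm P (s ^ 2) (ivp X.qR (s ^ 2) P.c 0 1 P.b) (divp X.qR (s ^ 2) P.c 0 1 P.b)
  set σL := P.sigL s
  set σR := P.sigR s
  -- `v₁` and `w₁` are the errors of the two factors.
  obtain ⟨v₁, hv₁⟩ : ∃ v₁, v₁ = v - σL * V := ⟨_, rfl⟩
  obtain ⟨w₁, hw₁⟩ : ∃ w₁, w₁ = w - σR * W := ⟨_, rfl⟩
  rw [← hv₁] at hv
  rw [← hw₁] at hw
  set r := ‖s‖
  set l := ‖σL‖
  set m := ‖σR‖
  have hl : 0 ≤ l := norm_nonneg _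
  have hm : 0 ≤ m := norm_nonneg _
  have e : (P.Δ23 * u + P.Δ24 * v) * w - (P.Δ13 * u + P.Δ14 * v) * b
      - P.Δ24 * ((σL * V) * (σR * W))
      = P.Δ24 * (σL * V * w₁ + v₁ * (σR * W) + v₁ * w₁) + P.Δ23 * (u * (σR * W) + u * w₁)
        - P.Δ13 * (u * b) - P.Δ14 * (σL * V * b + v₁ * b) := by
    rw [hv₁, hw₁]; ring
  rw [e]
  have na : ∀ t : ℝ, ‖(t : ℂ)‖ = |t| := fun t => by rw [Complex.norm_real, Real.norm_eq_abs]
  set x := C₁ * l / r * EL with hx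
  set y := C₂ * m / r * ER with hy
  have hx0 : 0 ≤ x := by positivity
  have hy0 : 0 ≤ y := by positivity
  set p := ‖V‖
  set q := ‖W‖
  have hp : 0 ≤ p := norm_nonneg _
  have hq : 0 ≤ q := norm_nonneg _
  have n1 : ‖σL * V * w₁ + v₁ * (σR * W) + v₁ * w₁‖ ≤ l * p * y + x * (m * q) + x * y := by
    refine norm_add_le_of_le (norm_add_le_of_le ?_ ?_) ?_ <;> simp only [norm_mul] <;> gcongr
  have n2 : ‖u * (σR * W) + u * w₁‖ ≤ x * (m * q) + x * y := by
    refine norm_add_le_of_le ?_ ?_ <;> simp only [norm_mul] <;> gcongr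
  have n3 : ‖u * b‖ ≤ x * y := by rw [norm_mul]; gcongr
  have n4 : ‖σL * V * b + v₁ * b‖ ≤ l * p * y + x * y := by
    refine norm_add_le_of_le ?_ ?_ <;> simp only [norm_mul] <;> gcongr
  set T := l * p * y + x * (m * q) + x * y with hT
  have hlp : 0 ≤ l * p * y := by positivity
  have hmq : 0 ≤ x * (m * q) := by positivity
  have hxy : 0 ≤ x * y := by positivity
  have hT0 : 0 ≤ T := by positivity
  calc _ ≤ |P.Δ24| * T + |P.Δ23| * T + |P.Δ13| * T + |P.Δ14| * T := by
        refine norm_sub_le_of_le (norm_sub_le_of_le (norm_add_le_of_le ?_ ?_) ?_) ?_ <;>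
          rw [norm_mul, na] <;> refine mul_le_mul_of_nonneg_left ?_ (abs_nonneg _)
        · exact n1
        · exact n2.trans (by linarith)
        · exact n3.trans (by linarith)
        · exact n4.trans (by linarith)
    _ = D * (l * m * (C₂ * (p * ER / r) + C₁ * (q * EL / r) + C₁ * C₂ * (EL * ER / r ^ 2))) := by
        rw [hD, hT, hx, hy]
        field_simp
    _ ≤ D * (l * m * ((C₁ + C₂ + C₁ * C₂) * (p * ER / r)
          + (C₁ + C₂ + C₁ * C₂) * (q * EL / r)
          + (C₁ + C₂ + C₁ * C₂) * (EL * ER / r ^ 2))) := by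
        have : 0 ≤ C₁ * C₂ := by positivity
        gcongr <;> linarith
    _ = _ := by ring

end Ext

end SLProblem

/-! ### Lower bounds for sines, and square roots -/

section Sine

theorem normSq_sin (z : ℂ) :
    ‖Complex.sin z‖ ^ 2 = Real.sin z.re ^ 2 + Real.sinh z.im ^ 2 := by
  rw [← Complex.normSq_eq_norm_sq, Complex.sin_eq, Complex.normSq_apply]
  simp only [← Complex.ofReal_sin, ← Complex.ofReal_cosh, ← Complex.ofReal_cos,
    ← Complex.ofReal_sinh, Complex.add_re, Complex.mul_re, Complex.ofReal_re, Complex.ofReal_im,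
    Complex.I_re, Complex.I_im, Complex.add_im, Complex.mul_im]
  have h1 := Real.cosh_sq z.im
  have h2 := Real.sin_sq_add_cos_sq z.re
  ring_nf
  linear_combination Real.sin z.re ^ 2 * h1 + Real.sinh z.im ^ 2 * h2

theorem abs_sinh_im_le_norm_sin (z : ℂ) : |Real.sinh z.im| ≤ ‖Complex.sin z‖ := by
  refine abs_le_of_sq_le_sq ?_ (norm_nonneg _)
  rw [normSq_sin]
  nlinarith [sq_nonneg (Real.sin z.re)]

theorem abs_le_abs_sinh (y : ℝ) : |y| ≤ |Real.sinh y| := by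
  rw [Real.abs_sinh]
  exact Real.self_le_sinh_iff.2 (abs_nonneg y)

theorem mul_abs_le_abs_sin {x : ℝ} (hx : |x| ≤ Real.pi / 2) : 2 / Real.pi * |x| ≤ |Real.sin x| := by
  have h := Real.mul_le_sin (abs_nonneg x) hx
  rcases abs_cases x with ⟨h1, h2⟩ | ⟨h1, h2⟩
  · rw [h1] at h ⊢
    exact h.trans (le_abs_self _)
  · rw [h1, Real.sin_neg] at h
    rw [h1]
    exact h.trans (neg_le_abs _)

/-- Jordan's inequality in a vertical strip. -/
theorem mul_norm_le_norm_sin {z : ℂ} (hz : |z.re| ≤ Real.pi / 2) :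
    2 / Real.pi * ‖z‖ ≤ ‖Complex.sin z‖ := by
  have hpi := Real.pi_pos
  have h1 := mul_abs_le_abs_sin hz
  have h2 := abs_le_abs_sinh z.im
  have h3 : 2 / Real.pi ≤ 1 := (div_le_one hpi).2 Real.two_le_pi
  have h4 : 2 / Real.pi * |z.im| ≤ |Real.sinh z.im| :=
    (mul_le_of_le_one_left (abs_nonneg _) h3).trans h2
  refine (sq_le_sq₀ (by positivity) (norm_nonneg _)).1 ?_
  rw [mul_pow, ← Complex.normSq_eq_norm_sq z, Complex.normSq_apply, normSq_sin,
    ← sq_abs (Real.sin _), ← sq_abs (Real.sinh _)]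
  have h5 := pow_le_pow_left₀ (by positivity) h1 2
  have h6 := pow_le_pow_left₀ (by positivity) h4 2
  rw [mul_pow, sq_abs] at h5 h6
  nlinarith

theorem norm_sin_sub_int_mul_pi (z : ℂ) (n : ℤ) :
    ‖Complex.sin (z - n * Real.pi)‖ = ‖Complex.sin z‖ := by
  rw [Complex.sin_antiperiodic.sub_int_mul_eq, norm_mul]
  rcases Int.units_eq_one_or n.negOnePow with h | h <;> simp [h]

variable {ℓ θ : ℝ} {j : ℤ} {p : ℤ → ℝ} {s : ℂ}

/-- Near a given point, `sin (s ℓ + θ)` is bounded below by the distance to the nearest zero. -/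
theorem exists_near_zero (hℓ : 0 < ℓ) (hp : ∀ n, p n = ((n + j : ℤ) * Real.pi - θ) / ℓ) (s : ℂ) :
    ∃ n, |s.re - p n| ≤ Real.pi / (2 * ℓ) ∧
      2 * ℓ / Real.pi * ‖s - p n‖ ≤ ‖Complex.sin (s * ℓ + θ)‖ := by
  have hpi := Real.pi_pos
  set m := round ((s.re * ℓ + θ) / Real.pi) with hm
  refine ⟨m - j, ?_⟩
  have hpm : p (m - j) = (m * Real.pi - θ) / ℓ := by rw [hp]; simp
  have hr := abs_sub_round ((s.re * ℓ + θ) / Real.pi)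
  rw [← hm] at hr
  have h1 : |s.re * ℓ + θ - m * Real.pi| ≤ Real.pi / 2 := by
    have : s.re * ℓ + θ - m * Real.pi = ((s.re * ℓ + θ) / Real.pi - m) * Real.pi := by field_simp
    rw [this, abs_mul, abs_of_pos hpi]
    nlinarith
  have h2 : s.re - p (m - j) = (s.re * ℓ + θ - m * Real.pi) / ℓ := by
    rw [hpm]; field_simp; ring
  have h3 : (s - p (m - j)) * ℓ = s * ℓ + θ - m * Real.pi := by
    rw [hpm]; push_cast
    have : (ℓ : ℂ) ≠ 0 := by exact_mod_cast hℓ.ne'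
    field_simp
    ring
  constructor
  · rw [h2, abs_div, abs_of_pos hℓ, ← div_div]
    gcongr
  · rw [← norm_sin_sub_int_mul_pi _ m, ← h3]
    have h4 : |((s - p (m - j)) * ℓ).re| ≤ Real.pi / 2 := by
      rw [h3]; simpa using h1
    refine le_trans (le_of_eq ?_) (mul_norm_le_norm_sin h4)
    rw [norm_mul, Complex.norm_real, Real.norm_eq_abs, abs_of_pos hℓ]
    ring

/-- If `s ^ 2` has distance at least `K` from the squares of the zeros, then `sin (s ℓ + θ)` is
at least of order `K / s`. -/
theorem le_norm_sin_of_separated {T K : ℝ} (hℓ : 0 < ℓ)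
    (hp : ∀ n, p n = ((n + j : ℤ) * Real.pi - θ) / ℓ) (hT : 0 ≤ T)
    (hs : T + Real.pi / ℓ ≤ s.re) (hK : ∀ n, T ≤ p n → K ≤ ‖s ^ 2 - (p n : ℂ) ^ 2‖) :
    2 * ℓ / (3 * Real.pi) * K ≤ ‖s‖ * ‖Complex.sin (s * ℓ + θ)‖ := by
  have hpi := Real.pi_pos
  obtain ⟨n, h1, h2⟩ := exists_near_zero hℓ hp s
  have h3 : Real.pi / (2 * ℓ) ≤ Real.pi / ℓ := by
    gcongr
    linarith
  have h4 := abs_le.1 h1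
  have h5 : T ≤ p n := by linarith [h4.2]
  have hre : s.re ≤ ‖s‖ := (le_abs_self _).trans (Complex.abs_re_le_norm s)
  have h6 : ‖s + p n‖ ≤ 3 * ‖s‖ := by
    refine (norm_add_le _ _).trans ?_
    rw [Complex.norm_real, Real.norm_eq_abs, abs_of_nonneg (hT.trans h5)]
    linarith [h4.1]
  have h7 : K ≤ ‖s - p n‖ * (3 * ‖s‖) := by
    refine (hK n h5).trans ?_
    rw [show s ^ 2 - (p n : ℂ) ^ 2 = (s - p n) * (s + p n) by ring, norm_mul]
    gcongr
  calc 2 * ℓ / (3 * Real.pi) * K ≤ 2 * ℓ / (3 * Real.pi) * (‖s - p n‖ * (3 * ‖s‖)) := by gcongr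
    _ = ‖s‖ * (2 * ℓ / Real.pi * ‖s - p n‖) := by field_simp
    _ ≤ _ := by gcongr

end Sine

section SquareRoot

/-- The principal square root. -/
noncomputable def csqrt (z : ℂ) : ℂ := Complex.exp (Complex.log z / 2)

theorem csqrt_sq {z : ℂ} (hz : z ≠ 0) : csqrt z ^ 2 = z := by
  rw [csqrt, ← Complex.exp_nat_mul]
  push_cast
  rw [mul_div_cancel₀ _ two_ne_zero, Complex.exp_log hz]

theorem csqrt_ne_zero (z : ℂ) : csqrt z ≠ 0 := Complex.exp_ne_zero _

theorem re_csqrt_pos {z : ℂ} (hz : z ∈ Complex.slitPlane) : 0 < (csqrt z).re := by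
  rw [csqrt, Complex.exp_re]
  have h : (Complex.log z / 2).im = Complex.arg z / 2 := by simp [Complex.log_im]
  rw [h]
  refine mul_pos (Real.exp_pos _) (Real.cos_pos_of_mem_Ioo ?_)
  have h1 := Complex.neg_pi_lt_arg z
  have h2 : Complex.arg z < Real.pi :=
    (Complex.arg_le_pi z).lt_of_ne (Complex.mem_slitPlane_iff_arg.1 hz).1
  constructor <;> linarith

theorem hasDerivAt_csqrt {z : ℂ} (hz : z ∈ Complex.slitPlane) :
    HasDerivAt csqrt (csqrt z * (z⁻¹ / 2)) z :=
  ((Complex.hasDerivAt_log hz).div_const 2).cexp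

/-- The zeros of `sin (√z ℓ + θ)` in the right half-plane are squares of zeros. -/
theorem sin_csqrt_eq_zero_iff {ℓ θ : ℝ} {j : ℤ} {p : ℤ → ℝ} (hℓ : 0 < ℓ)
    (hp : ∀ n, p n = ((n + j : ℤ) * Real.pi - θ) / ℓ) {z : ℂ} (hz : 0 < z.re) :
    Complex.sin (csqrt z * ℓ + θ) = 0 ↔ ∃ n, 0 < p n ∧ z = ((p n ^ 2 : ℝ) : ℂ) := by
  have hℓ' : (ℓ : ℂ) ≠ 0 := by exact_mod_cast hℓ.ne'
  have hslit : z ∈ Complex.slitPlane := Or.inl hz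
  have hpos := re_csqrt_pos hslit
  have hsq := csqrt_sq (Complex.slitPlane_ne_zero hslit)
  rw [Complex.sin_eq_zero_iff]
  constructor
  · rintro ⟨k, hk⟩
    have h1 : csqrt z = (p (k - j) : ℂ) := by
      rw [hp]; push_cast
      field_simp
      linear_combination hk
    refine ⟨k - j, ?_, ?_⟩
    · rw [h1] at hpos; simpa using hpos
    · rw [← hsq, h1]; push_cast; ring
  · rintro ⟨n, hn, hzn⟩
    have h1 : csqrt z = (p n : ℂ) := by
      have h2 : (csqrt z - p n) * (csqrt z + p n) = 0 := by
        have : csqrt z ^ 2 = (p n : ℂ) ^ 2 := by rw [hsq, hzn]; push_cast; ring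
        linear_combination this
      rcases mul_eq_zero.1 h2 with h | h
      · exact sub_eq_zero.1 h
      · have := congrArg Complex.re h
        simp at this
        linarith
    refine ⟨n + j, ?_⟩
    rw [h1, hp]; push_cast
    field_simp
    ring

/-- The zeros of `g z * sin (√z ℓ + θ)` are simple. -/
theorem deriv_mul_sin_csqrt_ne_zero {ℓ θ : ℝ} (hℓ : 0 < ℓ) {g : ℂ → ℂ} {z : ℂ}
    (hz : z ∈ Complex.slitPlane) (hg : DifferentiableAt ℂ g z) (hgz : g z ≠ 0)
    (h0 : Complex.sin (csqrt z * ℓ + θ) = 0) :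
    deriv (fun z => g z * Complex.sin (csqrt z * ℓ + θ)) z ≠ 0 := by
  have hℓ' : (ℓ : ℂ) ≠ 0 := by exact_mod_cast hℓ.ne'
  have h1 := hg.hasDerivAt.mul ((((hasDerivAt_csqrt hz).mul_const (ℓ : ℂ)).add_const (θ : ℂ)).csin)
  have h2 := h1.deriv
  rw [h0, mul_zero, zero_add] at h2
  have hcos : Complex.cos (csqrt z * ℓ + θ) ≠ 0 := by
    intro hc
    have := Complex.sin_sq_add_cos_sq (csqrt z * ℓ + θ)
    rw [h0, hc] at this
    norm_num at this
  have hz0 := Complex.slitPlane_ne_zero hz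
  have hc0 := csqrt_ne_zero z
  have h3 : g z * (Complex.cos (csqrt z * ℓ + θ) * (csqrt z * (z⁻¹ / 2) * ℓ)) ≠ 0 := by
    simp [hgz, hcos, hc0, hz0, hℓ']
  rw [← h2] at h3
  exact h3

theorem differentiableOn_sin_csqrt (ℓ θ : ℝ) :
    DifferentiableOn ℂ (fun z => Complex.sin (csqrt z * ℓ + θ)) {z | 0 < z.re} := fun _ hz =>
  (((((hasDerivAt_csqrt (Or.inl hz)).mul_const (ℓ : ℂ)).add_const
    (θ : ℂ)).csin).differentiableAt).differentiableWithinAt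

end SquareRoot

namespace SLProblem.Ext

variable {P : SLProblem} (X : P.Ext)

/-- If both sines are large compared with `1/s`, relative to their exponential growth, then the
leading term of the characteristic function dominates. -/
theorem charFun_dominated (hP : P.Admissible) (hα : P.α10 ≠ 0 ∨ P.α11 ≠ 0) (hΔ : P.Δ24 ≠ 0) :
    ∃ δ > 0, ∃ S > 0, ∀ s : ℂ, S ≤ ‖s‖ → ∀ A B : ℂ,
    A = Complex.sin (s * ((P.c - P.a : ℝ) : ℂ) + P.thL) →
    B = Complex.sin (s * ((P.b - P.c : ℝ) : ℂ) + P.thR) →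
    Real.exp (|s.im| * (P.c - P.a)) ≤ δ * (‖s‖ * ‖A‖) →
    Real.exp (|s.im| * (P.b - P.c)) ≤ δ * (‖s‖ * ‖B‖) →
    ‖P.Δ12 * X.charFun (s ^ 2) - P.Δ24 * ((P.sigL s * (P.kL * A)) * (P.sigR s * (P.kR * B)))‖
      < ‖P.Δ24 * ((P.sigL s * (P.kL * A)) * (P.sigR s * (P.kR * B)))‖ := by
  obtain ⟨C, hC, S, hS, h⟩ := X.charFun_asymptotics hP
  have hkL := abs_pos.2 (kL_ne_zero hα)
  have hkR := abs_pos.2 (kR_ne_zero hP)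
  have hΔ' := abs_pos.2 hΔ
  set k := |P.kL| * |P.kR| with hk
  set D := |P.kL| + |P.kR| + 1 with hD
  have hk0 : 0 < k := by positivity
  have hD0 : 0 < D := by positivity
  -- With this `δ`, the sum of the three error terms is a proper fraction of the leading term.
  obtain ⟨δ, hδ0, hδ1, hδ⟩ : ∃ δ > 0, δ ≤ 1 ∧ C * D * δ < |P.Δ24| * k := by
    refine ⟨min 1 (|P.Δ24| * k / (C * D + 1)), by positivity, min_le_left _ _, ?_⟩
    calc C * D * min 1 (|P.Δ24| * k / (C * D + 1))
        ≤ C * D * (|P.Δ24| * k / (C * D + 1)) := by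
          gcongr
          exact min_le_right _ _
      _ = |P.Δ24| * k * (C * D / (C * D + 1)) := by ring
      _ < |P.Δ24| * k * 1 := by
          gcongr
          rw [div_lt_one (by positivity)]
          linarith
      _ = _ := by ring
  refine ⟨δ, hδ0, S, hS, fun s hs A B hA hB hEL hER => ?_⟩
  have hs' : 0 < ‖s‖ := hS.trans_le hs
  have hs0 : s ≠ 0 := norm_pos_iff.1 hs'
  have h1 := h s hs (P.kL * A) (P.kR * B) (by rw [hA]; push_cast; rfl) (by rw [hB]; push_cast; rfl)
  have hσ : 0 < ‖P.sigL s‖ * ‖P.sigR s‖ :=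
    mul_pos (norm_pos_iff.2 (sigL_ne_zero hs0)) (norm_pos_iff.2 (sigR_ne_zero hs0))
  have na : ∀ t : ℝ, ‖(t : ℂ)‖ = |t| := fun t => by rw [Complex.norm_real, Real.norm_eq_abs]
  have e : ‖P.Δ24 * ((P.sigL s * (P.kL * A)) * (P.sigR s * (P.kR * B)))‖
      = ‖P.sigL s‖ * ‖P.sigR s‖ * (‖A‖ * ‖B‖) * (|P.Δ24| * k) := by
    simp only [norm_mul, na, hk]; ring
  rw [e]
  refine h1.trans_lt ?_
  simp only [norm_mul, na]
  have hELp := Real.exp_pos (|s.im| * (P.c - P.a))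
  have hERp := Real.exp_pos (|s.im| * (P.b - P.c))
  generalize Real.exp (|s.im| * (P.c - P.a)) = EL at *
  generalize Real.exp (|s.im| * (P.b - P.c)) = ER at *
  generalize ‖P.sigL s‖ * ‖P.sigR s‖ = σ at *
  generalize ‖s‖ = r at *
  generalize ‖A‖ = α at *
  generalize ‖B‖ = β at *
  have hα0 : 0 < α := by
    have := hELp.trans_le hEL
    rw [← mul_assoc] at this
    exact pos_of_mul_pos_right this (by positivity)
  have hβ0 : 0 < β := by
    have := hERp.trans_le hER
    rw [← mul_assoc] at this
    exact pos_of_mul_pos_right this (by positivity)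
  calc C * σ * ((|P.kL| * α * ER + |P.kR| * β * EL) / r + EL * ER / r ^ 2)
      ≤ C * σ * ((|P.kL| * α * (δ * (r * β)) + |P.kR| * β * (δ * (r * α))) / r
        + (δ * (r * α)) * (δ * (r * β)) / r ^ 2) := by gcongr
    _ = σ * (α * β) * (C * (|P.kL| + |P.kR| + δ) * δ) := by field_simp
    _ ≤ σ * (α * β) * (C * D * δ) := by
        gcongr
        linarith
    _ < _ := by gcongr

end SLProblem.Ext

/-! ### Counting eigenvalues -/

namespace SLProblem

variable {P : SLProblem}

/-- The increasing sequences `mu 0` and `-mu 1`. The second sign accounts for the negative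
denominator `a - c` of `mu 1`. -/
noncomputable def pos (P : SLProblem) (i : Fin 2) (n : ℤ) : ℝ :=
  if i = 0 then P.mu 0 n else -P.mu 1 n

theorem pos_sq (i : Fin 2) (n : ℤ) : P.pos i n ^ 2 = P.mu i n ^ 2 := by
  fin_cases i <;> simp [pos]

/-- The two sequences are the zeros of `sin (s (b - c) + θ_R)` and of `sin (s (c - a) + θ_L)`, up to
shifts of the index. -/
theorem exists_pos_eq (hP : P.Admissible) : (∃ j : ℤ, ∀ n, P.pos 0 n
      = ((n + j : ℤ) * Real.pi - P.thR) / (P.b - P.c)) ∧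
    ∃ j : ℤ, ∀ n, P.pos 1 n = ((n + j : ℤ) * Real.pi - P.thL) / (P.c - P.a) := by
  have h1 := (sub_pos.2 hP.hac).ne'
  have h2 := (sub_pos.2 hP.hcb).ne'
  have h3 : P.a - P.c ≠ 0 := (sub_neg.2 hP.hac).ne
  by_cases hb : P.α21' = 0 <;> by_cases ha : P.α11 = 0
  · refine ⟨⟨0, fun n => ?_⟩, ⟨1, fun n => ?_⟩⟩
    · simp [pos, mu, thR, hb, ha]
      field_simp
    · simp [pos, mu, thL, ha, hb]
      field_simp
      ring
  · refine ⟨⟨1, fun n => ?_⟩, ⟨-1, fun n => ?_⟩⟩ <;>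
      simp [pos, mu, thL, thR, ha, hb] <;> field_simp <;> ring
  · refine ⟨⟨-1, fun n => ?_⟩, ⟨1, fun n => ?_⟩⟩ <;>
      simp [pos, mu, thL, thR, ha, hb] <;> field_simp <;> ring
  · refine ⟨⟨-2, fun n => ?_⟩, ⟨0, fun n => ?_⟩⟩ <;>
      simp [pos, mu, thL, thR, ha, hb] <;> field_simp <;> ring

/-- The real eigenvalues. -/
def realEigenvalues (P : SLProblem) : Set ℝ := {x | (x : ℂ) ∈ P.eigenvalues}

section Progression

variable {ℓ θ : ℝ} {j : ℤ} {p : ℤ → ℝ}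

theorem progression_sub (hp : ∀ n, p n = ((n + j : ℤ) * Real.pi - θ) / ℓ) (m n : ℤ) :
    p m - p n = (m - n) * (Real.pi / ℓ) := by
  rw [hp, hp]; push_cast; ring

end Progression

theorem exists_pos_sub (hP : P.Admissible) (i : Fin 2) :
    ∃ d > 0, ∀ m n : ℤ, P.pos i m - P.pos i n = (m - n) * d := by
  obtain ⟨⟨j, h0⟩, ⟨k, h1⟩⟩ := exists_pos_eq hP
  have hpi := Real.pi_pos
  fin_cases i
  · exact ⟨_, div_pos hpi (sub_pos.2 hP.hcb), progression_sub h0⟩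
  · exact ⟨_, div_pos hpi (sub_pos.2 hP.hac), progression_sub h1⟩

theorem strictMono_pos (hP : P.Admissible) (i : Fin 2) : StrictMono (P.pos i) := by
  obtain ⟨d, hd, h⟩ := exists_pos_sub hP i
  intro m n hmn
  have h1 := h n m
  have h2 : (0 : ℝ) < n - m := sub_pos.2 (by exact_mod_cast hmn)
  nlinarith [mul_pos h2 hd]

namespace Ext

variable (X : P.Ext)

/-- The first factor of the leading term of the characteristic function, as a function of the
spectral parameter. -/
noncomputable def leadL (P : SLProblem) (z : ℂ) : ℂ :=
  P.Δ24 * (P.sigL (csqrt z) * P.kL) *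
    Complex.sin (csqrt z * ((P.c - P.a : ℝ) : ℂ) + P.thL)

/-- The second factor of the leading term. -/
noncomputable def leadR (P : SLProblem) (z : ℂ) : ℂ :=
  P.sigR (csqrt z) * P.kR * Complex.sin (csqrt z * ((P.b - P.c : ℝ) : ℂ) + P.thR)

/-- Far to the right in a horizontal strip, the leading term dominates at a fixed distance
`K` from its zeros. A fixed distance suffices because distance `K` of `s ^ 2` from `p ^ 2`
means distance of order `K / p` of `s` from `p`, and the sines are large compared with `1 / s`
there if `K` is large. -/
theorem leading_dominates (hP : P.Admissible) (hα : P.α10 ≠ 0 ∨ P.α11 ≠ 0) (hΔ : P.Δ24 ≠ 0) :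
    ∃ K > 0, ∀ T ≥ 0, ∃ M > 0, ∀ z : ℂ, M ≤ z.re → |z.im| ≤ 3 * K →
      (∀ i n, T ≤ P.pos i n → K ≤ ‖z - ((P.pos i n ^ 2 : ℝ) : ℂ)‖) →
      ‖P.Δ12 * X.charFun z - leadL P z * leadR P z‖ < ‖leadL P z * leadR P z‖ := by
  obtain ⟨δ, hδ, S, hS, h⟩ := X.charFun_dominated hP hα hΔ
  obtain ⟨⟨jR, hR⟩, ⟨jL, hL⟩⟩ := exists_pos_eq hP
  have hpi := Real.pi_pos
  have hac := sub_pos.2 hP.hac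
  have hcb := sub_pos.2 hP.hcb
  -- `E` bounds the exponential factors for `|Im s| ≤ 1`, and `cL K`, `cR K` are lower bounds for
  -- `|s|` times the sines. `K` is large enough for the hypotheses of `charFun_dominated`.
  set E := Real.exp ((P.c - P.a) + (P.b - P.c)) with hE
  have hE0 : 0 < E := Real.exp_pos _
  set cL := 2 * (P.c - P.a) / (3 * Real.pi)
  set cR := 2 * (P.b - P.c) / (3 * Real.pi)
  have hcL : 0 < cL := by positivity
  have hcR : 0 < cR := by positivity
  set K := E / (δ * cL) + E / (δ * cR) with hK
  have hK0 : 0 < K := by positivity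
  have hKL : E ≤ δ * (cL * K) := by
    have : δ * (cL * (E / (δ * cL))) = E := by field_simp
    have h2 : δ * (cL * (E / (δ * cL))) ≤ δ * (cL * K) := by
      gcongr
      rw [hK]
      exact le_add_of_nonneg_right (by positivity)
    linarith
  have hKR : E ≤ δ * (cR * K) := by
    have : δ * (cR * (E / (δ * cR))) = E := by field_simp
    have h2 : δ * (cR * (E / (δ * cR))) ≤ δ * (cR * K) := by
      gcongr
      rw [hK]
      exact le_add_of_nonneg_left (by positivity)
    linarith
  refine ⟨K, hK0, fun T hT => ?_⟩
  set ρ := S + T + Real.pi / (P.c - P.a) + Real.pi / (P.b - P.c) + 3 * K + 1 with hρ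
  have hd1 : 0 < Real.pi / (P.c - P.a) := by positivity
  have hd2 : 0 < Real.pi / (P.b - P.c) := by positivity
  have hρ0 : 0 < ρ := by positivity
  refine ⟨ρ ^ 2, by positivity, fun z hz hzi hsep => ?_⟩
  have hzre : 0 < z.re := (by positivity : 0 < ρ ^ 2).trans_le hz
  have hslit : z ∈ Complex.slitPlane := Or.inl hzre
  have hsq := csqrt_sq (Complex.slitPlane_ne_zero hslit)
  have hpos := re_csqrt_pos hslit
  rw [leadL, leadR]
  generalize csqrt z = s at *
  have hre : z.re = s.re ^ 2 - s.im ^ 2 := by rw [← hsq]; simp [pow_two]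
  have him : z.im = 2 * (s.re * s.im) := by rw [← hsq]; simp [pow_two]; ring
  have hsre : ρ ≤ s.re := by
    refine (sq_le_sq₀ hρ0.le hpos.le).1 ?_
    linarith [sq_nonneg s.im]
  have hsim : |s.im| ≤ 1 := by
    rw [him, abs_mul, abs_mul, abs_of_pos hpos, abs_two] at hzi
    have h3K : 3 * K ≤ s.re := by linarith
    have : s.re * |s.im| ≤ s.re * 1 := by linarith [abs_nonneg s.im]
    exact le_of_mul_le_mul_left this hpos
  have hsn : s.re ≤ ‖s‖ := (le_abs_self _).trans (Complex.abs_re_le_norm s)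
  have hsep' : ∀ i n, T ≤ P.pos i n → K ≤ ‖s ^ 2 - (P.pos i n : ℂ) ^ 2‖ := by
    intro i n hn
    have := hsep i n hn
    rw [← hsq] at this
    exact_mod_cast this
  have h1 := le_norm_sin_of_separated hac hL hT (s := s) (by linarith) (hsep' 1)
  have h2 := le_norm_sin_of_separated hcb hR hT (s := s) (by linarith) (hsep' 0)
  have key := h s (by linarith) _ _ rfl rfl ?_ ?_
  · rw [← hsq]
    have e : (P.Δ24 * (P.sigL s * P.kL) * Complex.sin (s * ((P.c - P.a : ℝ) : ℂ) + P.thL))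
        * (P.sigR s * P.kR * Complex.sin (s * ((P.b - P.c : ℝ) : ℂ) + P.thR))
        = P.Δ24 * ((P.sigL s * (P.kL * Complex.sin (s * ((P.c - P.a : ℝ) : ℂ) + P.thL)))
          * (P.sigR s * (P.kR * Complex.sin (s * ((P.b - P.c : ℝ) : ℂ) + P.thR)))) := by ring
    rw [e]
    exact key
  · calc Real.exp (|s.im| * (P.c - P.a)) ≤ E := by
          have := mul_le_of_le_one_left hac.le hsim
          exact Real.exp_le_exp.2 (by linarith)
      _ ≤ δ * (cL * K) := hKL
      _ ≤ _ := by gcongr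
  · calc Real.exp (|s.im| * (P.b - P.c)) ≤ E := by
          have := mul_le_of_le_one_left hcb.le hsim
          exact Real.exp_le_exp.2 (by linarith)
      _ ≤ δ * (cR * K) := hKR
      _ ≤ _ := by gcongr

theorem differentiableAt_sigL_csqrt {z : ℂ} (hz : z ∈ Complex.slitPlane) :
    DifferentiableAt ℂ (fun z => P.sigL (csqrt z)) z := by
  have := (hasDerivAt_csqrt hz).differentiableAt
  unfold sigL
  split_ifs <;> fun_prop

theorem differentiableAt_sigR_csqrt {z : ℂ} (hz : z ∈ Complex.slitPlane) :
    DifferentiableAt ℂ (fun z => P.sigR (csqrt z)) z := by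
  have := (hasDerivAt_csqrt hz).differentiableAt
  unfold sigR
  split_ifs <;> fun_prop

/-- The zeros of a leading factor in a disc correspond to the indices of the leading terms. -/
theorem ncard_zeros_progression {ℓ θ : ℝ} {j : ℤ} {p : ℤ → ℝ} (hℓ : 0 < ℓ)
    (hp : ∀ n, p n = ((n + j : ℤ) * Real.pi - θ) / ℓ) {g : ℂ → ℂ} (hg : ∀ z, g z ≠ 0) {n₀ : ℤ}
    (hn₀ : 0 < p n₀) {z r : ℝ} (hz : p n₀ ^ 2 + r < z) :
    (Metric.ball (z : ℂ) r ∩ {w | g w * Complex.sin (csqrt w * ℓ + θ) = 0}).ncard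
      = {n | n₀ ≤ n ∧ |p n ^ 2 - z| < r}.ncard := by
  have hpi := Real.pi_pos
  have hmono : StrictMono p := by
    intro m n hmn
    have h1 := progression_sub hp n m
    have h2 : (0 : ℝ) < n - m := sub_pos.2 (by exact_mod_cast hmn)
    have h3 : 0 < Real.pi / ℓ := by positivity
    nlinarith [mul_pos h2 h3]
  have hpos : ∀ n, n₀ ≤ n → 0 < p n := fun n hn => hn₀.trans_le (hmono.monotone hn)
  have hdist : ∀ x : ℝ, ((x : ℂ) ∈ Metric.ball (z : ℂ) r) ↔ |x - z| < r := fun x => by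
    rw [Metric.mem_ball, dist_eq_norm, ← Complex.ofReal_sub, Complex.norm_real, Real.norm_eq_abs]
  have e : Metric.ball (z : ℂ) r ∩ {w | g w * Complex.sin (csqrt w * ℓ + θ) = 0}
      = (fun n => ((p n ^ 2 : ℝ) : ℂ)) '' {n | n₀ ≤ n ∧ |p n ^ 2 - z| < r} := by
    ext w
    simp only [mem_inter_iff, mem_ofPred_eq, mul_eq_zero, hg, false_or, mem_image]
    constructor
    · rintro ⟨hw, hw0⟩
      have hre : 0 < w.re := by
        have h1 : |w.re - z| < r := by
          rw [Metric.mem_ball, dist_eq_norm] at hw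
          have := (Complex.abs_re_le_norm (w - z)).trans_lt hw
          simpa using this
        have := (abs_lt.1 h1).1
        nlinarith [sq_nonneg (p n₀)]
      obtain ⟨n, hn, rfl⟩ := (sin_csqrt_eq_zero_iff hℓ hp hre).1 hw0
      have hw' := (hdist _).1 hw
      refine ⟨n, ⟨?_, hw'⟩, rfl⟩
      by_contra! hlt
      have h2 := hmono hlt
      have := (abs_lt.1 hw').1
      nlinarith
    · rintro ⟨n, ⟨hn, hnr⟩, rfl⟩
      refine ⟨(hdist _).2 hnr, ?_⟩
      refine (sin_csqrt_eq_zero_iff hℓ hp ?_).2 ⟨n, hpos n hn, rfl⟩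
      have := hpos n hn
      rw [Complex.ofReal_re]
      positivity
  rw [e, InjOn.ncard_image]
  rintro m ⟨hm, -⟩ n ⟨hn, -⟩ hmn
  simp only [Complex.ofReal_inj] at hmn
  have := (sq_eq_sq₀ (hpos m hm).le (hpos n hn).le).1 hmn
  exact hmono.injective this

/-- As all eigenvalues are real, those in an interval are the zeros in the disc over it. The factor
`Δ12` matches `leading_dominates`. -/
theorem ncard_realEigenvalues (hP : P.Admissible) (hα : P.α10 ≠ 0 ∨ P.α11 ≠ 0) (z r : ℝ) :
    {x | x ∈ P.realEigenvalues ∧ |x - z| < r}.ncard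
      = (Metric.ball (z : ℂ) r ∩ {w | P.Δ12 * X.charFun w = 0}).ncard := by
  have hΔ : (P.Δ12 : ℂ) ≠ 0 := by exact_mod_cast hP.Δ12_pos.ne'
  have hdist : ∀ x : ℝ, ((x : ℂ) ∈ Metric.ball (z : ℂ) r) ↔ |x - z| < r := fun x => by
    rw [Metric.mem_ball, dist_eq_norm, ← Complex.ofReal_sub, Complex.norm_real, Real.norm_eq_abs]
  have e : Metric.ball (z : ℂ) r ∩ {w | P.Δ12 * X.charFun w = 0}
      = (fun x : ℝ => (x : ℂ)) '' {x | x ∈ P.realEigenvalues ∧ |x - z| < r} := by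
    ext w
    simp only [mem_inter_iff, mem_ofPred_eq, mul_eq_zero, hΔ, false_or, mem_image,
      realEigenvalues, X.mem_eigenvalues_iff hP hα]
    constructor
    · rintro ⟨hw, hw0⟩
      have him := X.im_eq_zero_of_charFun_eq_zero hP hα hw0
      obtain ⟨x, rfl⟩ : ∃ x : ℝ, (x : ℂ) = w := ⟨w.re, Complex.ext rfl (by simp [him])⟩
      exact ⟨x, ⟨hw0, (hdist x).1 hw⟩, rfl⟩
    · rintro ⟨x, ⟨hx, hxr⟩, rfl⟩
      exact ⟨(hdist x).2 hxr, hx⟩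
  rw [e, ncard_image_of_injective _ Complex.ofReal_injective]

/-- By Rouché's theorem, an interval that is at distance `K` from the squares `pos i n ^ 2` with its
end points contains as many eigenvalues as such squares; and large eigenvalues are close to such
squares. -/
theorem eigenvalue_count (X : P.Ext) (hP : P.Admissible) (hα : P.α10 ≠ 0 ∨ P.α11 ≠ 0)
    (hΔ : P.Δ24 ≠ 0) :
    ∃ K > 0, ∀ n₀, (∀ i, 0 < P.pos i n₀) → ∃ M > 0,
      (∀ z r : ℝ, M ≤ z → 0 < r → r ≤ 3 * K →
        (∀ i, ∀ n ≥ n₀, K ≤ |(|P.pos i n ^ 2 - z| - r)|) →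
        {x | x ∈ P.realEigenvalues ∧ |x - z| < r}.ncard
          = {n | n₀ ≤ n ∧ |P.pos 0 n ^ 2 - z| < r}.ncard
            + {n | n₀ ≤ n ∧ |P.pos 1 n ^ 2 - z| < r}.ncard) ∧
      ∀ x ∈ P.realEigenvalues, M ≤ x → ∃ i, ∃ n ≥ n₀, |x - P.pos i n ^ 2| < K := by
  obtain ⟨K, hK, h⟩ := X.leading_dominates hP hα hΔ
  obtain ⟨⟨jR, hR⟩, ⟨jL, hL⟩⟩ := exists_pos_eq hP
  have hac := sub_pos.2 hP.hac
  have hcb := sub_pos.2 hP.hcb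
  have hkL : (P.kL : ℂ) ≠ 0 := by exact_mod_cast kL_ne_zero hα
  have hkR : (P.kR : ℂ) ≠ 0 := by exact_mod_cast kR_ne_zero hP
  have hΔ' : (P.Δ24 : ℂ) ≠ 0 := by exact_mod_cast hΔ
  have hΔ12 : (P.Δ12 : ℂ) ≠ 0 := by exact_mod_cast hP.Δ12_pos.ne'
  have hgL : ∀ z, (P.Δ24 : ℂ) * (P.sigL (csqrt z) * P.kL) ≠ 0 := fun z =>
    mul_ne_zero hΔ' (mul_ne_zero (sigL_ne_zero (csqrt_ne_zero z)) hkL)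
  have hgR : ∀ z, P.sigR (csqrt z) * (P.kR : ℂ) ≠ 0 := fun z =>
    mul_ne_zero (sigR_ne_zero (csqrt_ne_zero z)) hkR
  have hdgL : ∀ z ∈ Complex.slitPlane,
      DifferentiableAt ℂ (fun z => (P.Δ24 : ℂ) * (P.sigL (csqrt z) * P.kL)) z := fun z hz =>
    ((differentiableAt_sigL_csqrt hz).mul_const _).const_mul _
  have hdgR : ∀ z ∈ Complex.slitPlane,
      DifferentiableAt ℂ (fun z => P.sigR (csqrt z) * (P.kR : ℂ)) z := fun z hz =>
    (differentiableAt_sigR_csqrt hz).mul_const _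
  refine ⟨K, hK, fun n₀ hn₀ => ?_⟩
  -- Above `T` only indices from `n₀` on occur in both sequences.
  set T := P.pos 0 n₀ + P.pos 1 n₀ with hT
  have h00 := hn₀ 0
  have h01 := hn₀ 1
  have hTn : ∀ i n, T ≤ P.pos i n → n₀ ≤ n := by
    intro i n hn
    refine (strictMono_pos hP i).le_iff_le.1 (le_trans ?_ hn)
    fin_cases i
    · exact le_add_of_nonneg_right h01.le
    · exact le_add_of_nonneg_left h00.le
  obtain ⟨M, hM, hd⟩ := h T (by positivity)
  refine ⟨M + T ^ 2 + 3 * K + 1, by positivity, fun z r hz hr hrK hsep => ?_, fun x hx hxM => ?_⟩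
  · rw [X.ncard_realEigenvalues hP hα]
    have hTsq : 0 ≤ T ^ 2 := by positivity
    have hU : IsOpen {w : ℂ | 0 < w.re} := isOpen_lt continuous_const Complex.continuous_re
    have hball : ∀ w ∈ Metric.closedBall (z : ℂ) r, M ≤ w.re ∧ |w.im| ≤ 3 * K := by
      intro w hw
      rw [Metric.mem_closedBall, dist_eq_norm] at hw
      have h1 := (Complex.abs_re_le_norm (w - z)).trans hw
      have h2 := (Complex.abs_im_le_norm (w - z)).trans hw
      simp only [Complex.sub_re, Complex.ofReal_re, Complex.sub_im, Complex.ofReal_im,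
        sub_zero] at h1 h2
      have := (abs_le.1 h1).1
      constructor <;> linarith
    have hpos : ∀ w ∈ Metric.closedBall (z : ℂ) r, 0 < w.re := fun w hw =>
      hM.trans_le (hball w hw).1
    have hcount := ncard_zeros_eq_add_of_norm_sub_lt (f := fun w => P.Δ12 * X.charFun w)
      (v := leadL P) (w := leadR P) hr hU hpos
      ((X.differentiable_charFun hP).const_mul _).differentiableOn
      ((fun w hw => (hdgL w (Or.inl hw)).differentiableWithinAt.mul
        (differentiableOn_sin_csqrt _ _ w hw)))
      ((fun w hw => (hdgR w (Or.inl hw)).differentiableWithinAt.mul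
        (differentiableOn_sin_csqrt _ _ w hw))) ?_ ?_ ?_ ?_
    · rw [hcount.2, add_comm]
      congr 1
      · refine ncard_zeros_progression hcb hR hgR h00 ?_
        nlinarith
      · refine ncard_zeros_progression hac hL hgL h01 ?_
        nlinarith
    · intro w hw
      obtain ⟨h1, h2⟩ := hball w (Metric.sphere_subset_closedBall hw)
      refine hd w h1 h2 fun i n hn => ?_
      refine (hsep i n (hTn i n hn)).trans ?_
      have h3 : ‖w - z‖ = r := by rw [← dist_eq_norm]; exact hw
      have h4 : |P.pos i n ^ 2 - z| = ‖((P.pos i n ^ 2 : ℝ) : ℂ) - z‖ := by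
        rw [← Complex.ofReal_sub, Complex.norm_real, Real.norm_eq_abs]
      rw [h4, ← h3]
      refine (abs_norm_sub_norm_le _ _).trans (le_of_eq ?_)
      rw [sub_sub_sub_cancel_right, norm_sub_rev]
    · intro w _ hw0
      have h1 : X.charFun w = 0 := (mul_eq_zero.1 hw0).resolve_left hΔ12
      have h2 : deriv (fun w => P.Δ12 * X.charFun w) w = P.Δ12 * deriv X.charFun w :=
        ((X.differentiable_charFun hP w).hasDerivAt.const_mul _).deriv
      rw [h2]
      exact mul_ne_zero hΔ12 (X.deriv_charFun_ne_zero hP hα h1)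
    · intro w hw hw0
      have hs : w ∈ Complex.slitPlane := Or.inl (hpos w (Metric.ball_subset_closedBall hw))
      exact deriv_mul_sin_csqrt_ne_zero hac hs (hdgL w hs) (hgL w)
        ((mul_eq_zero.1 hw0).resolve_left (hgL w))
    · intro w hw hw0
      have hs : w ∈ Complex.slitPlane := Or.inl (hpos w (Metric.ball_subset_closedBall hw))
      exact deriv_mul_sin_csqrt_ne_zero hcb hs (hdgR w hs) (hgR w)
        ((mul_eq_zero.1 hw0).resolve_left (hgR w))
  · by_contra! hfar
    have hchar : X.charFun x = 0 := (X.mem_eigenvalues_iff hP hα).1 hx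
    have := hd x (by rw [Complex.ofReal_re]; nlinarith [sq_nonneg T])
      (by rw [Complex.ofReal_im, abs_zero]; positivity) (fun i n hn => by
        rw [← Complex.ofReal_sub, Complex.norm_real, Real.norm_eq_abs]
        exact hfar i n (hTn i n hn))
    rw [hchar, mul_zero, zero_sub, norm_neg] at this
    exact lt_irrefl _ this

/-- On the imaginary axis both sines grow exponentially, so there are no eigenvalues far to the
left. -/
theorem bddBelow_realEigenvalues (X : P.Ext) (hP : P.Admissible) (hα : P.α10 ≠ 0 ∨ P.α11 ≠ 0)
    (hΔ : P.Δ24 ≠ 0) : BddBelow P.realEigenvalues := by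
  obtain ⟨δ, hδ, S, hS, h⟩ := X.charFun_dominated hP hα hΔ
  have hac := sub_pos.2 hP.hac
  have hcb := sub_pos.2 hP.hcb
  set τ := S + 4 / δ + 1 / (P.c - P.a) + 1 / (P.b - P.c) with hτ
  have h4 : 0 < 4 / δ := by positivity
  have h5 : 0 < 1 / (P.c - P.a) := by positivity
  have h6 : 0 < 1 / (P.b - P.c) := by positivity
  have hτ0 : 0 < τ := by positivity
  refine ⟨-τ ^ 2, fun x hx => ?_⟩
  by_contra! hlt
  have hchar : X.charFun x = 0 := (X.mem_eigenvalues_iff hP hα).1 hx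
  set t := √(-x) with ht
  have htx : t ^ 2 = -x := Real.sq_sqrt (by nlinarith [sq_nonneg τ])
  have htτ : τ ≤ t := Real.le_sqrt_of_sq_le (by linarith)
  have ht0 : 0 < t := hτ0.trans_le htτ
  have hs : (Complex.I * t) ^ 2 = (x : ℂ) := by
    rw [mul_pow, Complex.I_sq, ← Complex.ofReal_pow, htx]; push_cast; ring
  have hns : ‖Complex.I * (t : ℂ)‖ = t := by
    rw [norm_mul, Complex.norm_I, one_mul, Complex.norm_real, Real.norm_eq_abs, abs_of_pos ht0]
  have him : (Complex.I * (t : ℂ)).im = t := by simp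
  have aux : ∀ ℓ θ : ℝ, 0 < ℓ → 1 / ℓ ≤ t → Real.exp (|(Complex.I * (t : ℂ)).im| * ℓ)
      ≤ δ * (‖Complex.I * (t : ℂ)‖ * ‖Complex.sin (Complex.I * t * (ℓ : ℂ) + θ)‖) := by
    intro ℓ θ hℓ htℓ
    have h1 := abs_sinh_im_le_norm_sin (Complex.I * t * (ℓ : ℂ) + θ)
    have h2 : (Complex.I * t * (ℓ : ℂ) + θ).im = t * ℓ := by simp
    rw [h2] at h1
    rw [him, hns, abs_of_pos ht0]
    have h3 : 1 ≤ t * ℓ := by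
      rw [div_le_iff₀ hℓ] at htℓ; exact htℓ
    have h7 : Real.exp (t * ℓ) ≤ 4 * Real.sinh (t * ℓ) := by
      rw [Real.sinh_eq]
      have h8 : Real.exp (-(t * ℓ)) ≤ 1 := Real.exp_le_one_iff.2 (by linarith)
      have h9 := Real.add_one_le_exp (t * ℓ)
      linarith
    have h10 : 4 ≤ δ * t := by
      have : 4 / δ ≤ t := by linarith
      rwa [div_le_iff₀' hδ] at this
    calc Real.exp (t * ℓ) ≤ 4 * Real.sinh (t * ℓ) := h7
      _ ≤ 4 * ‖Complex.sin (Complex.I * t * (ℓ : ℂ) + θ)‖ := by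
          gcongr
          exact (le_abs_self _).trans h1
      _ ≤ δ * t * ‖Complex.sin (Complex.I * t * (ℓ : ℂ) + θ)‖ := by gcongr
      _ = _ := by ring
  have := h (Complex.I * t) (by rw [hns]; linarith) _ _ rfl rfl
    (aux _ _ hac (by linarith)) (aux _ _ hcb (by linarith))
  rw [hs, hchar, mul_zero, zero_sub, norm_neg] at this
  exact lt_irrefl _ this

theorem finite_realEigenvalues_le (X : P.Ext) (hP : P.Admissible) (hα : P.α10 ≠ 0 ∨ P.α11 ≠ 0)
    (hΔ : P.Δ24 ≠ 0) (T : ℝ) : (P.realEigenvalues ∩ Iic T).Finite := by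
  obtain ⟨m, hm⟩ := X.bddBelow_realEigenvalues hP hα hΔ
  have h := finite_zeros_of_deriv_ne_zero (f := X.charFun)
    (isCompact_closedBall (0 : ℂ) (max |m| |T|))
    (fun z _ => X.differentiable_charFun hP z) (fun z _ h0 => X.deriv_charFun_ne_zero hP hα h0)
  refine (h.preimage Complex.ofReal_injective.injOn).subset ?_
  rintro x ⟨hx, hxT⟩
  refine ⟨?_, (X.mem_eigenvalues_iff hP hα).1 hx⟩
  rw [mem_closedBall_zero_iff, Complex.norm_real, Real.norm_eq_abs]
  exact abs_le_max_abs_abs (hm hx) hxT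

end Ext

end SLProblem

/-! ### Listing a set by two sequences -/

section Enumeration

/-- A listing of all but finitely many elements of `s` by two sequences extends to a listing of
`s`, by prolonging the first sequence to the left. -/
theorem exists_bijOn_extend {s : Set ℝ} {f : Fin 2 → ℤ → ℝ} {n₁ : ℤ}
    (hinj : InjOn (fun p : Fin 2 × ℤ => f p.1 p.2) {p | n₁ ≤ p.2})
    (hmaps : MapsTo (fun p : Fin 2 × ℤ => f p.1 p.2) {p | n₁ ≤ p.2} s)
    (hfin : (s \ (fun p : Fin 2 × ℤ => f p.1 p.2) '' {p | n₁ ≤ p.2}).Finite) :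
    ∃ (N : Fin 2 → ℤ) (f' : Fin 2 → ℤ → ℝ),
      BijOn (fun p : Fin 2 × ℤ => f' p.1 p.2) {p | N p.1 ≤ p.2} s ∧
      ∀ i, ∀ n ≥ n₁, f' i n = f i n := by
  set E := s \ (fun p : Fin 2 × ℤ => f p.1 p.2) '' {p | n₁ ≤ p.2} with hE
  have hcard : (Ico (n₁ - E.ncard) n₁).encard = E.encard := by
    rw [← Finset.coe_Ico, Set.encard_coe_eq_coe_finsetCard, Int.card_Ico, ← hfin.cast_ncard_eq]
    simp
  obtain ⟨g, hg⟩ := (finite_Ico (n₁ - (E.ncard : ℤ)) n₁).exists_bijOn_of_encard_eq hcard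
  set N : Fin 2 → ℤ := ![n₁ - E.ncard, n₁] with hN
  set f' : Fin 2 → ℤ → ℝ := fun i n => if n < n₁ then g n else f i n with hf'
  have h0 : N 0 = n₁ - E.ncard := rfl
  have h1 : N 1 = n₁ := rfl
  have hnew : ∀ i n, N i ≤ n → n < n₁ → i = 0 ∧ n ∈ Ico (n₁ - (E.ncard : ℤ)) n₁ := by
    intro i n hn hlt
    fin_cases i
    · exact ⟨rfl, hn, hlt⟩
    · exact absurd hn (not_le.2 hlt)
  have hlt : ∀ i n, n < n₁ → f' i n = g n := fun i n h => if_pos h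
  have hge : ∀ i n, n₁ ≤ n → f' i n = f i n := fun i n h => if_neg h.not_gt
  refine ⟨N, f', ⟨?_, ?_, ?_⟩, hge⟩
  · rintro ⟨i, n⟩ hn
    rcases lt_or_ge n n₁ with h | h
    · change f' i n ∈ s
      rw [hlt i n h]
      exact (hg.mapsTo (hnew i n hn h).2).1
    · change f' i n ∈ s
      rw [hge i n h]
      exact hmaps (x := (i, n)) h
  · rintro ⟨i, n⟩ hn ⟨k, m⟩ hm heq
    change f' i n = f' k m at heq
    rcases lt_or_ge n n₁ with h | h <;> rcases lt_or_ge m n₁ with h' | h'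
    · rw [hlt i n h, hlt k m h'] at heq
      obtain ⟨rfl, h2⟩ := hnew i n hn h
      obtain ⟨rfl, h3⟩ := hnew k m hm h'
      rw [hg.injOn h2 h3 heq]
    · rw [hlt i n h, hge k m h'] at heq
      exact absurd ⟨(k, m), h', heq.symm⟩ (hg.mapsTo (hnew i n hn h).2).2
    · rw [hge i n h, hlt k m h'] at heq
      exact absurd ⟨(i, n), h, heq⟩ (hg.mapsTo (hnew k m hm h').2).2
    · rw [hge i n h, hge k m h'] at heq
      exact hinj (x₁ := (i, n)) (x₂ := (k, m)) h h' heq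
  · intro x hx
    by_cases hxE : x ∈ (fun p : Fin 2 × ℤ => f p.1 p.2) '' {p | n₁ ≤ p.2}
    · obtain ⟨⟨i, n⟩, hn, rfl⟩ := hxE
      have hn' : n₁ ≤ n := hn
      refine ⟨(i, n), ?_, hge i n hn⟩
      change N i ≤ n
      fin_cases i
      · change n₁ - (E.ncard : ℤ) ≤ n
        lia
      · exact hn
    · obtain ⟨n, hn, rfl⟩ := hg.surjOn ⟨hx, hxE⟩
      exact ⟨(0, n), hn.1, hlt 0 n hn.2⟩

variable {Λ : Set ℝ} {a b : ℤ → ℝ} {K M : ℝ} {n₀ : ℤ}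

/-- In a sequence with gaps of at least `10 K`, close members are equal. -/
theorem eq_of_abs_sub_lt (ha : ∀ m n, n₀ ≤ m → m < n → a m + 10 * K ≤ a n) {m n : ℤ}
    (hm : n₀ ≤ m) (hn : n₀ ≤ n) (h : |a m - a n| < 10 * K) : m = n := by
  rw [abs_lt] at h
  rcases lt_trichotomy m n with h' | h' | h'
  · linarith [ha m n hm h', h.1]
  · exact h'
  · linarith [ha n m hn h', h.2]

/-- The numbers of points of `Λ` near the points of two sparse sequences: an isolated point has
one point of `Λ` nearby, a pair of close points has two. -/
theorem exists_near_of_count (hK : 0 < K)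
    (ha : ∀ m n, n₀ ≤ m → m < n → a m + 10 * K ≤ a n)
    (hb : ∀ m n, n₀ ≤ m → m < n → b m + 10 * K ≤ b n)
    (hcount : ∀ z r : ℝ, M ≤ z → 0 < r → r ≤ 3 * K →
      (∀ n ≥ n₀, K ≤ |(|a n - z| - r)|) → (∀ n ≥ n₀, K ≤ |(|b n - z| - r)|) →
      {x | x ∈ Λ ∧ |x - z| < r}.ncard
        = {n | n₀ ≤ n ∧ |a n - z| < r}.ncard + {n | n₀ ≤ n ∧ |b n - z| < r}.ncard)
    {n : ℤ} (hn : n₀ ≤ n) (hM : M ≤ a n) :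
    ((∀ m ≥ n₀, 2 * K < |a n - b m|) →
      ∃ x, ∀ t, (t ∈ Λ ∧ |t - a n| < K) ↔ t = x) ∧
    ((∃ m ≥ n₀, |a n - b m| ≤ 2 * K) →
      ∃ x y, x ≠ y ∧ ∀ t, (t ∈ Λ ∧ |t - a n| < 3 * K) ↔ (t = x ∨ t = y)) := by
  have haway : ∀ n' ≥ n₀, n' ≠ n → 10 * K ≤ |a n' - a n| := by
    intro n' hn' hne
    by_contra! h
    exact hne (eq_of_abs_sub_lt ha hn' hn h)
  have hself : ∀ r, 0 < r → r ≤ 3 * K → {k | n₀ ≤ k ∧ |a k - a n| < r} = {n} := by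
    intro r hr hrK
    ext k
    simp only [mem_ofPred_eq, mem_singleton_iff]
    constructor
    · rintro ⟨hk, hk'⟩
      by_contra hne
      linarith [haway k hk hne]
    · rintro rfl
      exact ⟨hn, by simpa using hr⟩
  have hann : ∀ r, K ≤ r → r ≤ 3 * K → ∀ k ≥ n₀, K ≤ |(|a k - a n| - r)| := by
    intro r hr hrK k hk
    by_cases hne : k = n
    · subst hne
      rw [sub_self, abs_zero, zero_sub, abs_neg]
      exact hr.trans (le_abs_self r)
    · have := haway k hk hne
      exact le_trans (by linarith) (le_abs_self _)
  constructor
  · intro hun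
    have h1 := hcount (a n) K hM hK (by linarith) (hann K le_rfl (by linarith)) (by
      intro m hm
      have := hun m hm
      rw [abs_sub_comm] at this
      exact le_trans (by linarith) (le_abs_self _))
    have h2 : {m | n₀ ≤ m ∧ |b m - a n| < K} = ∅ := by
      ext m
      simp only [mem_ofPred_eq, mem_empty_iff_false, iff_false, not_and, not_lt]
      intro hm
      rw [abs_sub_comm]
      linarith [hun m hm]
    rw [hself K hK (by linarith), h2, ncard_singleton, ncard_empty, ncard_eq_one] at h1
    obtain ⟨x, hx⟩ := h1
    exact ⟨x, fun t => by simpa using Set.ext_iff.1 hx t⟩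
  · rintro ⟨m, hm, hnm⟩
    have hnm' : |b m - a n| ≤ 2 * K := by rwa [abs_sub_comm]
    have hbaway : ∀ m' ≥ n₀, m' ≠ m → 8 * K ≤ |b m' - a n| := by
      intro m' hm' hne
      by_contra! h
      refine hne (eq_of_abs_sub_lt hb hm' hm ?_)
      have := abs_sub_le (b m') (a n) (b m)
      linarith
    have h1 := hcount (a n) (3 * K) hM (by linarith) le_rfl (hann (3 * K) (by linarith) le_rfl) (by
      intro m' hm'
      by_cases hne : m' = m
      · subst hne
        rw [abs_sub_comm]
        exact le_trans (by linarith) (le_abs_self _)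
      · have := hbaway m' hm' hne
        exact le_trans (by linarith) (le_abs_self _))
    have h2 : {k | n₀ ≤ k ∧ |b k - a n| < 3 * K} = {m} := by
      ext k
      simp only [mem_ofPred_eq, mem_singleton_iff]
      constructor
      · rintro ⟨hk, hk'⟩
        by_contra hne
        linarith [hbaway k hk hne]
      · rintro rfl
        exact ⟨hm, by linarith⟩
    rw [hself (3 * K) (by linarith) le_rfl, h2, ncard_singleton, ncard_singleton,
      ncard_eq_two] at h1
    obtain ⟨x, y, hxy, hx⟩ := h1
    exact ⟨x, y, hxy, fun t => by simpa using Set.ext_iff.1 hx t⟩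

/-- A set that has as many points in suitable intervals as two sparse sequences is listed by two
sequences at bounded distance from these. A member of one sequence that is at distance more than
`2 K` from the other sequence has one point of `Λ` within `K`. Otherwise the two close members form
a pair, with two points of `Λ` within `3 K`, one for each of them. The gaps `10 K` keep all these
intervals disjoint. -/
theorem exists_listing_of_count (hK : 0 < K)
    (ha : ∀ m n, n₀ ≤ m → m < n → a m + 10 * K ≤ a n)
    (hb : ∀ m n, n₀ ≤ m → m < n → b m + 10 * K ≤ b n)
    (hat : Tendsto a atTop atTop) (hbt : Tendsto b atTop atTop)
    (hcount : ∀ z r : ℝ, M ≤ z → 0 < r → r ≤ 3 * K →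
      (∀ n ≥ n₀, K ≤ |(|a n - z| - r)|) → (∀ n ≥ n₀, K ≤ |(|b n - z| - r)|) →
      {x | x ∈ Λ ∧ |x - z| < r}.ncard
        = {n | n₀ ≤ n ∧ |a n - z| < r}.ncard + {n | n₀ ≤ n ∧ |b n - z| < r}.ncard)
    (hcover : ∀ x ∈ Λ, M ≤ x → (∃ n ≥ n₀, |x - a n| < K) ∨ ∃ n ≥ n₀, |x - b n| < K)
    (hfin : ∀ T, (Λ ∩ Iic T).Finite) :
    ∃ (N : Fin 2 → ℤ) (f : Fin 2 → ℤ → ℝ) (n₁ : ℤ),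
      BijOn (fun p : Fin 2 × ℤ => f p.1 p.2) {p | N p.1 ≤ p.2} Λ ∧
      ∀ n ≥ n₁, |f 0 n - a n| ≤ 5 * K ∧ |f 1 n - b n| ≤ 5 * K := by
  classical
  obtain ⟨n₁, hn₁⟩ := eventually_atTop.1 ((eventually_ge_atTop n₀).and
    ((hat.eventually_ge_atTop (M + 10 * K)).and (hbt.eventually_ge_atTop (M + 10 * K))))
  have h₁0 : ∀ n ≥ n₁, n₀ ≤ n := fun n hn => (hn₁ n hn).1
  have hMa : ∀ n ≥ n₁, M + 10 * K ≤ a n := fun n hn => (hn₁ n hn).2.1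
  have hMb : ∀ n ≥ n₁, M + 10 * K ≤ b n := fun n hn => (hn₁ n hn).2.2
  have hA : ∀ n, n₀ ≤ n → M ≤ a n → ∃ x y,
      ((∀ m ≥ n₀, 2 * K < |a n - b m|) → ∀ t, (t ∈ Λ ∧ |t - a n| < K) ↔ t = x) ∧
      ((∃ m ≥ n₀, |a n - b m| ≤ 2 * K) →
        x ≠ y ∧ ∀ t, (t ∈ Λ ∧ |t - a n| < 3 * K) ↔ (t = x ∨ t = y)) := by
    intro n hn hM
    obtain ⟨h1, h2⟩ := exists_near_of_count hK ha hb hcount hn hM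
    by_cases hm : ∃ m ≥ n₀, |a n - b m| ≤ 2 * K
    · obtain ⟨x, y, h⟩ := h2 hm
      refine ⟨x, y, fun h' => ?_, fun _ => h⟩
      obtain ⟨m, hm0, hm1⟩ := hm
      exact absurd hm1 (not_le.2 (h' m hm0))
    · obtain ⟨x, h⟩ := h1 (by push Not at hm; exact hm)
      exact ⟨x, x, fun _ => h, fun h' => absurd h' hm⟩
  have hB : ∀ m, n₀ ≤ m → M ≤ b m → ∃ w,
      (∀ n ≥ n₀, 2 * K < |a n - b m|) → ∀ t, (t ∈ Λ ∧ |t - b m| < K) ↔ t = w := by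
    intro m hm hM
    have h1 := (exists_near_of_count hK hb ha (fun z r h1 h2 h3 h4 h5 => by
      rw [hcount z r h1 h2 h3 h5 h4, add_comm]) hm hM).1
    by_cases hn : ∀ n ≥ n₀, 2 * K < |a n - b m|
    · obtain ⟨w, hw⟩ := h1 (fun n h => by rw [abs_sub_comm]; exact hn n h)
      exact ⟨w, fun _ => hw⟩
    · exact ⟨0, fun h => absurd h hn⟩
  choose! x y hx hxy using hA
  choose! w hw using hB
  have hxmem : ∀ n, n₀ ≤ n → M ≤ a n → x n ∈ Λ ∧ |x n - a n| < 3 * K := by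
    intro n hn hM
    by_cases hm : ∃ m ≥ n₀, |a n - b m| ≤ 2 * K
    · exact ((hxy n hn hM hm).2 _).2 (Or.inl rfl)
    · push Not at hm
      have := (hx n hn hM hm _).2 rfl
      exact ⟨this.1, by linarith [this.2]⟩
  -- The partner in the first sequence of a point of the second one, where there is one.
  set c : ℤ → ℤ := fun m => if h : ∃ n ≥ n₀, |a n - b m| ≤ 2 * K then h.choose else 0 with hc
  have hcs : ∀ m, (∃ n ≥ n₀, |a n - b m| ≤ 2 * K) → n₀ ≤ c m ∧ |a (c m) - b m| ≤ 2 * K := by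
    intro m h
    simp only [hc, dif_pos h]
    exact h.choose_spec
  have hcuniq : ∀ m n, n₀ ≤ n → |a n - b m| ≤ 2 * K → c m = n := by
    intro m n hn hnm
    obtain ⟨h1, h2⟩ := hcs m ⟨n, hn, hnm⟩
    refine eq_of_abs_sub_lt ha h1 hn ?_
    have := abs_sub_le (a (c m)) (b m) (a n)
    rw [abs_sub_comm (b m)] at this
    linarith
  -- In a pair the first sequence takes `x`, the second one takes `y`.
  set f : Fin 2 → ℤ → ℝ := fun i m => if i = 0 then x m else
    if ∃ n ≥ n₀, |a n - b m| ≤ 2 * K then y (c m) else w m with hf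
  have f0 : ∀ n, f 0 n = x n := fun n => rfl
  have f1 : ∀ m, (∃ n ≥ n₀, |a n - b m| ≤ 2 * K) → f 1 m = y (c m) := fun m h => by simp [hf, h]
  have f1' : ∀ m, (∀ n ≥ n₀, 2 * K < |a n - b m|) → f 1 m = w m := fun m h => by
    have : ¬ ∃ n ≥ n₀, |a n - b m| ≤ 2 * K := by push Not; exact h
    simp only [hf, if_neg this]
    simp
  have hcM : ∀ m ≥ n₁, (∃ n ≥ n₀, |a n - b m| ≤ 2 * K) → M ≤ a (c m) := by
    intro m hm h
    have := (abs_le.1 (hcs m h).2).1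
    linarith [hMb m hm]
  have hy : ∀ m ≥ n₁, (∃ n ≥ n₀, |a n - b m| ≤ 2 * K) →
      x (c m) ≠ y (c m) ∧ y (c m) ∈ Λ ∧ |y (c m) - a (c m)| < 3 * K := by
    intro m hm h
    have h2 := hxy (c m) (hcs m h).1 (hcM m hm h) ⟨m, h₁0 m hm, (hcs m h).2⟩
    exact ⟨h2.1, (h2.2 _).2 (Or.inr rfl)⟩
  have hw' : ∀ m ≥ n₁, (∀ n ≥ n₀, 2 * K < |a n - b m|) → w m ∈ Λ ∧ |w m - b m| < K := by
    intro m hm h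
    exact (hw m (h₁0 m hm) (by linarith [hMb m hm]) h _).2 rfl
  have hmx : ∀ n ≥ n₁, f 0 n ∈ Λ ∧ |f 0 n - a n| < 5 * K := by
    intro n hn
    have := hxmem n (h₁0 n hn) (by linarith [hMa n hn])
    exact ⟨this.1, by rw [f0]; linarith [this.2]⟩
  have hmy : ∀ m ≥ n₁, f 1 m ∈ Λ ∧ |f 1 m - b m| < 5 * K := by
    intro m hm
    by_cases h : ∃ n ≥ n₀, |a n - b m| ≤ 2 * K
    · obtain ⟨-, h1, h2⟩ := hy m hm h
      rw [f1 m h]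
      refine ⟨h1, ?_⟩
      have := abs_sub_le (y (c m)) (a (c m)) (b m)
      linarith [(hcs m h).2]
    · push Not at h
      rw [f1' m h]
      obtain ⟨h1, h2⟩ := hw' m hm h
      exact ⟨h1, by linarith⟩
  have hcross : ∀ n ≥ n₁, ∀ m ≥ n₁, f 0 n ≠ f 1 m := by
    intro n hn m hm heq
    have hxn := hxmem n (h₁0 n hn) (by linarith [hMa n hn])
    rw [f0] at heq
    by_cases h : ∃ k ≥ n₀, |a k - b m| ≤ 2 * K
    · obtain ⟨h1, -, h2⟩ := hy m hm h
      rw [f1 m h] at heq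
      have : c m = n := by
        refine eq_of_abs_sub_lt ha (hcs m h).1 (h₁0 n hn) ?_
        have h3 := abs_sub_le (a (c m)) (y (c m)) (a n)
        rw [abs_sub_comm (a (c m)) (y (c m)), ← heq] at h3
        rw [← heq] at h2
        linarith [hxn.2]
      rw [this] at h1 heq
      exact h1 heq
    · push Not at h
      obtain ⟨-, h2⟩ := hw' m hm h
      rw [f1' m h] at heq
      by_cases h' : ∃ k ≥ n₀, |a n - b k| ≤ 2 * K
      · obtain ⟨k, hk, hnk⟩ := h'
        have : k = m := by
          refine eq_of_abs_sub_lt hb hk (h₁0 m hm) ?_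
          have h3 := abs_sub_le (b k) (a n) (b m)
          have h4 := abs_sub_le (a n) (x n) (b m)
          rw [abs_sub_comm (a n) (x n)] at h4
          rw [abs_sub_comm (b k) (a n)] at h3
          rw [← heq] at h2
          linarith [hxn.2]
        subst this
        exact absurd hnk (not_le.2 (h n (h₁0 n hn)))
      · push Not at h'
        have h3 := ((hx n (h₁0 n hn) (by linarith [hMa n hn]) h' (x n)).2 rfl).2
        have h4 := abs_sub_le (a n) (x n) (b m)
        rw [abs_sub_comm (a n) (x n)] at h4
        rw [← heq] at h2
        linarith [h' m (h₁0 m hm)]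
  have hinj : InjOn (fun p : Fin 2 × ℤ => f p.1 p.2) {p | n₁ ≤ p.2} := by
    rintro ⟨i, n⟩ hn ⟨k, m⟩ hm heq
    have hn' : n ≥ n₁ := hn
    have hm' : m ≥ n₁ := hm
    change f i n = f k m at heq
    fin_cases i <;> fin_cases k
    · have h1 := hmx n hn'
      have h2 := hmx m hm'
      have h3 := abs_sub_le (a n) (f 0 n) (a m)
      rw [abs_sub_comm (a n) (f 0 n)] at h3
      change f 0 n = f 0 m at heq
      rw [heq] at h1 h3
      rw [eq_of_abs_sub_lt ha (h₁0 n hn') (h₁0 m hm') (by linarith [h1.2, h2.2])]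
    · exact absurd heq (hcross n hn' m hm')
    · exact absurd heq.symm (hcross m hm' n hn')
    · have h1 := hmy n hn'
      have h2 := hmy m hm'
      have h3 := abs_sub_le (b n) (f 1 n) (b m)
      rw [abs_sub_comm (b n) (f 1 n)] at h3
      change f 1 n = f 1 m at heq
      rw [heq] at h1 h3
      rw [eq_of_abs_sub_lt hb (h₁0 n hn') (h₁0 m hm') (by linarith [h1.2, h2.2])]
  have hmaps : MapsTo (fun p : Fin 2 × ℤ => f p.1 p.2) {p | n₁ ≤ p.2} Λ := by
    rintro ⟨i, n⟩ hn
    fin_cases i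
    · exact (hmx n hn).1
    · exact (hmy n hn).1
  -- Every large point of `Λ` lies in a group all of whose indices are at least `n₁`.
  have hsurj : Λ \ (fun p : Fin 2 × ℤ => f p.1 p.2) '' {p | n₁ ≤ p.2} ⊆
      Λ ∩ Iic (max M (max (a n₁) (b n₁)) + 10 * K) := by
    rintro t ⟨ht, hnot⟩
    refine ⟨ht, ?_⟩
    by_contra! hlarge
    rw [mem_Iic, not_le] at hlarge
    have hlM : M ≤ max M (max (a n₁) (b n₁)) := le_max_left _ _
    have hla : a n₁ ≤ max M (max (a n₁) (b n₁)) := (le_max_left _ _).trans (le_max_right _ _)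
    have hlb : b n₁ ≤ max M (max (a n₁) (b n₁)) := (le_max_right _ _).trans (le_max_right _ _)
    have hidxa : ∀ n ≥ n₀, |t - a n| < 6 * K → n₁ ≤ n := by
      intro n hn htn
      by_contra! hlt
      have := (abs_lt.1 htn).2
      linarith [ha n n₁ hn hlt]
    have hidxb : ∀ n ≥ n₀, |t - b n| < 6 * K → n₁ ≤ n := by
      intro n hn htn
      by_contra! hlt
      have := (abs_lt.1 htn).2
      linarith [hb n n₁ hn hlt]
    have hpair : ∀ n ≥ n₀, ∀ m ≥ n₀, |a n - b m| ≤ 2 * K → |t - a n| < 3 * K → False := by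
      intro n hn m hm hnm htn
      have h1 := hidxa n hn (by linarith)
      have h2 : n₁ ≤ m := by
        refine hidxb m hm ?_
        have := abs_sub_le t (a n) (b m)
        linarith
      have hcm := hcuniq m n hn hnm
      rcases ((hxy n hn (by linarith [hMa n h1]) ⟨m, hm, hnm⟩).2 t).1 ⟨ht, htn⟩ with h | h
      · exact hnot ⟨(0, n), h1, h.symm⟩
      · refine hnot ⟨(1, m), h2, ?_⟩
        change f 1 m = t
        rw [f1 m ⟨n, hn, hnm⟩, hcm, h]
    rcases hcover t ht (by linarith) with ⟨n, hn, htn⟩ | ⟨m, hm, htm⟩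
    · by_cases h : ∃ m ≥ n₀, |a n - b m| ≤ 2 * K
      · obtain ⟨m, hm, hnm⟩ := h
        exact hpair n hn m hm hnm (by linarith)
      · push Not at h
        have h1 := hidxa n hn (by linarith)
        exact hnot ⟨(0, n), h1, ((hx n hn (by linarith [hMa n h1]) h t).1 ⟨ht, htn⟩).symm⟩
    · by_cases h : ∃ n ≥ n₀, |a n - b m| ≤ 2 * K
      · obtain ⟨n, hn, hnm⟩ := h
        refine hpair n hn m hm hnm ?_
        have := abs_sub_le t (b m) (a n)
        rw [abs_sub_comm (b m)] at this
        linarith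
      · push Not at h
        have h1 := hidxb m hm (by linarith)
        refine hnot ⟨(1, m), h1, ?_⟩
        change f 1 m = t
        rw [f1' m h]
        exact ((hw m hm (by linarith [hMb m h1]) h t).1 ⟨ht, htm⟩).symm
  obtain ⟨N, f', hbij, hff⟩ := exists_bijOn_extend hinj hmaps ((hfin _).subset hsurj)
  refine ⟨N, f', n₁, hbij, fun n hn => ?_⟩
  rw [hff 0 n hn, hff 1 n hn]
  exact ⟨(hmx n hn).2.le, (hmy n hn).2.le⟩

end Enumeration

/-! ### Uniform asymptotics along sequences -/

namespace SLProblem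

variable {P : SLProblem}

section Growth

theorem isLittleO_const_intCast {E : Type*} [NormedAddCommGroup E] (c : E) :
    (fun _ : ℤ => c) =o[atTop] fun n : ℤ => (n : ℝ) :=
  isLittleO_const_left.2
    (Or.inr (tendsto_norm_atTop_atTop.comp (tendsto_intCast_atTop_atTop (R := ℝ))))

theorem isBigO_one_div_intCast : (fun n : ℤ => 1 / (n : ℝ)) =O[atTop] fun _ => (1 : ℝ) := by
  have : Tendsto (fun n : ℤ => 1 / (n : ℝ)) atTop (𝓝 0) := by
    simp only [one_div]
    exact tendsto_inv_atTop_zero.comp (tendsto_intCast_atTop_atTop (R := ℝ))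
  exact this.isBigO_one ℝ

theorem isTheta_mu (hP : P.Admissible) (i : Fin 2) :
    (fun n => P.mu i n) =Θ[atTop] fun n : ℤ => (n : ℝ) := by
  obtain ⟨d, hd, h⟩ := exists_pos_sub hP i
  have h1 : (fun n : ℤ => P.pos i n) = (fun n : ℤ => d * (n : ℝ)) + fun _ => P.pos i 0 := by
    funext n
    have := h n 0
    simp only [Pi.add_apply, Int.cast_zero, sub_zero] at this ⊢
    linarith
  have h2 : (fun n => P.pos i n) =Θ[atTop] fun n : ℤ => (n : ℝ) := by
    rw [h1]
    exact ((isTheta_refl _ _).const_mul_left hd.ne').add_isLittleO (isLittleO_const_intCast _)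
  refine (IsTheta.of_norm_eventuallyEq_norm (Eventually.of_forall fun n => ?_)).trans h2
  exact (sq_eq_sq_iff_abs_eq_abs _ _).1 (pos_sq i n).symm

theorem isTheta_of_sub {s : ℤ → ℂ} {m : ℤ → ℝ} (hm : m =Θ[atTop] fun n : ℤ => (n : ℝ))
    (hs : (fun n => s n - m n) =O[atTop] fun n : ℤ => 1 / (n : ℝ)) :
    s =Θ[atTop] fun n : ℤ => (n : ℝ) := by
  have h1 : (fun n => s n - m n) =o[atTop] fun n : ℤ => (n : ℝ) :=
    (hs.trans isBigO_one_div_intCast).trans_isLittleO (isLittleO_const_intCast 1)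
  have h2 : (fun n => (m n : ℂ)) =Θ[atTop] fun n : ℤ => (n : ℝ) :=
    (IsTheta.of_norm_eventuallyEq_norm (Eventually.of_forall fun n =>
      Complex.norm_real (m n))).trans hm
  have h := h1.add_isTheta h2
  rwa [show ((fun n => s n - m n) + fun n => (m n : ℂ)) = s from funext fun n => by simp] at h

theorem eventually_abs_im_le {s : ℤ → ℂ} {m : ℤ → ℝ}
    (hs : (fun n => s n - m n) =O[atTop] fun n : ℤ => 1 / (n : ℝ)) :
    ∃ c, ∀ᶠ n in atTop, |(s n).im| ≤ c := by
  obtain ⟨c, hc⟩ := (hs.trans isBigO_one_div_intCast).bound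
  refine ⟨c, hc.mono fun n hn => ?_⟩
  have := (Complex.abs_im_le_norm _).trans hn
  simpa using this

end Growth

section Trigonometric

/-- `sin` and `cos` are Lipschitz in horizontal strips. -/
theorem norm_trig_sub_le {B : ℝ} {z w : ℂ} (hz : |z.im| ≤ B) (hw : |w.im| ≤ B) :
    ‖Complex.sin z - Complex.sin w‖ ≤ Real.exp B * ‖z - w‖ ∧
      ‖Complex.cos z - Complex.cos w‖ ≤ Real.exp B * ‖z - w‖ := by
  have hconv : Convex ℝ {z : ℂ | |z.im| ≤ B} := by
    have : {z : ℂ | |z.im| ≤ B} = Complex.imLm ⁻¹' Icc (-B) B := by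
      ext z
      simp [abs_le]
    rw [this]
    exact (convex_Icc _ _).linear_preimage _
  constructor
  · refine Convex.norm_image_sub_le_of_norm_deriv_le
      (fun x _ => Complex.differentiable_sin x) (fun x hx => ?_) hconv hw hz
    rw [Complex.deriv_sin]
    exact (norm_cos_le_exp x).trans (Real.exp_le_exp.2 hx)
  · refine Convex.norm_image_sub_le_of_norm_deriv_le
      (fun x _ => Complex.differentiable_cos x) (fun x hx => ?_) hconv hw hz
    rw [Complex.deriv_cos, norm_neg]
    exact (norm_sin_le_exp x).trans (Real.exp_le_exp.2 hx)

theorem abs_im_mul_sub_le {z : ℂ} {c x x₀ x₁ : ℝ} (hz : |z.im| ≤ c) (hx : x ∈ Icc x₀ x₁) :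
    |(z * ((x : ℂ) - x₀)).im| ≤ c * (x₁ - x₀) := by
  have hc := (abs_nonneg _).trans hz
  rw [← Complex.ofReal_sub, Complex.im_mul_ofReal, abs_mul, abs_of_nonneg (sub_nonneg.2 hx.1)]
  exact mul_le_mul hz (by linarith [hx.2]) (sub_nonneg.2 hx.1) hc

theorem isBigO_trig {s : ℤ → ℂ} (him : ∃ c, ∀ᶠ n in atTop, |(s n).im| ≤ c) (x₀ x₁ : ℝ) :
    (fun p : ℤ × ℝ => Complex.sin (s p.1 * (p.2 - x₀)))
        =O[atTop ×ˢ 𝓟 (Icc x₀ x₁)] (fun _ => (1 : ℝ)) ∧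
      (fun p : ℤ × ℝ => Complex.cos (s p.1 * (p.2 - x₀)))
        =O[atTop ×ˢ 𝓟 (Icc x₀ x₁)] (fun _ => (1 : ℝ)) := by
  obtain ⟨c, hc⟩ := him
  constructor
  · refine IsBigO.of_bound (Real.exp (c * (x₁ - x₀))) (eventually_prod_principal_iff.2 ?_)
    filter_upwards [hc] with n hn x hx
    rw [norm_one, mul_one]
    exact (norm_sin_le_exp _).trans (Real.exp_le_exp.2 (abs_im_mul_sub_le hn hx))
  · refine IsBigO.of_bound (Real.exp (c * (x₁ - x₀))) (eventually_prod_principal_iff.2 ?_)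
    filter_upwards [hc] with n hn x hx
    rw [norm_one, mul_one]
    exact (norm_cos_le_exp _).trans (Real.exp_le_exp.2 (abs_im_mul_sub_le hn hx))

theorem isBigO_trig_sub {s : ℤ → ℂ} {m : ℤ → ℝ}
    (hs : (fun n => s n - m n) =O[atTop] fun n : ℤ => 1 / (n : ℝ)) (x₀ x₁ : ℝ) :
    (fun p : ℤ × ℝ => Complex.sin (s p.1 * (p.2 - x₀)) - Complex.sin (m p.1 * (p.2 - x₀)))
        =O[atTop ×ˢ 𝓟 (Icc x₀ x₁)] (fun p => 1 / (p.1 : ℝ)) ∧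
      (fun p : ℤ × ℝ => Complex.cos (s p.1 * (p.2 - x₀)) - Complex.cos (m p.1 * (p.2 - x₀)))
        =O[atTop ×ˢ 𝓟 (Icc x₀ x₁)] (fun p => 1 / (p.1 : ℝ)) := by
  obtain ⟨c, hc⟩ := eventually_abs_im_le hs
  have hfst := hs.comp_tendsto (tendsto_fst (f := atTop) (g := 𝓟 (Icc x₀ x₁)))
  have key : ∀ᶠ p : ℤ × ℝ in atTop ×ˢ 𝓟 (Icc x₀ x₁),
      |(s p.1 * (p.2 - x₀)).im| ≤ c * (x₁ - x₀) ∧ |((m p.1 : ℂ) * (p.2 - x₀)).im| ≤ c * (x₁ - x₀) ∧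
      ‖s p.1 * (p.2 - x₀) - m p.1 * (p.2 - x₀)‖ ≤ ‖s p.1 - m p.1‖ * (x₁ - x₀) := by
    refine eventually_prod_principal_iff.2 ?_
    filter_upwards [hc] with n hn x hx
    refine ⟨abs_im_mul_sub_le hn hx, abs_im_mul_sub_le ?_ hx, ?_⟩
    · simpa using (abs_nonneg _).trans hn
    · rw [← sub_mul, norm_mul, ← Complex.ofReal_sub, Complex.norm_real, Real.norm_eq_abs,
        abs_of_nonneg (sub_nonneg.2 hx.1)]
      have := hx.2
      gcongr
  constructor
  · refine (IsBigO.of_bound (Real.exp (c * (x₁ - x₀)) * (x₁ - x₀)) ?_).trans hfst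
    filter_upwards [key] with p hp
    refine (norm_trig_sub_le hp.1 hp.2.1).1.trans ?_
    calc _ ≤ Real.exp (c * (x₁ - x₀)) * (‖s p.1 - m p.1‖ * (x₁ - x₀)) := by gcongr; exact hp.2.2
      _ = _ := by simp only [Function.comp_apply]; ring
  · refine (IsBigO.of_bound (Real.exp (c * (x₁ - x₀)) * (x₁ - x₀)) ?_).trans hfst
    filter_upwards [key] with p hp
    refine (norm_trig_sub_le hp.1 hp.2.1).2.trans ?_
    calc _ ≤ Real.exp (c * (x₁ - x₀)) * (‖s p.1 - m p.1‖ * (x₁ - x₀)) := by gcongr; exact hp.2.2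
      _ = _ := by simp only [Function.comp_apply]; ring

end Trigonometric

section Solutions

variable {q : ℝ → ℝ} {Q x₀ x₁ : ℝ} {s : ℤ → ℂ} {y y' : ℤ → ℝ → ℂ} {g : ℤ → ℝ}

/-- The asymptotics of a sequence of solutions, uniformly in `x`, in terms of the growth `g` of
their initial values. -/
theorem IsSol.isBigO_sub (hq : Continuous q) (hQ : ∀ z, |q z| ≤ Q) (h01 : x₀ ≤ x₁)
    (hy : ∀ n, IsSol q (s n ^ 2) (y n) (y' n)) (hs : s =Θ[atTop] fun n : ℤ => (n : ℝ))
    (him : ∃ c, ∀ᶠ n in atTop, |(s n).im| ≤ c)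
    (hg : (fun n => y n x₀) =O[atTop] g) (hg' : (fun n => y' n x₀ / s n) =O[atTop] g) :
    (fun p : ℤ × ℝ => y p.1 p.2 - (y p.1 x₀ * Complex.cos (s p.1 * (p.2 - x₀))
        + y' p.1 x₀ / s p.1 * Complex.sin (s p.1 * (p.2 - x₀))))
      =O[atTop ×ˢ 𝓟 (Icc x₀ x₁)] fun p => g p.1 * (1 / (p.1 : ℝ)) := by
  obtain ⟨c, hc⟩ := him
  have hQ0 : 0 ≤ Q := (abs_nonneg _).trans (hQ 0)
  have hsn : Tendsto (fun n => ‖s n‖) atTop atTop :=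
    hs.tendsto_norm_atTop_iff.2 (tendsto_norm_atTop_atTop.comp tendsto_intCast_atTop_atTop)
  have h1 : (fun n => (‖y n x₀‖ + ‖y' n x₀ / s n‖) * ‖s n‖⁻¹)
      =O[atTop] fun n : ℤ => g n * (1 / (n : ℝ)) := by
    simp only [one_div]
    exact (hg.norm_left.add hg'.norm_left).mul hs.norm_left.inv.1
  refine IsBigO.trans (IsBigO.of_bound
    (2 * (Q * (x₁ - x₀)) * Real.exp (c * (x₁ - x₀))) ?_) (h1.comp_tendsto tendsto_fst)
  refine eventually_prod_principal_iff.2 ?_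
  filter_upwards [hc, hsn.eventually_ge_atTop (2 * (Q * (x₁ - x₀))),
    hsn.eventually_gt_atTop 0] with n hn hsn1 hsn0 x hx
  refine ((hy n).asymptotics hq hQ h01 hsn1 (norm_pos_iff.1 hsn0) x hx).1.trans ?_
  have h01' := sub_nonneg.2 h01
  have hexp : Real.exp (|(s n).im| * (x - x₀)) ≤ Real.exp (c * (x₁ - x₀)) := by
    refine Real.exp_le_exp.2 (mul_le_mul hn (by linarith [hx.2]) (sub_nonneg.2 hx.1)
      ((abs_nonneg _).trans hn))
  simp only [Function.comp_apply]
  rw [Real.norm_of_nonneg (by positivity : 0 ≤ (‖y n x₀‖ + ‖y' n x₀ / s n‖) * ‖s n‖⁻¹), norm_div]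
  calc _ ≤ 2 * (Q * (x₁ - x₀)) * ((‖y n x₀‖ + ‖y' n x₀‖ / ‖s n‖) / ‖s n‖)
        * Real.exp (c * (x₁ - x₀)) := by gcongr
    _ = _ := by rw [div_eq_mul_inv _ ‖s n‖]; ring

end Solutions

/-- A uniform estimate on `S` is an estimate along the product of `atTop` and the principal filter
of `S`; one may enlarge `S`. -/
theorem uniformBigO_of_isBigO {S S' : Set ℝ} {F : ℤ → ℝ → ℂ} {G : ℤ → ℝ → ℝ} {g : ℤ → ℝ}
    {f : ℤ → ℝ → ℂ} (hS : S ⊆ S') (hF : ∀ n, ∀ x ∈ S, F n x = f n x)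
    (h : (fun p : ℤ × ℝ => f p.1 p.2 - G p.1 p.2) =O[atTop ×ˢ 𝓟 S'] fun p => g p.1) :
    UniformBigO S F G g := by
  obtain ⟨C, hC⟩ := h.bound
  obtain ⟨n₀, hn₀⟩ := eventually_atTop.1 (eventually_prod_principal_iff.1 hC)
  refine ⟨C, n₀, fun n hn x hx => ?_⟩
  rw [hF n x hx]
  exact hn₀ n hn x (hS hx)

end SLProblem

/-! ### Existence of an enumeration -/

namespace SLProblem

variable {P : SLProblem}

section Enumeration

/-- A square root of a real number `x`: it is `√x` for `x ≥ 0` and `i √(-x)` for `x ≤ 0`, since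
`Real.sqrt` vanishes at negative numbers. -/
noncomputable def realSqrt (x : ℝ) : ℂ := (√x : ℂ) + (√(-x) : ℂ) * Complex.I

theorem realSqrt_sq (x : ℝ) : realSqrt x ^ 2 = x := by
  have h1 : (√x * √x - √(-x) * √(-x) : ℝ) = x ∧ √x * √(-x) = 0 := by
    rcases le_total 0 x with h | h
    · rw [Real.mul_self_sqrt h, Real.sqrt_eq_zero_of_nonpos (neg_nonpos.2 h)]
      simp
    · rw [Real.mul_self_sqrt (neg_nonneg.2 h), Real.sqrt_eq_zero_of_nonpos h]
      simp
  have h2 : ((√x : ℂ) * √x - √(-x) * √(-x)) = x := by exact_mod_cast h1.1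
  have h3 : (√x : ℂ) * √(-x) = 0 := by exact_mod_cast h1.2
  rw [realSqrt]
  linear_combination h2 + 2 * Complex.I * h3 + (√(-x) : ℂ) ^ 2 * Complex.I_sq

theorem norm_realSqrt_sub_le {x p : ℝ} (hx : 0 ≤ x) (hp : 0 < p) :
    ‖realSqrt x - p‖ ≤ |x - p ^ 2| / p := by
  have h0 : realSqrt x - p = ((√x - p : ℝ) : ℂ) := by
    rw [realSqrt, Real.sqrt_eq_zero_of_nonpos (neg_nonpos.2 hx)]
    simp
  rw [h0, Complex.norm_real, Real.norm_eq_abs, le_div_iff₀ hp]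
  have h1 : x - p ^ 2 = (√x - p) * (√x + p) := by
    linear_combination -Real.sq_sqrt hx
  have h2 := Real.sqrt_nonneg x
  rw [h1, abs_mul, abs_of_pos (by positivity : 0 < √x + p)]
  gcongr
  linarith

theorem tendsto_pos (hP : P.Admissible) (i : Fin 2) : Tendsto (P.pos i) atTop atTop := by
  obtain ⟨d, hd, h⟩ := exists_pos_sub hP i
  have h1 : P.pos i = fun n : ℤ => P.pos i 0 + (n : ℝ) * d := by
    funext n
    have := h n 0
    simp only [Int.cast_zero, sub_zero] at this
    linarith
  rw [h1]
  exact tendsto_atTop_add_const_left _ _ (tendsto_intCast_atTop_atTop.atTop_mul_const hd)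

theorem isTheta_pos (hP : P.Admissible) (i : Fin 2) :
    P.pos i =Θ[atTop] fun n : ℤ => (n : ℝ) :=
  (IsTheta.of_norm_eventuallyEq_norm (Eventually.of_forall fun n =>
    (sq_eq_sq_iff_abs_eq_abs _ _).1 (pos_sq i n))).trans (isTheta_mu hP i)

/-- The squares of the leading terms are eventually sparse. -/
theorem eventually_pos_sq_add_le (hP : P.Admissible) (i : Fin 2) (K : ℝ) :
    ∀ᶠ n₀ in atTop, 0 < P.pos i n₀ ∧
      ∀ m n, n₀ ≤ m → m < n → P.pos i m ^ 2 + K ≤ P.pos i n ^ 2 := by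
  obtain ⟨d, hd, h⟩ := exists_pos_sub hP i
  filter_upwards [(tendsto_pos hP i).eventually_gt_atTop 0,
    (tendsto_pos hP i).eventually_ge_atTop (K / d)] with n₀ h0 h1
  refine ⟨h0, fun m n hm hmn => ?_⟩
  rw [div_le_iff₀ hd] at h1
  have h2 : P.pos i n₀ ≤ P.pos i m := (strictMono_pos hP i).monotone hm
  have h3 := h n m
  have h4 : (1 : ℝ) ≤ n - m := by
    have : m + 1 ≤ n := hmn
    have : (m : ℝ) + 1 ≤ n := by exact_mod_cast this
    linarith
  have h5 : d ≤ P.pos i n - P.pos i m := by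
    rw [h3]
    exact le_mul_of_one_le_left hd.le h4
  nlinarith

theorem ofReal_image_realEigenvalues (X : P.Ext) (hP : P.Admissible)
    (hα : P.α10 ≠ 0 ∨ P.α11 ≠ 0) :
    ((↑) : ℝ → ℂ) '' P.realEigenvalues = P.eigenvalues := by
  ext z
  constructor
  · rintro ⟨x, hx, rfl⟩
    exact hx
  · intro hz
    have h := X.im_eq_zero_of_charFun_eq_zero hP hα ((X.mem_eigenvalues_iff hP hα).1 hz)
    have hz' : ((z.re : ℝ) : ℂ) = z := Complex.ext (by simp) (by simp [h])
    refine ⟨z.re, ?_, hz'⟩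
    change ((z.re : ℝ) : ℂ) ∈ P.eigenvalues
    rwa [hz']

/-- The eigenvalues are listed at distance `O(1)` from the numbers `mu i n ^ 2`; square roots of the
right sign are then at distance `O(1/n)` from `mu i n`. -/
theorem exists_isEnumeration (X : P.Ext) (hP : P.Admissible) (hα : P.α10 ≠ 0 ∨ P.α11 ≠ 0)
    (hΔ : P.Δ24 ≠ 0) : ∃ (N : Fin 2 → ℤ) (s : Fin 2 → ℤ → ℂ), P.IsEnumeration N s := by
  obtain ⟨K, hK, h⟩ := X.eigenvalue_count hP hα hΔ
  obtain ⟨n₀, ⟨hpos0, hgap0⟩, hpos1, hgap1⟩ := ((eventually_pos_sq_add_le hP 0 (10 * K)).and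
    (eventually_pos_sq_add_le hP 1 (10 * K))).exists
  obtain ⟨M, hM, hcount, hcover⟩ := h n₀ (Fin.forall_fin_two.2 ⟨hpos0, hpos1⟩)
  have ht : ∀ i, Tendsto (fun n => P.pos i n ^ 2) atTop atTop := fun i =>
    (tendsto_pow_atTop two_ne_zero).comp (tendsto_pos hP i)
  obtain ⟨N, f, n₁, hbij, hnear⟩ := exists_listing_of_count (Λ := P.realEigenvalues) (M := M)
    hK hgap0 hgap1 (ht 0) (ht 1)
    (fun z r hz hr hrK h0 h1 => hcount z r hz hr hrK (Fin.forall_fin_two.2 ⟨h0, h1⟩))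
    (fun x hx hxM => by simpa [Fin.exists_fin_two] using hcover x hx hxM)
    (fun T => X.finite_realEigenvalues_le hP hα hΔ T)
  -- The sign of the square root is that of `mu i n` for large `n`.
  set ε : Fin 2 → ℂ := ![1, -1] with hε
  have hε2 : ∀ i, ε i ^ 2 = 1 := by
    intro i
    fin_cases i <;> simp [hε]
  have hε1 : ∀ i, ‖ε i‖ = 1 := by
    intro i
    fin_cases i <;> simp [hε]
  have hεmu : ∀ i n, (P.mu i n : ℂ) = ε i * P.pos i n := by
    intro i n
    fin_cases i <;> simp [hε, pos]
  refine ⟨N, fun i n => ε i * realSqrt (f i n), ?_, fun i => ?_⟩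
  · rw [← ofReal_image_realEigenvalues X hP hα]
    refine ((Complex.ofReal_injective.injOn.bijOn_image).comp hbij).congr fun p _ => ?_
    simp only [Function.comp_apply]
    rw [mul_pow, hε2, realSqrt_sq, one_mul]
  · have hnear' : ∀ n ≥ n₁, |f i n - P.pos i n ^ 2| ≤ 5 * K := by
      intro n hn
      fin_cases i
      · exact (hnear n hn).1
      · exact (hnear n hn).2
    have h1 : (fun n => ε i * realSqrt (f i n) - P.mu i n) =O[atTop] fun n => (P.pos i n)⁻¹ := by
      refine IsBigO.of_bound (5 * K) ?_
      filter_upwards [eventually_ge_atTop n₁, (tendsto_pos hP i).eventually_gt_atTop 0,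
        (ht i).eventually_ge_atTop (5 * K)] with n hn hp hpK
      have hfn := hnear' n hn
      have hf0 : 0 ≤ f i n := by linarith [(abs_le.1 hfn).1]
      rw [hεmu, ← mul_sub, norm_mul, hε1, one_mul, norm_inv, Real.norm_of_nonneg hp.le]
      refine (norm_realSqrt_sub_le hf0 hp).trans ?_
      rw [div_eq_mul_inv]
      gcongr
    simp only [one_div]
    exact h1.trans (isTheta_pos hP i).inv.1

end Enumeration

end SLProblem

/-! ### Asymptotics of the eigenfunctions -/

namespace SLProblem

variable {P : SLProblem}

namespace Ext

section Sequence

variable {s : ℤ → ℂ}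

/-- The growth of the initial values at `c+` along a sequence of square roots of spectral
parameters. -/
theorem isBigO_phi₂c (X : P.Ext) (hP : P.Admissible) (hs : s =Θ[atTop] fun n : ℤ => (n : ℝ))
    (him : ∃ c, ∀ᶠ n in atTop, |(s n).im| ≤ c) :
    (fun n => P.phi₂c (s n ^ 2)
        - (P.Δ24 / P.Δ12 : ℝ) * (P.sigL (s n) * (P.kL * Complex.sin (s n * (P.c - P.a) + P.thL))))
      =O[atTop] (fun n : ℤ => ‖P.sigL (s n)‖ * (1 / (n : ℝ))) ∧
    (fun n => P.phi₂c (s n ^ 2)) =O[atTop] (fun n : ℤ => ‖P.sigL (s n)‖) ∧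
    (fun n => P.dphi₂c (s n ^ 2)) =O[atTop] (fun n : ℤ => ‖P.sigL (s n)‖) := by
  obtain ⟨C, hC, S, hS, h⟩ := X.left_asymptotics hP
  obtain ⟨c, hc⟩ := him
  have hac := sub_pos.2 hP.hac
  have hΔ : (P.Δ12 : ℂ) ≠ 0 := by exact_mod_cast hP.Δ12_pos.ne'
  have hsn : Tendsto (fun n => ‖s n‖) atTop atTop :=
    hs.tendsto_norm_atTop_iff.2 (tendsto_norm_atTop_atTop.comp tendsto_intCast_atTop_atTop)
  set E := Real.exp (c * (P.c - P.a)) with hE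
  set V : ℤ → ℂ := fun n =>
    P.sigL (s n) * (P.kL * Complex.sin (s n * (P.c - P.a) + P.thL)) with hV
  have hexp : ∀ n, |(s n).im| ≤ c → Real.exp (|(s n).im| * (P.c - P.a)) ≤ E := fun n hn =>
    Real.exp_le_exp.2 (mul_le_mul_of_nonneg_right hn hac.le)
  have hinv : (fun n => ‖P.sigL (s n)‖ * ‖s n‖⁻¹)
      =O[atTop] fun n : ℤ => ‖P.sigL (s n)‖ * (1 / (n : ℝ)) := by
    simp only [one_div]
    exact (isBigO_refl _ _).mul hs.norm_left.inv.1
  have hone : (fun n : ℤ => ‖P.sigL (s n)‖ * (1 / (n : ℝ))) =O[atTop] fun n => ‖P.sigL (s n)‖ := by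
    simpa using (isBigO_refl (fun n => ‖P.sigL (s n)‖) atTop).mul isBigO_one_div_intCast
  have hd : (fun n => X.dyL (s n ^ 2) P.c - V n)
      =O[atTop] fun n : ℤ => ‖P.sigL (s n)‖ * (1 / (n : ℝ)) := by
    refine (IsBigO.of_bound (C * E) ?_).trans hinv
    filter_upwards [hc, hsn.eventually_ge_atTop S] with n hn hsS
    refine (h (s n) hsS).1.trans ?_
    rw [Real.norm_of_nonneg (by positivity : 0 ≤ ‖P.sigL (s n)‖ * ‖s n‖⁻¹)]
    have := hexp n hn
    calc _ ≤ C * ‖P.sigL (s n)‖ / ‖s n‖ * E := by gcongr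
      _ = _ := by rw [div_eq_mul_inv]; ring
  have hy : (fun n => X.yL (s n ^ 2) P.c)
      =O[atTop] fun n : ℤ => ‖P.sigL (s n)‖ * (1 / (n : ℝ)) := by
    refine (IsBigO.of_bound (C * E) ?_).trans hinv
    filter_upwards [hc, hsn.eventually_ge_atTop S] with n hn hsS
    refine (h (s n) hsS).2.trans ?_
    rw [Real.norm_of_nonneg (by positivity : 0 ≤ ‖P.sigL (s n)‖ * ‖s n‖⁻¹)]
    have := hexp n hn
    calc _ ≤ C * ‖P.sigL (s n)‖ / ‖s n‖ * E := by gcongr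
      _ = _ := by rw [div_eq_mul_inv]; ring
  have hVO : V =O[atTop] fun n => ‖P.sigL (s n)‖ := by
    refine IsBigO.of_bound (|P.kL| * E) ?_
    filter_upwards [hc] with n hn
    have h1 : ‖Complex.sin (s n * (P.c - P.a) + P.thL)‖ ≤ E := by
      refine (norm_sin_le_exp _).trans (le_trans (le_of_eq ?_) (hexp n hn))
      rw [← Complex.ofReal_sub, Complex.add_im, Complex.ofReal_im, add_zero,
        Complex.im_mul_ofReal, abs_mul, abs_of_pos hac]
    rw [hV, norm_mul, norm_mul, Complex.norm_real, Real.norm_eq_abs, norm_norm]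
    calc _ ≤ ‖P.sigL (s n)‖ * (|P.kL| * E) := by gcongr
      _ = _ := by ring
  have hdO : (fun n => X.dyL (s n ^ 2) P.c) =O[atTop] fun n => ‖P.sigL (s n)‖ := by
    simpa using (hd.trans hone).add hVO
  have hyO := hy.trans hone
  have hmain : (fun n => P.phi₂c (s n ^ 2) - (P.Δ24 / P.Δ12 : ℝ) * V n)
      =O[atTop] (fun n : ℤ => ‖P.sigL (s n)‖ * (1 / (n : ℝ))) := by
    refine ((hy.const_mul_left (P.Δ23 / P.Δ12 : ℂ)).add
      (hd.const_mul_left (P.Δ24 / P.Δ12 : ℂ))).congr_left fun n => ?_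
    rw [phi₂c, X.phi₁c_eq _ hP, X.dphi₁c_eq _ hP]
    push_cast
    ring
  refine ⟨hmain, ?_, ?_⟩
  · simpa using (hmain.trans hone).add (hVO.const_mul_left ((P.Δ24 / P.Δ12 : ℝ) : ℂ))
  · refine ((hyO.const_mul_left (-(P.Δ13 / P.Δ12) : ℂ)).add
      (hdO.const_mul_left (-(P.Δ14 / P.Δ12) : ℂ))).congr_left fun n => ?_
    rw [dphi₂c, X.phi₁c_eq _ hP, X.dphi₁c_eq _ hP]
    ring

/-- The asymptotics of the basic solution on `(c, b]`. -/
theorem isBigO_yR (X : P.Ext) (hP : P.Admissible) (hs : s =Θ[atTop] fun n : ℤ => (n : ℝ))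
    (him : ∃ c, ∀ᶠ n in atTop, |(s n).im| ≤ c) :
    (fun p : ℤ × ℝ => X.yR (s p.1 ^ 2) p.2
        - (P.Δ24 / P.Δ12 : ℝ) * (P.sigL (s p.1)
            * (P.kL * Complex.sin (s p.1 * (P.c - P.a) + P.thL)))
          * Complex.cos (s p.1 * (p.2 - P.c)))
      =O[atTop ×ˢ 𝓟 (Icc P.c P.b)] fun p => ‖P.sigL (s p.1)‖ * (1 / (p.1 : ℝ)) := by
  obtain ⟨h1, h2, h3⟩ := X.isBigO_phi₂c hP hs him
  obtain ⟨hsin, hcos⟩ := isBigO_trig him P.c P.b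
  have hfst := tendsto_fst (f := (atTop : Filter ℤ)) (g := 𝓟 (Icc P.c P.b))
  have h3' : (fun n => P.dphi₂c (s n ^ 2) / s n)
      =O[atTop] fun n : ℤ => ‖P.sigL (s n)‖ * (1 / (n : ℝ)) := by
    simpa only [div_eq_mul_inv, one_mul] using h3.mul hs.inv.1
  have hone : (fun n : ℤ => ‖P.sigL (s n)‖ * (1 / (n : ℝ))) =O[atTop] fun n => ‖P.sigL (s n)‖ := by
    simpa using (isBigO_refl (fun n => ‖P.sigL (s n)‖) atTop).mul isBigO_one_div_intCast
  have h := IsSol.isBigO_sub (s := s) (y := fun n => X.yR (s n ^ 2))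
    (y' := fun n => X.dyR (s n ^ 2)) (g := fun n => ‖P.sigL (s n)‖) X.contR X.boundR hP.hcb.le
    (fun n => X.isSol_right _) hs him (by simpa using h2) (by simpa using h3'.trans hone)
  have e1 := (h1.comp_tendsto hfst).mul hcos
  have e2 := (h3'.comp_tendsto hfst).mul hsin
  simp only [Function.comp_def, mul_one] at e1 e2
  refine ((h.add e1).add e2).congr_left fun p => ?_
  simp only [yR_c, dyR_c]
  ring

/-- The asymptotics of the basic solution on `[a, c)`. It is applied with `g = 1`, and with
`g = 1 / n` if `α11 = 0`. -/
theorem isBigO_yL (X : P.Ext) (hP : P.Admissible) {g : ℤ → ℝ}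
    (hs : s =Θ[atTop] fun n : ℤ => (n : ℝ)) (him : ∃ c, ∀ᶠ n in atTop, |(s n).im| ≤ c)
    (h0 : (fun _ : ℤ => (P.α11 : ℂ)) =O[atTop] g)
    (h1 : (fun n : ℤ => 1 / (n : ℝ)) =O[atTop] g) :
    (fun p : ℤ × ℝ => X.yL (s p.1 ^ 2) p.2
        - (P.α11 * Complex.cos (s p.1 * (p.2 - P.a))
          + -P.α10 / s p.1 * Complex.sin (s p.1 * (p.2 - P.a))))
      =O[atTop ×ˢ 𝓟 (Icc P.a P.c)] fun p => g p.1 * (1 / (p.1 : ℝ)) := by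
  have h2 : (fun n => -(P.α10 : ℂ) / s n) =O[atTop] g := by
    simp only [div_eq_mul_inv]
    refine IsBigO.trans ?_ h1
    simp only [one_div]
    exact hs.inv.1.const_mul_left _
  have h := IsSol.isBigO_sub (s := s) (y := fun n => X.yL (s n ^ 2))
    (y' := fun n => X.dyL (s n ^ 2)) (g := g) X.contL X.boundL hP.hac.le
    (fun n => X.isSol_left _) hs him (by simpa using h0) (by simpa using h2)
  simpa using h

end Sequence

section Eigenfunctions

variable {s : ℤ → ℂ} {i : Fin 2}

theorem uniformBigO_left (X : P.Ext) (hP : P.Admissible)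
    (hs : (fun n => s n - P.mu i n) =O[atTop] fun n : ℤ => 1 / (n : ℝ)) :
    UniformBigO (Ico P.a P.c) (fun n => P.phi (s n ^ 2))
      (fun n x => P.α11 * Real.cos (P.mu i n * (x - P.a))) (fun n => 1 / (n : ℝ)) := by
  have hΘ := isTheta_of_sub (isTheta_mu hP i) hs
  have him := eventually_abs_im_le hs
  have hfst := tendsto_fst (f := (atTop : Filter ℤ)) (g := 𝓟 (Icc P.a P.c))
  refine uniformBigO_of_isBigO (f := fun n => X.yL (s n ^ 2)) Ico_subset_Icc_self
    (fun n x hx => X.phi_left _ hx) ?_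
  have e1 := X.isBigO_yL hP (g := fun _ => 1) hΘ him
    (isBigO_const_const _ one_ne_zero _) isBigO_one_div_intCast
  have e2 := ((hΘ.inv.1.comp_tendsto hfst).mul (isBigO_trig him P.a P.c).1).const_mul_left
    (-(P.α10 : ℂ))
  have e3 := (isBigO_trig_sub hs P.a P.c).2.const_mul_left (P.α11 : ℂ)
  simp only [Function.comp_def, mul_one, one_mul, ← one_div] at e1 e2 e3
  refine ((e1.add e2).add e3).congr_left fun p => ?_
  push_cast
  ring

theorem uniformBigO_left_of_eq (X : P.Ext) (hP : P.Admissible) (h11 : P.α11 = 0)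
    (hs : (fun n => s n - P.mu i n) =O[atTop] fun n : ℤ => 1 / (n : ℝ)) :
    UniformBigO (Ico P.a P.c) (fun n => P.phi (s n ^ 2))
      (fun n x => -P.α10 / P.mu i n * Real.sin (P.mu i n * (x - P.a)))
      (fun n => 1 / (n : ℝ) ^ 2) := by
  have hΘ := isTheta_of_sub (isTheta_mu hP i) hs
  have him := eventually_abs_im_le hs
  have hfst := tendsto_fst (f := (atTop : Filter ℤ)) (g := 𝓟 (Icc P.a P.c))
  refine uniformBigO_of_isBigO (f := fun n => X.yL (s n ^ 2)) Ico_subset_Icc_self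
    (fun n x hx => X.phi_left _ hx) ?_
  have hmuΘ : (fun n => (P.mu i n : ℂ)) =Θ[atTop] fun n : ℤ => (n : ℝ) :=
    (IsTheta.of_norm_eventuallyEq_norm (Eventually.of_forall fun n =>
      Complex.norm_real (P.mu i n))).trans (isTheta_mu hP i)
  have hmu0 : (fun n => P.mu i n - P.mu i n : ℤ → ℂ) =O[atTop] fun n : ℤ => 1 / (n : ℝ) := by
    simpa using isBigO_zero _ _
  have hmus := (isBigO_trig (eventually_abs_im_le hmu0) P.a P.c).1
  -- The difference of the reciprocals is `(μ - s) / (s μ) = O(1/n³)`.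
  have hrec : (fun n => (s n)⁻¹ - (P.mu i n : ℂ)⁻¹) =O[atTop] fun n : ℤ => 1 / (n : ℝ) ^ 2 := by
    have h1 := ((hs.trans isBigO_one_div_intCast).neg_left).mul (hΘ.inv.1.mul hmuΘ.inv.1)
    refine IsBigO.congr' h1 ?_ (Eventually.of_forall fun n => by field_simp)
    have hne : ∀ {t : ℤ → ℂ}, t =Θ[atTop] (fun n : ℤ => (n : ℝ)) → ∀ᶠ n in atTop, t n ≠ 0 := by
      intro t ht
      filter_upwards [ht.eq_zero_iff, eventually_gt_atTop 0] with n hn h0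
      rw [Ne, hn]
      exact_mod_cast h0.ne'
    filter_upwards [hne hΘ, hne hmuΘ] with n h1 h2
    field_simp
    ring
  have e1 := X.isBigO_yL hP (g := fun n => 1 / (n : ℝ)) hΘ him
    (by simpa [h11] using isBigO_zero _ _) (isBigO_refl _ _)
  have e2 := ((hΘ.inv.1.comp_tendsto hfst).mul (isBigO_trig_sub hs P.a P.c).1).const_mul_left
    (-(P.α10 : ℂ))
  have e3 := ((hrec.comp_tendsto hfst).mul hmus).const_mul_left (-(P.α10 : ℂ))
  have hsq : ∀ n : ℤ, 1 / (n : ℝ) * (1 / (n : ℝ)) = 1 / (n : ℝ) ^ 2 := fun n => by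
    rw [one_div_mul_one_div, pow_two]
  simp only [Function.comp_def, mul_one, ← one_div, hsq, h11] at e1 e2 e3
  refine ((e1.add e2).add e3).congr_left fun p => ?_
  push_cast
  ring

/-- The case `x = c` of `isBigO_trig_sub`. -/
theorem isBigO_trig_c_sub (hP : P.Admissible)
    (hs : (fun n => s n - P.mu i n) =O[atTop] fun n : ℤ => 1 / (n : ℝ)) :
    (fun n => Complex.sin (s n * (P.c - P.a)) - Complex.sin (P.mu i n * (P.c - P.a)))
        =O[atTop] (fun n : ℤ => 1 / (n : ℝ)) ∧
      (fun n => Complex.cos (s n * (P.c - P.a)) - Complex.cos (P.mu i n * (P.c - P.a)))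
        =O[atTop] (fun n : ℤ => 1 / (n : ℝ)) := by
  have ht : Tendsto (fun n : ℤ => (n, P.c)) atTop (atTop ×ˢ 𝓟 (Icc P.a P.c)) :=
    tendsto_id.prodMk (tendsto_principal.2 (Eventually.of_forall fun _ =>
      right_mem_Icc.2 hP.hac.le))
  have h1 := (isBigO_trig_sub hs P.a P.c).1.comp_tendsto ht
  have h2 := (isBigO_trig_sub hs P.a P.c).2.comp_tendsto ht
  simp only [Function.comp_def] at h1 h2
  exact ⟨h1, h2⟩

theorem isBigO_ofReal_trig (m : ℤ → ℝ) (t : ℝ) :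
    (fun n => Complex.sin ((m n : ℂ) * t)) =O[atTop] (fun _ => (1 : ℝ)) ∧
      (fun n => Complex.cos ((m n : ℂ) * t)) =O[atTop] (fun _ => (1 : ℝ)) := by
  constructor
  · refine IsBigO.of_bound 1 (Eventually.of_forall fun n => ?_)
    rw [← Complex.ofReal_mul, ← Complex.ofReal_sin, Complex.norm_real, norm_one, mul_one]
    exact Real.abs_sin_le_one _
  · refine IsBigO.of_bound 1 (Eventually.of_forall fun n => ?_)
    rw [← Complex.ofReal_mul, ← Complex.ofReal_cos, Complex.norm_real, norm_one, mul_one]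
    exact Real.abs_cos_le_one _

theorem uniformBigO_right_of_ne (X : P.Ext) (hP : P.Admissible) (h11 : P.α11 ≠ 0)
    (hs : (fun n => s n - P.mu i n) =O[atTop] fun n : ℤ => 1 / (n : ℝ)) :
    UniformBigO (Ioc P.c P.b) (fun n => P.phi (s n ^ 2))
      (fun n x => -P.α11 * (P.Δ24 / P.Δ12) * P.mu i n
        * Real.sin (P.mu i n * (P.c - P.a)) * Real.cos (P.mu i n * (x - P.c)))
      (fun _ => 1) := by
  have hΘ := isTheta_of_sub (isTheta_mu hP i) hs
  have him := eventually_abs_im_le hs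
  have hfst := tendsto_fst (f := (atTop : Filter ℤ)) (g := 𝓟 (Icc P.c P.b))
  refine uniformBigO_of_isBigO (f := fun n => X.yR (s n ^ 2)) Ioc_subset_Icc_self
    (fun n x hx => X.phi_right _ hx) ?_
  have hmu : (fun n => (P.mu i n : ℂ)) =O[atTop] fun n : ℤ => (n : ℝ) :=
    (IsBigO.of_norm_left (by simpa using (isTheta_mu hP i).1.norm_left))
  have hn1 : (fun n : ℤ => (n : ℝ) * (1 / (n : ℝ))) =O[atTop] fun _ => (1 : ℝ) := by
    refine IsBigO.of_bound 1 ((eventually_gt_atTop 0).mono fun n hn => ?_)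
    have : (n : ℝ) ≠ 0 := by exact_mod_cast hn.ne'
    rw [mul_one_div_cancel this, one_mul]
  have hsig : ∀ t, P.sigL t = t := fun t => by rw [sigL, if_neg h11]
  have hth : P.thL = 0 := if_neg h11
  have hk : P.kL = -P.α11 := if_neg h11
  have hsigO : (fun n : ℤ => ‖P.sigL (s n)‖ * (1 / (n : ℝ))) =O[atTop] fun _ => (1 : ℝ) := by
    simp only [hsig]
    exact (hΘ.1.norm_left.mul (isBigO_refl _ _)).trans hn1
  have hcos := (isBigO_trig him P.c P.b).2
  have hcd := (isBigO_trig_sub hs P.c P.b).2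
  have hsd := (isBigO_trig_c_sub hP hs).1
  have hss : (fun n => Complex.sin ((P.mu i n : ℂ) * (P.c - P.a))) =O[atTop]
      fun _ => (1 : ℝ) := by
    simpa using (isBigO_ofReal_trig (P.mu i) (P.c - P.a)).1
  have hs1 : (fun n => Complex.sin (s n * (P.c - P.a))) =O[atTop] fun _ => (1 : ℝ) := by
    simpa using (hsd.trans isBigO_one_div_intCast).add hss
  -- The initial value at `c+` may be replaced by its value at the leading term.
  have hA : (fun n => s n * Complex.sin (s n * (P.c - P.a))
      - P.mu i n * Complex.sin (P.mu i n * (P.c - P.a))) =O[atTop] fun _ => (1 : ℝ) := by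
    have h1 := (hs.trans isBigO_one_div_intCast).mul hs1
    have h2 := (hmu.mul hsd).trans hn1
    rw [show (fun _ : ℤ => (1 : ℝ) * 1) = fun _ => 1 from by simp] at h1
    refine (h1.add h2).congr_left fun n => ?_
    ring
  have hB := (hmu.mul hss)
  simp only [mul_one] at hB
  have e1 := (X.isBigO_yR hP hΘ him).trans (hsigO.comp_tendsto hfst)
  have e2 := ((hA.comp_tendsto hfst).mul hcos).const_mul_left (-(P.α11 * (P.Δ24 / P.Δ12)) : ℂ)
  have e3 := (((hB.comp_tendsto hfst).mul hcd).trans (hn1.comp_tendsto hfst)).const_mul_left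
    (-(P.α11 * (P.Δ24 / P.Δ12)) : ℂ)
  simp only [Function.comp_def, mul_one, hsig, hth, hk, Complex.ofReal_zero, add_zero]
    at e1 e2 e3
  refine ((e1.add e2).add e3).congr_left fun p => ?_
  push_cast
  ring

theorem uniformBigO_right_of_eq (X : P.Ext) (hP : P.Admissible) (h11 : P.α11 = 0)
    (hs : (fun n => s n - P.mu i n) =O[atTop] fun n : ℤ => 1 / (n : ℝ)) :
    UniformBigO (Ioc P.c P.b) (fun n => P.phi (s n ^ 2))
      (fun n x => -P.α10 * (P.Δ24 / P.Δ12)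
        * Real.cos (P.mu i n * (P.c - P.a)) * Real.cos (P.mu i n * (x - P.c)))
      (fun n => 1 / (n : ℝ)) := by
  have hΘ := isTheta_of_sub (isTheta_mu hP i) hs
  have him := eventually_abs_im_le hs
  have hfst := tendsto_fst (f := (atTop : Filter ℤ)) (g := 𝓟 (Icc P.c P.b))
  refine uniformBigO_of_isBigO (f := fun n => X.yR (s n ^ 2)) Ioc_subset_Icc_self
    (fun n x hx => X.phi_right _ hx) ?_
  have hsig : ∀ t, P.sigL t = 1 := fun t => by rw [sigL, if_pos h11]
  have hth : P.thL = Real.pi / 2 := if_pos h11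
  have hk : P.kL = -P.α10 := if_pos h11
  have hcc : (fun n => Complex.cos ((P.mu i n : ℂ) * (P.c - P.a))) =O[atTop]
      fun _ => (1 : ℝ) := by
    simpa using (isBigO_ofReal_trig (P.mu i) (P.c - P.a)).2
  have e1 := X.isBigO_yR hP hΘ him
  have e2 := (((isBigO_trig_c_sub hP hs).2.comp_tendsto hfst).mul
    (isBigO_trig him P.c P.b).2).const_mul_left (-(P.α10 * (P.Δ24 / P.Δ12)) : ℂ)
  have e3 := ((hcc.comp_tendsto hfst).mul (isBigO_trig_sub hs P.c P.b).2).const_mul_left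
    (-(P.α10 * (P.Δ24 / P.Δ12)) : ℂ)
  simp only [Function.comp_def, mul_one, one_mul, norm_one, hsig, hth, hk, sin_add_half_pi]
    at e1 e2 e3
  refine ((e1.add e2).add e3).congr_left fun p => ?_
  push_cast
  ring

end Eigenfunctions

end Ext

end SLProblem

theorem mainTheorem6 (P : SLProblem) (hP : P.Admissible)
    (hα : P.α10 ≠ 0 ∨ P.α11 ≠ 0) (hΔ : P.Δ24 ≠ 0) :
    (∀ lam : ℂ, P.IsBasicSolution lam (P.phi lam)) ∧
    (∀ lam ∈ P.eigenvalues, lam.im = 0) ∧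
    (∃ (N : Fin 2 → ℤ) (s : Fin 2 → ℤ → ℂ), P.IsEnumeration N s) ∧
    ∀ (N : Fin 2 → ℤ) (s : Fin 2 → ℤ → ℂ), P.IsEnumeration N s → ∀ i : Fin 2,
      (∀ n ≥ N i, P.IsEigenfunction (s i n ^ 2) (P.phi (s i n ^ 2))) ∧
      (P.α11 ≠ 0 →
        UniformBigO (Set.Ico P.a P.c) (fun n => P.phi (s i n ^ 2))
          (fun n x => P.α11 * Real.cos (P.mu i n * (x - P.a)))
          (fun n => 1 / (n : ℝ)) ∧
        UniformBigO (Set.Ioc P.c P.b) (fun n => P.phi (s i n ^ 2))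
          (fun n x => -P.α11 * (P.Δ24 / P.Δ12) * P.mu i n
            * Real.sin (P.mu i n * (P.c - P.a)) * Real.cos (P.mu i n * (x - P.c)))
          (fun _ => 1)) ∧
      (P.α11 = 0 →
        UniformBigO (Set.Ico P.a P.c) (fun n => P.phi (s i n ^ 2))
          (fun n x => -P.α10 / P.mu i n * Real.sin (P.mu i n * (x - P.a)))
          (fun n => 1 / (n : ℝ) ^ 2) ∧
        UniformBigO (Set.Ioc P.c P.b) (fun n => P.phi (s i n ^ 2))
          (fun n x => -P.α10 * (P.Δ24 / P.Δ12)
            * Real.cos (P.mu i n * (P.c - P.a)) * Real.cos (P.mu i n * (x - P.c)))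
          (fun n => 1 / (n : ℝ))) := by
  obtain ⟨X⟩ := hP.nonempty_ext
  refine ⟨fun lam => X.isBasicSolution_phi lam hP, fun lam h =>
    X.im_eq_zero_of_charFun_eq_zero hP hα ((X.mem_eigenvalues_iff hP hα).1 h),
    SLProblem.exists_isEnumeration X hP hα hΔ, fun N s hs i => ⟨fun n hn => ?_, fun h => ?_,
      fun h => ?_⟩⟩
  · exact X.isEigenfunction_phi _ hP hα
      ((X.mem_eigenvalues_iff hP hα).1 (hs.1.mapsTo (x := (i, n)) hn))
  · exact ⟨X.uniformBigO_left hP (hs.2 i), X.uniformBigO_right_of_ne hP h (hs.2 i)⟩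
  · exact ⟨X.uniformBigO_left_of_eq hP h (hs.2 i), X.uniformBigO_right_of_eq hP h (hs.2 i)⟩
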